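/- All graphs are finite and simple. A $4$-Steiner root of a graph $G=(V,E)$ is a tree $T$ with $V\subseteq V(T)$ such that distinct $u,v\in V$ are adjacent in $G$ iff $dist_T(u,v)\le 4$; the nodes in $V$ are called real, the others Steiner. For $A\subseteq V(T)$, $T\langle A\rangle$ is the smallest subtree of $T$ containing $A$. Two trees (with real nodes in $V$) are Steiner-equivalent if they have the same real nodes and there is an isomorphism between them that fixes every real node. A clique-intersection of $G$ is an intersection of a nonempty family of maximal cliques. Let $X$ be a nonempty clique-intersection. A vertex $v\in X$ is $X$-constrained if either some clique-intersection $X'\subsetneq X$ has $v\in X'$ and $|X'|\ge 2$, or there are clique-intersections $X_1\supsetneq X$ and $X_2$ with $X\cap X_2=\{v\}\subsetneq X_1\cap X_2$; otherwise it is $X$-free (the same definition is used for any vertex set $X$). A $4$-Steiner root $T$ of $G$ is well-structured if for every nonempty clique-intersection $X$: (1) all $X$-free vertices are leaves of $T\langle X\rangle$ of eccentricity $diam(T\langle X\rangle)$; (2) there is a central node $c$ of $T\langle X\rangle$ that is, for all $X$-free vertices except maybe one, a closest central node; (3) on a path from the center of $T\langle X\rangle$ to an $X$-free vertex, all nodes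 strictly between them are Steiner nodes of degree two in $T\langle X\rangle$; (4) if $X$ is a maximal clique having an $X$-free vertex, then $diam(T\langle X\rangle)=4$. A rooted clique-tree of $G$ is a rooted tree whose nodes are the maximal cliques of $G$ and in which, for each vertex $v$, the cliques containing $v$ induce a subtree. For a node $K_i$ put $S_i=K_i\cap K_{p(i)}$, where $K_{p(i)}$ is its father ($S_i=\emptyset$ for the root). The local clique data of $K_i$ consist of $|K_i|$, the set $S_i$, the set of its $S_i$-free vertices, and the list (with its length) of the distinct sets $K_i\cap K_j$, $j\ne i$, all given as $0$-$1$ vectors indexed by $K_i$. **Theorem.** There are two algorithms (programs for a unit-cost random-access machine with addition and subtraction, random access to a read-only input, and a write-only output) such that for every connected graph $G$, every rooted clique-tree of $G$ and every leaf $K_i$ of it: * (preprocessing) given $G$, the rooted clique-tree and $i$, the first algorithm outputs the local clique data of $K_i$ in time polynomial in the size of its input; * given random access to the local clique data of $K_i$, the second algorithm outputs, in time polynomial in $|K_i|$, a finite family $\mathcal T_i$ of $4$-Steiner roots of $G[K_i]$ with the following property: for every well-structured $4$-Steiner root $T$ of $G$, the tree $T\langle K_i\rangle$ is Steiner-equivalent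 to some member of $\mathcal T_i$. -/

import Mathlib

/-! ### Graphs, Steiner roots, well-structured roots -/

section Graphs

variable {V W W' : Type*}

/-- The `k`-th power of `G`: `u` and `v` are adjacent iff `0 < dist u v ≤ k`. (The distance of two
vertices in different components has the value `0` here, so such vertices are not adjacent.) -/
def graphPower (G : SimpleGraph V) (k : ℕ) : SimpleGraph V where
  Adj u v := 0 < G.dist u v ∧ G.dist u v ≤ k
  symm := ⟨fun u v h => by simpa only [SimpleGraph.dist_comm] using h⟩
  loopless := ⟨fun v h => by simp at h⟩

/-- `T` is a `k`-Steiner root of `G`, where `ρ` is the identification of the vertices of `G` with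
nodes of `T` (the real nodes; the nodes outside the range of `ρ` are the Steiner nodes):
`T` is a tree and `G` is an induced subgraph of the `k`-th power of `T`. -/
structure IsSteinerRoot (k : ℕ) (G : SimpleGraph V) (T : SimpleGraph W) (ρ : V → W) : Prop where
  isTree : T.IsTree
  injective : Function.Injective ρ
  induced : (graphPower T k).comap ρ = G

/-- Node set of the smallest subtree of the tree `T` that contains the set `A` of nodes. -/
def spanNodes (T : SimpleGraph W) (A : Set W) : Set W :=
  ⋂₀ {B | A ⊆ B ∧ (T.induce B).Connected}

/-- The smallest subtree `T⟨A⟩` of the tree `T` that contains the set `A` of nodes. -/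
abbrev spanTree (T : SimpleGraph W) (A : Set W) : SimpleGraph (spanNodes T A) :=
  T.induce (spanNodes T A)

/-- `K` is an inclusion-wise maximal clique of `G`. -/
def IsMaxClique (G : SimpleGraph V) (K : Set V) : Prop :=
  Maximal (fun s : Set V => G.IsClique s) K

/-- `X` is a clique-intersection: the intersection of a (nonempty) family of maximal cliques. -/
def IsCliqueInter (G : SimpleGraph V) (X : Set V) : Prop :=
  ∃ F : Set (Set V), F.Nonempty ∧ (∀ K ∈ F, IsMaxClique G K) ∧ X = ⋂₀ F

/-- `v` is internally `X`-constrained. -/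
def IsInternallyConstrained (G : SimpleGraph V) (X : Set V) (v : V) : Prop :=
  ∃ X', IsCliqueInter G X' ∧ X' ⊂ X ∧ v ∈ X' ∧ X'.Nontrivial

/-- `v` is `(X, X₁, X₂)`-sandwiched for some clique-intersections `X₁`, `X₂`. -/
def IsSandwiched (G : SimpleGraph V) (X : Set V) (v : V) : Prop :=
  ∃ X₁ X₂, IsCliqueInter G X₁ ∧ IsCliqueInter G X₂ ∧ X ⊂ X₁ ∧ X ∩ X₂ = {v} ∧ {v} ⊂ X₁ ∩ X₂

/-- `v` is `X`-free: a vertex of `X` that is not `X`-constrained. -/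
def IsFree (G : SimpleGraph V) (X : Set V) (v : V) : Prop :=
  v ∈ X ∧ ¬ IsInternallyConstrained G X v ∧ ¬ IsSandwiched G X v

/-- Well-structured `4`-Steiner roots. For every nonempty clique-intersection `X`:
* every `X`-free vertex is a leaf of `T⟨X⟩` (the only node of a one-node tree counts as a leaf)
  whose eccentricity is the diameter of `T⟨X⟩`;
* some central node `c` of `T⟨X⟩` is a closest central node for all `X`-free vertices but at
  most one (the vertex `e`);
* on a path from an `X`-free vertex to the center, all the nodes strictly between them are
  Steiner nodes of degree two (degree in `T⟨X⟩`);
* if `X` is a maximal clique with an `X`-free vertex, then `T⟨X⟩` has diameter `4`. -/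
structure IsWellStructured (G : SimpleGraph V) (T : SimpleGraph W) (ρ : V → W) : Prop where
  root : IsSteinerRoot 4 G T ρ
  leaf : ∀ X : Set V, IsCliqueInter G X → X.Nonempty →
    ∀ v, IsFree G X v → ∀ w : spanNodes T (ρ '' X), (w : W) = ρ v →
      ((spanTree T (ρ '' X)).neighborSet w).ncard ≤ 1 ∧
      (spanTree T (ρ '' X)).eccent w = (spanTree T (ρ '' X)).ediam
  side : ∀ X : Set V, IsCliqueInter G X → X.Nonempty →
    ∃ c ∈ (spanTree T (ρ '' X)).center, ∃ e : V, ∀ v, IsFree G X v → v ≠ e →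
      ∀ c' ∈ (spanTree T (ρ '' X)).center, T.dist (ρ v) c ≤ T.dist (ρ v) c'
  inner : ∀ X : Set V, IsCliqueInter G X → X.Nonempty →
    ∀ v, IsFree G X v → ∀ c ∈ (spanTree T (ρ '' X)).center,
      ∀ w : spanNodes T (ρ '' X), w ∉ (spanTree T (ρ '' X)).center → (w : W) ≠ ρ v →
        T.dist (ρ v) w + T.dist w c = T.dist (ρ v) c →
          (w : W) ∉ Set.range ρ ∧ ((spanTree T (ρ '' X)).neighborSet w).ncard = 2
  diam : ∀ X : Set V, IsMaxClique G X → (∃ v, IsFree G X v) →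
    (spanTree T (ρ '' X)).diam = 4

/-- Steiner equivalence of two trees with real nodes, where `a v w` says that the node `w` of `A`
is the vertex `v`, and likewise for `b`: an isomorphism that fixes the real nodes (and maps
Steiner nodes to Steiner nodes, so that both trees have the same real nodes). -/
def SteinerEquivalent (A : SimpleGraph W) (a : V → W → Prop)
    (B : SimpleGraph W') (b : V → W' → Prop) : Prop :=
  ∃ φ : A ≃g B, ∀ v w, a v w ↔ b v (φ w)

end Graphs

/-! ### Rooted clique-trees -/

/-- A rooted clique-tree of a graph: a tree on the maximal cliques (node `i` is the clique
`clique i`, every maximal clique is exactly one node) such that the cliques containing any fixed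
vertex induce a subtree, with one node chosen as the root. -/
structure RootedCliqueTree {n : ℕ} (G : SimpleGraph (Fin n)) where
  size : ℕ
  clique : Fin size → Finset (Fin n)
  clique_injective : Function.Injective clique
  isMaxClique_iff : ∀ K : Finset (Fin n), IsMaxClique G (K : Set (Fin n)) ↔ ∃ i, clique i = K
  tree : SimpleGraph (Fin size)
  isTree : tree.IsTree
  subtree : ∀ v : Fin n, (tree.induce {i | v ∈ clique i}).Connected
  root : Fin size

namespace RootedCliqueTree

variable {n : ℕ} {G : SimpleGraph (Fin n)} (C : RootedCliqueTree G)

/-- `j` is the father of `i`. -/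
def IsFather (j i : Fin C.size) : Prop :=
  C.tree.Adj j i ∧ C.tree.dist C.root i = C.tree.dist C.root j + 1

/-- `i` is a leaf of the rooted tree: it has no children. -/
def IsLeaf (i : Fin C.size) : Prop := ∀ j, ¬ C.IsFather i j

open Classical in
/-- `S_i`, the intersection of `K_i` with its father; it is empty for the root. -/
noncomputable def sep (i : Fin C.size) : Finset (Fin n) :=
  (C.clique i).filter fun v => ∃ j, C.IsFather j i ∧ v ∈ C.clique j

open Classical in
/-- The vertices of `S_i` that are `S_i`-free. -/
noncomputable def freeSep (i : Fin C.size) : Finset (Fin n) :=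
  (C.sep i).filter fun v => IsFree G (C.sep i : Set (Fin n)) v

/-- The distinct sets of the form `K_i ∩ K_j`, `j ≠ i`. -/
def traces (i : Fin C.size) : List (Finset (Fin n)) :=
  (((List.finRange C.size).filter (· ≠ i)).map fun j => C.clique i ∩ C.clique j).dedup

/-- A subset of `K_i` as a `0`-`1` vector of length `|K_i|`; the vertices of `K_i` are taken in
increasing order. -/
def row (i : Fin C.size) (A : Finset (Fin n)) : List ℕ :=
  List.ofFn fun p => if (C.clique i).orderEmbOfFin rfl p ∈ A then 1 else 0

/-- The local clique data of `K_i`: the number of vertices of `K_i`, the number of traces, `S_i`,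
the set of `S_i`-free vertices, and the traces. -/
noncomputable def localData (i : Fin C.size) : List ℕ :=
  [(C.clique i).card, (C.traces i).length] ++ C.row i (C.sep i) ++ C.row i (C.freeSep i) ++
    (C.traces i).flatMap (C.row i)

open Classical in
/-- Encoding of the graph, the rooted clique-tree and a node `i` as a word: numbers of vertices
and of tree nodes, the root, `i`, the adjacency matrix of the graph, the incidence matrix of the
cliques, and the adjacency matrix of the tree. -/
noncomputable def input (i : Fin C.size) : List ℕ :=
  [n, C.size, (C.root : ℕ), (i : ℕ)] ++
    (List.finRange n).flatMap (fun u => (List.finRange n).map fun v =>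
      if G.Adj u v then 1 else 0) ++
    (List.finRange C.size).flatMap (fun j => (List.finRange n).map fun v =>
      if v ∈ C.clique j then 1 else 0) ++
    (List.finRange C.size).flatMap (fun j => (List.finRange C.size).map fun l =>
      if C.tree.Adj j l then 1 else 0)

end RootedCliqueTree

/-! ### Output format: families of trees with real nodes -/

/-- A graph on the nodes `0, …, size - 1` given by a list of edges, together with the nodes that
are the first, second, …, `k`-th real node. -/
structure TreeCode (k : ℕ) where
  size : ℕ
  edges : List (Fin size × Fin size)
  label : Fin k → Fin size

namespace TreeCode

variable {k : ℕ}

def graph (D : TreeCode k) : SimpleGraph (Fin D.size) :=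
  SimpleGraph.fromRel fun a b => (a, b) ∈ D.edges

/-- The identification of the vertices of a set `K` of size `k` (in increasing order) with nodes. -/
def real {n : ℕ} {K : Finset (Fin n)} (D : TreeCode K.card) (v : K) : Fin D.size :=
  D.label ((K.orderIsoOfFin rfl).symm v)

def encode (D : TreeCode k) : List ℕ :=
  [D.size, D.edges.length] ++ D.edges.flatMap (fun e => [(e.1 : ℕ), (e.2 : ℕ)]) ++
    List.ofFn fun p => (D.label p : ℕ)

/-- Encoding of a finite family: the number of members, then the members. -/
def encodeFamily (F : List (TreeCode k)) : List ℕ :=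
  F.length :: F.flatMap encode

end TreeCode

/-! ### Random-access machines

Structured programs for a random-access machine with registers, an indirectly addressed work
memory, a random-access read-only input, and a write-only output. The arithmetic operations are
addition and truncated subtraction; every elementary operation and every test costs one step. -/

namespace RAM

inductive Prog
  /-- `R x := c` -/
  | const (x c : ℕ)
  /-- `R x := R y` -/
  | move (x y : ℕ)
  /-- `R x := R y + R z` -/
  | add (x y z : ℕ)
  /-- `R x := R y - R z`, truncated at `0` -/
  | sub (x y z : ℕ)
  /-- `R x := ` the entry of the input at position `R y` (`0` beyond the end) -/
  | read (x y : ℕ)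
  /-- `R x := M (R y)` -/
  | load (x y : ℕ)
  /-- `M (R x) := R y` -/
  | store (x y : ℕ)
  /-- append `R x` to the output -/
  | emit (x : ℕ)
  | seq (a b : Prog)
  /-- if `R x ≠ 0` then `a` else `b` -/
  | ite (x : ℕ) (a b : Prog)
  /-- while `R x ≠ 0` do `a` -/
  | loop (x : ℕ) (a : Prog)

structure State where
  reg : ℕ → ℕ
  mem : ℕ → ℕ
  out : List ℕ

def State.setReg (s : State) (x c : ℕ) : State :=
  { s with reg := Function.update s.reg x c }

def State.start : State := ⟨fun _ => 0, fun _ => 0, []⟩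

/-- `Exec inp P s t s'`: on the input `inp`, the program `P` started in the state `s` halts after
`t` steps in the state `s'`. -/
inductive Exec (inp : List ℕ) : Prog → State → ℕ → State → Prop
  | const (x c s) : Exec inp (.const x c) s 1 (s.setReg x c)
  | move (x y s) : Exec inp (.move x y) s 1 (s.setReg x (s.reg y))
  | add (x y z s) : Exec inp (.add x y z) s 1 (s.setReg x (s.reg y + s.reg z))
  | sub (x y z s) : Exec inp (.sub x y z) s 1 (s.setReg x (s.reg y - s.reg z))
  | read (x y s) : Exec inp (.read x y) s 1 (s.setReg x (inp.getD (s.reg y) 0))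
  | load (x y s) : Exec inp (.load x y) s 1 (s.setReg x (s.mem (s.reg y)))
  | store (x y s) : Exec inp (.store x y) s 1
      { s with mem := Function.update s.mem (s.reg x) (s.reg y) }
  | emit (x s) : Exec inp (.emit x) s 1 { s with out := s.out ++ [s.reg x] }
  | seq {a b s s' s'' t t'} : Exec inp a s t s' → Exec inp b s' t' s'' →
      Exec inp (.seq a b) s (t + t') s''
  | iteTrue {x a b s s' t} : s.reg x ≠ 0 → Exec inp a s t s' →
      Exec inp (.ite x a b) s (t + 1) s'
  | iteFalse {x a b s s' t} : s.reg x = 0 → Exec inp b s t s' →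
      Exec inp (.ite x a b) s (t + 1) s'
  | loopDone {x a s} : s.reg x = 0 → Exec inp (.loop x a) s 1 s
  | loopStep {x a s s' s'' t t'} : s.reg x ≠ 0 → Exec inp a s t s' →
      Exec inp (.loop x a) s' t' s'' → Exec inp (.loop x a) s (t + t' + 1) s''

/-- On the input `inp`, the program `P` halts after at most `b` steps with the output `out`. -/
def OutputsWithin (P : Prog) (inp out : List ℕ) (b : ℕ) : Prop :=
  ∃ t s, Exec inp P State.start t s ∧ t ≤ b ∧ s.out = out

end RAM

/-! Let `K` be a leaf clique with separator `S`. Every other maximal clique meets `K` inside `S`, so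
the vertices of `K \ S` are `K`-free, and there is at least one of them. A well-structured root
therefore spans on `K` a tree of diameter `4` with center `c`, in which each vertex outside `S`
hangs at `c` on a private path of length two (`IsLeafClique.exists_isLeafCenter`). If two vertices
of `S` at distance two from `c` had different fathers, `c` would be the midpoint of the path between
them; every vertex of the father clique, being within distance `4` of both, would be within distance
`2` of `c`, and the father clique would be contained in `K` (`IsLeafCenter.father_eq`). So the
spanned tree is given by `c`, one child `b` of `c`, and one of five types for each vertex. The only
choice that threatens to be exponential is the set `L` of vertices below `b`, as opposed to the set
`U` of the other children of `c` in `S`.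

If `L` has at most one vertex, or `U` is empty, there is little to guess. Otherwise `S` is spread
over both sides of the edge `cb`. Every maximal clique consists of the real nodes in a ball of
radius two (`IsMaxClique.exists_ball`), and the position of the center of that ball relative to `cb`
leaves few traces on `K`: the sets `S`, `S \ L`, `S \ U`, and sets with at most two vertices
(`IsBistar.trace_cases`). If `S \ L` or `S \ U` occurs, it reveals `L`. If neither occurs, every
vertex of `U` that is not `S`-free forms a trace together with a real center, while no vertex of `L`
does; and since `c` and `b` are both central in the tree spanned by `S`, the condition on closest
central nodes puts all `S`-free vertices of `L ∪ U` but one on the same side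
(`IsBistar.exists_exception`). In all cases `L` agrees, away from `c` and `b`, with one of six base
sets computable from the local data, changed in at most one vertex (`exists_baseSet`).

The algorithm for a leaf runs through all choices of `c`, `b`, the exceptional vertex, a trace and
one of six modes. Each choice yields a tree with all real nodes within distance two of one node,
hence a root of the clique, so nothing has to be tested. The number of traces may be large compared
with `|K|`, but whenever traces matter there are at most `|K|² + 4` of them, and the algorithm looks
at no more than that. Preprocessing is polynomial because freeness can be tested with single maximal
cliques instead of arbitrary clique-intersections. Both programs are written with bounded sums and
loops, whose running time is polynomial in the values of the variables. -/

/-! ### A language of list comprehensions and its compilation to random-access machines -/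

namespace RAM

/-- Arithmetic expressions with bounded sums over named variables. -/
inductive Ex
  | const (c : ℕ)
  | var (x : ℕ)
  | add (a b : Ex)
  | sub (a b : Ex)
  | read (a : Ex)
  | cond (c a b : Ex)
  /-- the sum of `a` over all values of the variable `x` below the value of the variable `y` -/
  | sum (x y : ℕ) (a : Ex)

namespace Ex

def eval (inp : List ℕ) : Ex → (ℕ → ℕ) → ℕ
  | const c, _ => c
  | var x, σ => σ x
  | add a b, σ => a.eval inp σ + b.eval inp σ
  | sub a b, σ => a.eval inp σ - b.eval inp σ
  | read a, σ => inp.getD (a.eval inp σ) 0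
  | cond c a b, σ => if c.eval inp σ ≠ 0 then a.eval inp σ else b.eval inp σ
  | sum x y a, σ => ∑ v ∈ Finset.range (σ y), a.eval inp (Function.update σ x v)

/-- The variable `x` lives in register `2 * x`; the value of the expression goes to register
`2 * d + 1`, and of the odd registers only those from `2 * d + 1` on are used. -/
def comp : Ex → ℕ → Prog
  | const c, d => .const (2 * d + 1) c
  | var x, d => .move (2 * d + 1) (2 * x)
  | add a b, d => .seq (a.comp d) (.seq (b.comp (d + 1)) (.add (2 * d + 1) (2 * d + 1) (2 * d + 3)))
  | sub a b, d => .seq (a.comp d) (.seq (b.comp (d + 1)) (.sub (2 * d + 1) (2 * d + 1) (2 * d + 3)))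
  | read a, d => .seq (a.comp d) (.read (2 * d + 1) (2 * d + 1))
  | cond c a b, d => .seq (c.comp d) (.ite (2 * d + 1) (a.comp d) (b.comp d))
  -- Register `2 * d + 3` saves the old value of `x`, and `2 * d + 5` counts down from a copy of `y`
  -- taken before `x` is reset; so the case `x = y` is harmless.
  | sum x y a, d =>
      .seq (.seq (.move (2 * d + 3) (2 * x)) (.seq (.move (2 * d + 5) (2 * y))
        (.seq (.const (2 * d + 1) 0) (.const (2 * x) 0))))
      (.seq (.loop (2 * d + 5) (.seq (a.comp (d + 3)) (.seq (.add (2 * d + 1) (2 * d + 1) (2 * d + 7))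
        (.seq (.const (2 * d + 7) 1) (.seq (.add (2 * x) (2 * x) (2 * d + 7))
          (.sub (2 * d + 5) (2 * d + 5) (2 * d + 7)))))))
        (.move (2 * x) (2 * d + 3)))

/-- A bound for the running time in terms of a bound for the values of the variables. -/
noncomputable def cost : Ex → Polynomial ℕ
  | const _ => 1
  | var _ => 1
  | add a b => a.cost + b.cost + 1
  | sub a b => a.cost + b.cost + 1
  | read a => a.cost + 1
  | cond c a b => c.cost + a.cost + b.cost + 1
  -- A round costs the body, four instructions and one test. The additional six steps are four for
  -- the setup, the last test, and the restoration of `x`.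
  | sum _ _ a => Polynomial.X * (a.cost + 5) + 6

end Ex

/-- The values of the variables in a state. -/
def State.vals (s : State) : ℕ → ℕ := fun x => s.reg (2 * x)

/-- `s'` differs from `s` only in odd registers from `2 * d + 1` on (and in the memory). -/
def State.Agree (d : ℕ) (s s' : State) : Prop :=
  ∀ r, r % 2 = 0 ∨ r < 2 * d + 1 → s'.reg r = s.reg r

theorem State.Agree.vals {d : ℕ} {s s' : State} (h : s.Agree d s') : s'.vals = s.vals :=
  funext fun x => h _ (Or.inl (by omega))

theorem State.Agree.mono {d e : ℕ} {s s' : State} (h : s.Agree e s') (hde : d ≤ e) :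
    s.Agree d s' :=
  fun r hr => h r (by omega)

theorem State.Agree.trans {d : ℕ} {s s' s'' : State} (h : s.Agree d s') (h' : s'.Agree d s'') :
    s.Agree d s'' :=
  fun r hr => (h' r hr).trans (h r hr)

theorem State.setReg_reg (s : State) (x c r : ℕ) :
    (s.setReg x c).reg r = if r = x then c else s.reg r := by
  simp [State.setReg, Function.update_apply]

theorem State.setReg_out (s : State) (x c : ℕ) : (s.setReg x c).out = s.out := rfl

theorem State.agree_setReg (s : State) (d e c : ℕ) (h : d ≤ e) :
    s.Agree d (s.setReg (2 * e + 1) c) := by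
  intro r hr
  rw [State.setReg_reg, if_neg (by omega)]

/-- Loop invariant: `x` holds `j` and `m` rounds remain. The condition `j + m ≤ B` keeps all
variables below the bound that the cost of the body refers to. -/
theorem exec_loop_sum {inp : List ℕ} {a : Ex} {d x B : ℕ}
    (ih : ∀ s : State, (∀ z, s.vals z ≤ B) → ∃ t s', Exec inp (a.comp (d + 3)) s t s' ∧
      t ≤ a.cost.eval B ∧ s'.reg (2 * (d + 3) + 1) = a.eval inp s.vals ∧
      s.Agree (d + 3) s' ∧ s'.out = s.out) (σ : ℕ → ℕ) (hσ : ∀ z, σ z ≤ B) (m : ℕ) :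
    ∀ (j : ℕ) (s : State), s.vals = Function.update σ x j → j + m ≤ B →
      s.reg (2 * d + 5) = m →
      ∃ t s', Exec inp (.loop (2 * d + 5) (.seq (a.comp (d + 3))
        (.seq (.add (2 * d + 1) (2 * d + 1) (2 * d + 7))
        (.seq (.const (2 * d + 7) 1) (.seq (.add (2 * x) (2 * x) (2 * d + 7))
          (.sub (2 * d + 5) (2 * d + 5) (2 * d + 7))))))) s t s' ∧
        t ≤ m * (a.cost.eval B + 5) + 1 ∧
        s'.reg (2 * d + 1) = s.reg (2 * d + 1) +
          ∑ v ∈ Finset.range m, a.eval inp (Function.update σ x (j + v)) ∧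
        (∀ r, r ≠ 2 * x → (r % 2 = 0 ∨ r < 2 * d + 1 ∨ r = 2 * d + 3) → s'.reg r = s.reg r) ∧
        s'.out = s.out := by
  induction m with
  | zero =>
    intro j s hs hj hm
    exact ⟨1, s, .loopDone hm, by simp, by simp, fun _ _ _ => rfl, rfl⟩
  | succ m IH =>
    intro j s hs hj hm
    have hx : s.reg (2 * x) = j := by
      have := congrFun hs x
      simpa [State.vals] using this
    obtain ⟨t, s₁, he, ht, hv, hag, ho⟩ := ih s (by
      intro z
      rw [hs, Function.update_apply]
      split_ifs
      · omega
      · exact hσ z)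
    have hl : ∀ r, r ≠ 2 * x → (r % 2 = 0 ∨ r < 2 * d + 1 ∨ r = 2 * d + 3) → s₁.reg r = s.reg r :=
      fun r h1 h2 => hag r (by omega)
    have h1 : s₁.reg (2 * d + 1) = s.reg (2 * d + 1) := hag _ (by omega)
    have h5 : s₁.reg (2 * d + 5) = m + 1 := (hag _ (by omega)).trans hm
    have hx' : s₁.reg (2 * x) = j := (hag _ (by omega)).trans hx
    have hv' : s₁.reg (2 * d + 7) = a.eval inp (Function.update σ x j) := by
      rw [← hs, ← hv, show 2 * (d + 3) + 1 = 2 * d + 7 by ring]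
    set s₂ := s₁.setReg (2 * d + 1) (s₁.reg (2 * d + 1) + s₁.reg (2 * d + 7)) with hs₂
    set s₃ := s₂.setReg (2 * d + 7) 1 with hs₃
    set s₄ := s₃.setReg (2 * x) (s₃.reg (2 * x) + s₃.reg (2 * d + 7)) with hs₄
    set s₅ := s₄.setReg (2 * d + 5) (s₄.reg (2 * d + 5) - s₄.reg (2 * d + 7)) with hs₅
    have e5 : ∀ r, s₅.reg r = if r = 2 * d + 5 then m else if r = 2 * x then j + 1 else
        if r = 2 * d + 7 then 1 else
        if r = 2 * d + 1 then s.reg (2 * d + 1) + a.eval inp (Function.update σ x j) else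
        s₁.reg r := by
      intro r
      have n1 : 2 * d + 5 ≠ 2 * x := by omega
      have n2 : 2 * d + 7 ≠ 2 * x := by omega
      have n3 : 2 * x ≠ 2 * d + 7 := by omega
      have n4 : 2 * x ≠ 2 * d + 1 := by omega
      simp only [hs₅, hs₄, hs₃, hs₂, State.setReg_reg, n1, n2, n3, n4, h1, h5, hx', hv']
      simp
    obtain ⟨t', s', he', ht', hv'', hag', ho'⟩ := IH (j + 1) s₅ (by
      funext z
      rw [Function.update_apply]
      simp only [State.vals, e5]
      rw [if_neg (by omega)]
      by_cases hz : z = x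
      · simp [hz]
      · rw [if_neg (by omega), if_neg (by omega), if_neg (by omega), if_neg hz]
        have := congrFun hs z
        rw [Function.update_apply, if_neg hz] at this
        rw [← this]
        exact hag _ (by omega)) (by omega) (by rw [e5, if_pos rfl])
    refine ⟨_, s', .loopStep (by omega) (.seq he (.seq (.add _ _ _ _) (.seq (.const _ _ _)
      (.seq (.add _ _ _ _) (.sub _ _ _ _))))) he', ?_, ?_, ?_, ?_⟩
    · nlinarith
    · rw [hv'', e5, if_neg (by omega), if_neg (by omega), if_neg (by omega), if_pos rfl,
        Finset.sum_range_succ']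
      simp only [add_zero]
      rw [add_assoc, add_comm (a.eval inp _)]
      congr 2
      refine Finset.sum_congr rfl fun v _ => ?_
      rw [show j + 1 + v = j + (v + 1) by ring]
    · intro r hr hr'
      rw [hag' r hr hr', e5, if_neg (by omega), if_neg (by omega), if_neg (by omega),
        if_neg (by omega)]
      exact hl r hr hr'
    · rw [ho', ← ho]
      rfl

/-- Only the variables have to be bounded: intermediate values may be large, but every operation
costs one step and the number of rounds of a sum is the value of a variable. Subexpressions
evaluated at greater depth leave earlier temporaries intact. -/
theorem Ex.exec_comp (inp : List ℕ) (B : ℕ) (e : Ex) : ∀ (d : ℕ) (s : State),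
    (∀ z, s.vals z ≤ B) →
    ∃ t s', Exec inp (e.comp d) s t s' ∧ t ≤ e.cost.eval B ∧
      s'.reg (2 * d + 1) = e.eval inp s.vals ∧ s.Agree d s' ∧ s'.out = s.out := by
  induction e with
  | const c =>
    intro d s hs
    exact ⟨1, _, .const _ _ _, by simp [cost], by simp [State.setReg_reg, eval],
      State.agree_setReg _ _ _ _ le_rfl, rfl⟩
  | var x =>
    intro d s hs
    exact ⟨1, _, .move _ _ _, by simp [cost], by simp [State.setReg_reg, eval, State.vals],
      State.agree_setReg _ _ _ _ le_rfl, rfl⟩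
  | add a b iha ihb =>
    intro d s hs
    obtain ⟨t₁, s₁, h₁, ht₁, hv₁, ha₁, ho₁⟩ := iha d s hs
    obtain ⟨t₂, s₂, h₂, ht₂, hv₂, ha₂, ho₂⟩ := ihb (d + 1) s₁ (by rwa [ha₁.vals])
    refine ⟨_, _, .seq h₁ (.seq h₂ (.add _ _ _ _)), ?_, ?_,
      (ha₁.trans (ha₂.mono (by omega))).trans (State.agree_setReg _ _ _ _ le_rfl), ?_⟩
    · simp [cost]; omega
    · rw [State.setReg_reg, if_pos rfl, ha₂ (2 * d + 1) (by omega), hv₁,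
        show 2 * d + 3 = 2 * (d + 1) + 1 by ring, hv₂, ha₁.vals, eval]
    · rw [State.setReg_out, ho₂, ho₁]
  | sub a b iha ihb =>
    intro d s hs
    obtain ⟨t₁, s₁, h₁, ht₁, hv₁, ha₁, ho₁⟩ := iha d s hs
    obtain ⟨t₂, s₂, h₂, ht₂, hv₂, ha₂, ho₂⟩ := ihb (d + 1) s₁ (by rwa [ha₁.vals])
    refine ⟨_, _, .seq h₁ (.seq h₂ (.sub _ _ _ _)), ?_, ?_,
      (ha₁.trans (ha₂.mono (by omega))).trans (State.agree_setReg _ _ _ _ le_rfl), ?_⟩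
    · simp [cost]; omega
    · rw [State.setReg_reg, if_pos rfl, ha₂ (2 * d + 1) (by omega), hv₁,
        show 2 * d + 3 = 2 * (d + 1) + 1 by ring, hv₂, ha₁.vals, eval]
    · rw [State.setReg_out, ho₂, ho₁]
  | read a iha =>
    intro d s hs
    obtain ⟨t₁, s₁, h₁, ht₁, hv₁, ha₁, ho₁⟩ := iha d s hs
    refine ⟨_, _, .seq h₁ (.read _ _ _), ?_, ?_,
      ha₁.trans (State.agree_setReg _ _ _ _ le_rfl), ?_⟩
    · simp [cost]; omega
    · rw [State.setReg_reg, if_pos rfl, hv₁, eval]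
    · rw [State.setReg_out, ho₁]
  | cond c a b ihc iha ihb =>
    intro d s hs
    obtain ⟨t₁, s₁, h₁, ht₁, hv₁, ha₁, ho₁⟩ := ihc d s hs
    by_cases hc : c.eval inp s.vals = 0
    · obtain ⟨t₂, s₂, h₂, ht₂, hv₂, ha₂, ho₂⟩ := ihb d s₁ (by rwa [ha₁.vals])
      refine ⟨_, _, .seq h₁ (.iteFalse (hv₁.trans hc) h₂), ?_, ?_, ha₁.trans ha₂, ?_⟩
      · simp [cost]; omega
      · rw [hv₂, ha₁.vals, eval, if_neg (not_not.2 hc)]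
      · rw [ho₂, ho₁]
    · obtain ⟨t₂, s₂, h₂, ht₂, hv₂, ha₂, ho₂⟩ := iha d s₁ (by rwa [ha₁.vals])
      refine ⟨_, _, .seq h₁ (.iteTrue (by rwa [hv₁]) h₂), ?_, ?_, ha₁.trans ha₂, ?_⟩
      · simp [cost]; omega
      · rw [hv₂, ha₁.vals, eval, if_pos hc]
      · rw [ho₂, ho₁]
  | sum x y a iha =>
    intro d s hs
    set s₁ := s.setReg (2 * d + 3) (s.reg (2 * x)) with hs₁
    set s₂ := s₁.setReg (2 * d + 5) (s₁.reg (2 * y)) with hs₂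
    set s₃ := s₂.setReg (2 * d + 1) 0 with hs₃
    set s₄ := s₃.setReg (2 * x) 0 with hs₄
    have e4 : ∀ r, s₄.reg r = if r = 2 * x then 0 else if r = 2 * d + 1 then 0 else
        if r = 2 * d + 5 then s.reg (2 * y) else if r = 2 * d + 3 then s.reg (2 * x) else
        s.reg r := by
      intro r
      have n1 : 2 * y ≠ 2 * d + 3 := by omega
      simp only [hs₄, hs₃, hs₂, hs₁, State.setReg_reg, n1]
      simp
    obtain ⟨t, s', he, ht, hv, hag, ho⟩ := exec_loop_sum (x := x) (d := d)
      (fun s hs => iha (d + 3) s hs) s.vals hs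
      (s.vals y) 0 s₄ (by
        funext z
        simp only [State.vals, e4, Function.update_apply]
        by_cases hz : z = x
        · simp [hz]
        · rw [if_neg (by omega), if_neg (by omega), if_neg (by omega), if_neg (by omega),
            if_neg hz]) (by simpa using hs y) (by
        rw [e4, if_neg (by omega), if_neg (by omega), if_pos rfl]; rfl)
    refine ⟨_, _, .seq (.seq (.move _ _ _) (.seq (.move _ _ _) (.seq (.const _ _ _) (.const _ _ _))))
      (.seq he (.move _ _ _)), ?_, ?_, ?_, ?_⟩
    · have : s.vals y * (a.cost.eval B + 5) ≤ B * (a.cost.eval B + 5) :=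
        Nat.mul_le_mul_right _ (hs y)
      simp [cost]
      omega
    · rw [State.setReg_reg, if_neg (by omega), hv, e4, if_neg (by omega), if_pos rfl, eval]
      simp
    · intro r hr
      rw [State.setReg_reg]
      split_ifs with h
      · rw [hag _ (by omega) (by omega), e4, if_neg (by omega), if_neg (by omega),
          if_neg (by omega), if_pos rfl, h]
      · rw [hag r h (by omega), e4, if_neg h, if_neg (by omega), if_neg (by omega),
          if_neg (by omega)]
    · rw [State.setReg_out, ho]
      rfl

/-- Programs that write a list described by comprehensions. -/
inductive Stmt
  | emit (e : Ex)
  | seq (a b : Stmt)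
  | ite (c : Ex) (a b : Stmt)
  | skip
  /-- run `a` for all values of the variable `x` below the value of the variable `y` -/
  | loop (x y : ℕ) (a : Stmt)

namespace Stmt

def out (inp : List ℕ) : Stmt → (ℕ → ℕ) → List ℕ
  | emit e, σ => [e.eval inp σ]
  | seq a b, σ => a.out inp σ ++ b.out inp σ
  | ite c a b, σ => if c.eval inp σ ≠ 0 then a.out inp σ else b.out inp σ
  | skip, _ => []
  | loop x y a, σ => (List.range (σ y)).flatMap fun v => a.out inp (Function.update σ x v)

def comp : Stmt → ℕ → Prog
  | emit e, d => .seq (e.comp d) (.emit (2 * d + 1))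
  | seq a b, d => .seq (a.comp d) (b.comp d)
  | ite c a b, d => .seq (c.comp d) (.ite (2 * d + 1) (a.comp d) (b.comp d))
  | skip, d => .const (2 * d + 1) 0
  | loop x y a, d =>
      .seq (.seq (.move (2 * d + 1) (2 * x)) (.seq (.move (2 * d + 3) (2 * y)) (.const (2 * x) 0)))
      (.seq (.loop (2 * d + 3) (.seq (a.comp (d + 2)) (.seq (.const (2 * d + 5) 1)
        (.seq (.add (2 * x) (2 * x) (2 * d + 5)) (.sub (2 * d + 3) (2 * d + 3) (2 * d + 5))))))
        (.move (2 * x) (2 * d + 1)))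

noncomputable def cost : Stmt → Polynomial ℕ
  | emit e => e.cost + 1
  | seq a b => a.cost + b.cost
  | ite c a b => c.cost + a.cost + b.cost + 1
  | skip => 1
  | loop _ _ a => Polynomial.X * (a.cost + 4) + 5

end Stmt

theorem exec_loop_out {inp : List ℕ} {a : Stmt} {d x B : ℕ}
    (ih : ∀ s : State, (∀ z, s.vals z ≤ B) → ∃ t s', Exec inp (a.comp (d + 2)) s t s' ∧
      t ≤ a.cost.eval B ∧ s.Agree (d + 2) s' ∧ s'.out = s.out ++ a.out inp s.vals)
    (σ : ℕ → ℕ) (hσ : ∀ z, σ z ≤ B) (m : ℕ) :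
    ∀ (j : ℕ) (s : State), s.vals = Function.update σ x j → j + m ≤ B →
      s.reg (2 * d + 3) = m →
      ∃ t s', Exec inp (.loop (2 * d + 3) (.seq (a.comp (d + 2)) (.seq (.const (2 * d + 5) 1)
        (.seq (.add (2 * x) (2 * x) (2 * d + 5)) (.sub (2 * d + 3) (2 * d + 3) (2 * d + 5))))))
          s t s' ∧
        t ≤ m * (a.cost.eval B + 4) + 1 ∧
        (∀ r, r ≠ 2 * x → (r % 2 = 0 ∨ r < 2 * d + 3) → s'.reg r = s.reg r) ∧
        s'.out = s.out ++ (List.range' j m).flatMap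
          fun v => a.out inp (Function.update σ x v) := by
  induction m with
  | zero =>
    intro j s hs hj hm
    exact ⟨1, s, .loopDone hm, by simp, fun _ _ _ => rfl, by simp⟩
  | succ m IH =>
    intro j s hs hj hm
    have hx : s.reg (2 * x) = j := by
      have := congrFun hs x
      simpa [State.vals] using this
    obtain ⟨t, s₁, he, ht, hag, ho⟩ := ih s (by
      intro z
      rw [hs, Function.update_apply]
      split_ifs
      · omega
      · exact hσ z)
    have h3 : s₁.reg (2 * d + 3) = m + 1 := (hag _ (by omega)).trans hm
    have hx' : s₁.reg (2 * x) = j := (hag _ (by omega)).trans hx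
    set s₃ := s₁.setReg (2 * d + 5) 1 with hs₃
    set s₄ := s₃.setReg (2 * x) (s₃.reg (2 * x) + s₃.reg (2 * d + 5)) with hs₄
    set s₅ := s₄.setReg (2 * d + 3) (s₄.reg (2 * d + 3) - s₄.reg (2 * d + 5)) with hs₅
    have e5 : ∀ r, s₅.reg r = if r = 2 * d + 3 then m else if r = 2 * x then j + 1 else
        if r = 2 * d + 5 then 1 else s₁.reg r := by
      intro r
      have n1 : 2 * d + 3 ≠ 2 * x := by omega
      have n2 : 2 * d + 5 ≠ 2 * x := by omega
      have n3 : 2 * x ≠ 2 * d + 5 := by omega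
      simp only [hs₅, hs₄, hs₃, State.setReg_reg, n1, n2, n3, h3, hx']
      simp
    obtain ⟨t', s', he', ht', hag', ho'⟩ := IH (j + 1) s₅ (by
      funext z
      rw [Function.update_apply]
      simp only [State.vals, e5]
      rw [if_neg (by omega)]
      by_cases hz : z = x
      · simp [hz]
      · rw [if_neg (by omega), if_neg (by omega), if_neg hz]
        have := congrFun hs z
        rw [Function.update_apply, if_neg hz] at this
        rw [← this]
        exact hag _ (by omega)) (by omega) (by rw [e5, if_pos rfl])
    refine ⟨_, s', .loopStep (by omega) (.seq he (.seq (.const _ _ _)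
      (.seq (.add _ _ _ _) (.sub _ _ _ _)))) he', ?_, ?_, ?_⟩
    · nlinarith
    · intro r hr hr'
      rw [hag' r hr hr', e5, if_neg (by omega), if_neg (by omega), if_neg (by omega)]
      exact hag r (by omega)
    · rw [ho', List.range'_succ, List.flatMap_cons, ← hs, ← List.append_assoc, ← ho]
      rfl

theorem Stmt.exec_comp (inp : List ℕ) (B : ℕ) (a : Stmt) : ∀ (d : ℕ) (s : State),
    (∀ z, s.vals z ≤ B) →
    ∃ t s', Exec inp (a.comp d) s t s' ∧ t ≤ a.cost.eval B ∧ s.Agree d s' ∧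
      s'.out = s.out ++ a.out inp s.vals := by
  induction a with
  | emit e =>
    intro d s hs
    obtain ⟨t₁, s₁, h₁, ht₁, hv₁, ha₁, ho₁⟩ := e.exec_comp inp B d s hs
    refine ⟨_, _, .seq h₁ (.emit _ _), ?_, ?_, ?_⟩
    · simp [cost]; omega
    · exact ha₁
    · simp [out, ho₁, hv₁]
  | seq a b iha ihb =>
    intro d s hs
    obtain ⟨t₁, s₁, h₁, ht₁, ha₁, ho₁⟩ := iha d s hs
    obtain ⟨t₂, s₂, h₂, ht₂, ha₂, ho₂⟩ := ihb d s₁ (by rwa [ha₁.vals])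
    refine ⟨_, _, .seq h₁ h₂, ?_, ha₁.trans ha₂, ?_⟩
    · simp [cost]; omega
    · rw [ho₂, ho₁, ha₁.vals, out, List.append_assoc]
  | ite c a b iha ihb =>
    intro d s hs
    obtain ⟨t₁, s₁, h₁, ht₁, hv₁, ha₁, ho₁⟩ := c.exec_comp inp B d s hs
    by_cases hc : c.eval inp s.vals = 0
    · obtain ⟨t₂, s₂, h₂, ht₂, ha₂, ho₂⟩ := ihb d s₁ (by rwa [ha₁.vals])
      refine ⟨_, _, .seq h₁ (.iteFalse (hv₁.trans hc) h₂), ?_, ha₁.trans ha₂, ?_⟩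
      · simp [cost]; omega
      · rw [ho₂, ho₁, ha₁.vals, out, if_neg (not_not.2 hc)]
    · obtain ⟨t₂, s₂, h₂, ht₂, ha₂, ho₂⟩ := iha d s₁ (by rwa [ha₁.vals])
      refine ⟨_, _, .seq h₁ (.iteTrue (by rwa [hv₁]) h₂), ?_, ha₁.trans ha₂, ?_⟩
      · simp [cost]; omega
      · rw [ho₂, ho₁, ha₁.vals, out, if_pos hc]
  | skip =>
    intro d s hs
    exact ⟨1, _, .const _ _ _, by simp [cost], State.agree_setReg _ _ _ _ le_rfl,
      by simp [out, State.setReg_out]⟩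
  | loop x y a iha =>
    intro d s hs
    set s₁ := s.setReg (2 * d + 1) (s.reg (2 * x)) with hs₁
    set s₂ := s₁.setReg (2 * d + 3) (s₁.reg (2 * y)) with hs₂
    set s₄ := s₂.setReg (2 * x) 0 with hs₄
    have e4 : ∀ r, s₄.reg r = if r = 2 * x then 0 else
        if r = 2 * d + 3 then s.reg (2 * y) else if r = 2 * d + 1 then s.reg (2 * x) else
        s.reg r := by
      intro r
      have n1 : 2 * y ≠ 2 * d + 1 := by omega
      simp only [hs₄, hs₂, hs₁, State.setReg_reg, n1]
      simp
    obtain ⟨t, s', he, ht, hag, ho⟩ := exec_loop_out (x := x) (d := d)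
      (fun s hs => iha (d + 2) s hs) s.vals hs
      (s.vals y) 0 s₄ (by
        funext z
        simp only [State.vals, e4, Function.update_apply]
        by_cases hz : z = x
        · simp [hz]
        · rw [if_neg (by omega), if_neg (by omega), if_neg (by omega), if_neg hz])
      (by simpa using hs y) (by rw [e4, if_neg (by omega), if_pos rfl]; rfl)
    refine ⟨_, _, .seq (.seq (.move _ _ _) (.seq (.move _ _ _) (.const _ _ _)))
      (.seq he (.move _ _ _)), ?_, ?_, ?_⟩
    · have : s.vals y * (a.cost.eval B + 4) ≤ B * (a.cost.eval B + 4) :=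
        Nat.mul_le_mul_right _ (hs y)
      simp [cost]
      omega
    · intro r hr
      rw [State.setReg_reg]
      split_ifs with h
      · rw [hag _ (by omega) (by omega), e4, if_neg (by omega), if_neg (by omega), if_pos rfl, h]
      · rw [hag r h (by omega), e4, if_neg h, if_neg (by omega), if_neg (by omega)]
    · rw [State.setReg_out, ho, out, List.range_eq_range']
      rfl

/-- Evaluate expressions one after the other and store the values in the variables from `x` on. -/
def setVars : List Ex → ℕ → Prog → Prog
  | [], _, P => P
  | e :: l, x, P => .seq (.seq (e.comp 0) (.move (2 * x) 1)) (setVars l (x + 1) P)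

/-- The values of the variables after the assignments. -/
def valsAfter (inp : List ℕ) : List Ex → ℕ → (ℕ → ℕ) → ℕ → ℕ
  | [], _, σ => σ
  | e :: l, x, σ => valsAfter inp l (x + 1) (Function.update σ x (e.eval inp σ))

/-- All values occurring during the assignments are at most `B`. -/
def ValsBounded (inp : List ℕ) (B : ℕ) : List Ex → ℕ → (ℕ → ℕ) → Prop
  | [], _, _ => True
  | e :: l, x, σ => e.eval inp σ ≤ B ∧
      ValsBounded inp B l (x + 1) (Function.update σ x (e.eval inp σ))

noncomputable def setVarsCost (l : List Ex) : Polynomial ℕ := (l.map fun e => e.cost + 1).sum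

theorem exec_setVars (inp : List ℕ) (B : ℕ) (a : Stmt) (l : List Ex) : ∀ (x : ℕ) (s : State),
    (∀ z, s.vals z ≤ B) → ValsBounded inp B l x s.vals →
    ∃ t s', Exec inp (setVars l x (a.comp 0)) s t s' ∧
      t ≤ (setVarsCost l + a.cost).eval B ∧
      s'.out = s.out ++ a.out inp (valsAfter inp l x s.vals) := by
  induction l with
  | nil =>
    intro x s hs _
    obtain ⟨t, s', h, ht, -, ho⟩ := a.exec_comp inp B 0 s hs
    exact ⟨t, s', h, by simpa [setVarsCost] using ht, ho⟩
  | cons e l ih =>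
    intro x s hs hb
    obtain ⟨t₁, s₁, h₁, ht₁, hv₁, ha₁, ho₁⟩ := e.exec_comp inp B 0 s hs
    have hvals : (s₁.setReg (2 * x) (s₁.reg 1)).vals =
        Function.update s.vals x (e.eval inp s.vals) := by
      funext z
      simp only [State.vals, State.setReg_reg, Function.update_apply]
      by_cases hz : z = x
      · subst hz
        simpa using hv₁
      · rw [if_neg (by omega), if_neg hz]
        exact congrFun ha₁.vals z
    obtain ⟨t₂, s₂, h₂, ht₂, ho₂⟩ := ih (x + 1) (s₁.setReg (2 * x) (s₁.reg 1)) (by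
      rw [hvals]
      intro z
      rw [Function.update_apply]
      split_ifs
      · exact hb.1
      · exact hs z) (by rw [hvals]; exact hb.2)
    refine ⟨_, s₂, .seq (.seq h₁ (.move _ _ _)) h₂, ?_, ?_⟩
    · simp [setVarsCost] at ht₂ ⊢
      omega
    · rw [ho₂, hvals, State.setReg_out, ho₁]
      rfl

theorem outputsWithin_setVars (inp : List ℕ) (B : ℕ) (a : Stmt) (l : List Ex)
    (hb : ValsBounded inp B l 0 fun _ => 0) :
    OutputsWithin (setVars l 0 (a.comp 0)) inp (a.out inp (valsAfter inp l 0 fun _ => 0))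
      ((setVarsCost l + a.cost).eval B) := by
  obtain ⟨t, s, h, ht, ho⟩ := exec_setVars inp B a l 0 State.start (by simp [State.vals, State.start])
    hb
  exact ⟨t, s, h, ht, ho⟩

end RAM

/-! ### Distances in trees -/

namespace SimpleGraph.IsTree

variable {W : Type*} {T : SimpleGraph W}

theorem length_eq_dist (hT : T.IsTree) {u v : W} {p : T.Walk u v} (hp : p.IsPath) :
    p.length = T.dist u v := by
  obtain ⟨q, hq, hl⟩ := hT.connected.exists_path_of_dist u v
  rw [← hl, (hT.existsUnique_path u v).unique hp hq]

theorem exists_adj_dist_eq (hT : T.IsTree) {u v : W} (h : v ≠ u) :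
    ∃ w, T.Adj v w ∧ T.dist u v = T.dist u w + 1 := by
  obtain ⟨p, hp⟩ := hT.connected.exists_walk_length_eq_dist v u
  cases p with
  | nil => exact absurd rfl h
  | cons hw q =>
    rename_i w
    refine ⟨w, hw, ?_⟩
    have h1 := T.dist_le q
    have h2 := hT.dist_eq_dist_add_one_of_adj u hw
    rw [SimpleGraph.Walk.length_cons, T.dist_comm] at hp
    rw [T.dist_comm] at h1
    omega

/-- The path from `x` to `a` stays on the side of `a`, the path from `b` to `y` on the side of `b`;
joined by the edge they therefore form a path, and paths in a tree realize distances. -/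
theorem dist_eq_of_split (hT : T.IsTree) {a b x y : W} (hab : T.Adj a b)
    (hx : T.dist x a < T.dist x b) (hy : T.dist y b < T.dist y a) :
    T.dist x y = T.dist x a + 1 + T.dist b y := by
  classical
  obtain ⟨p, hp, hpl⟩ := hT.connected.exists_path_of_dist x a
  obtain ⟨q, hq, hql⟩ := hT.connected.exists_path_of_dist b y
  have hps : ∀ t ∈ p.support, T.dist t a < T.dist t b := by
    intro t ht
    have h1 : T.dist x t + T.dist t a ≤ p.length := by
      have := congrArg SimpleGraph.Walk.length (p.take_spec ht)
      rw [SimpleGraph.Walk.length_append] at this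
      have h2 := T.dist_le (p.takeUntil t ht)
      have h3 := T.dist_le (p.dropUntil t ht)
      omega
    have h2 := hT.connected.dist_triangle (u := x) (v := t) (w := b)
    omega
  have hqs : ∀ t ∈ q.support, T.dist t b < T.dist t a := by
    intro t ht
    have h1 : T.dist b t + T.dist t y ≤ q.length := by
      have := congrArg SimpleGraph.Walk.length (q.take_spec ht)
      rw [SimpleGraph.Walk.length_append] at this
      have h2 := T.dist_le (q.takeUntil t ht)
      have h3 := T.dist_le (q.dropUntil t ht)
      omega
    have h2 := hT.connected.dist_triangle (u := a) (v := t) (w := y)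
    rw [T.dist_comm (u := y), T.dist_comm (u := y)] at hy
    rw [T.dist_comm (u := t), T.dist_comm (u := t)]
    omega
  have hpath : (p.append (SimpleGraph.Walk.cons hab q)).IsPath := by
    rw [SimpleGraph.Walk.isPath_def, SimpleGraph.Walk.support_append,
      SimpleGraph.Walk.support_cons, List.tail_cons, List.nodup_append]
    refine ⟨hp.support_nodup, hq.support_nodup, ?_⟩
    intro t ht t' ht' e
    subst e
    have := hps t ht
    have := hqs t ht'
    omega
  rw [← hT.length_eq_dist hpath, SimpleGraph.Walk.length_append, SimpleGraph.Walk.length_cons]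
  omega

/-- If `u ≠ u'`, the edge `uv` separates `r` from `u'`, so `u'` would be farther from `r` than `v`.
-/
theorem parent_unique (hT : T.IsTree) {r v u u' : W} (hu : T.Adj v u) (hu' : T.Adj v u')
    (h : T.dist r v = T.dist r u + 1) (h' : T.dist r v = T.dist r u' + 1) : u = u' := by
  by_contra hne
  have h1 : T.dist u' v = 1 := by rw [SimpleGraph.dist_eq_one_iff_adj]; exact hu'.symm
  have h2 : T.dist u' u ≠ 0 := fun h0 => hne ((hT.connected.dist_eq_zero_iff).1 h0).symm
  have h3 := hT.dist_eq_dist_add_one_of_adj u' hu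
  have h4 := hT.dist_eq_of_split hu.symm (x := r) (y := u') (by omega) (by omega)
  rw [T.dist_comm (u := v), h1] at h4
  omega

/-- A node on the path between `x` and `y` is, for every `z`, on the path from `z` to `x` or on
the path from `z` to `y`. -/
theorem between_or_between (hT : T.IsTree) {x y c : W}
    (h : T.dist x c + T.dist c y = T.dist x y) (z : W) :
    T.dist z x = T.dist z c + T.dist c x ∨ T.dist z y = T.dist z c + T.dist c y := by
  by_cases hx : c = x
  · left; subst hx; simp
  by_cases hy : c = y
  · right; subst hy; simp
  obtain ⟨p, hp, hpx⟩ := hT.exists_adj_dist_eq hx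
  obtain ⟨q, hq, hqy⟩ := hT.exists_adj_dist_eq hy
  have key : ∀ w p, T.Adj c p → T.dist w c = T.dist w p + 1 → T.dist z c < T.dist z p →
      T.dist z w = T.dist z c + T.dist c w := by
    intro w p hp hw hz
    rw [hT.dist_eq_of_split hp (x := z) (y := w) hz (by omega), T.dist_comm (u := c), hw,
      T.dist_comm (u := p)]
    ring
  by_cases hzp : T.dist z c < T.dist z p
  · exact Or.inl (key x p hp hpx hzp)
  by_cases hzq : T.dist z c < T.dist z q
  · exact Or.inr (key y q hq hqy hzq)
  -- Now both `p` and `q` are nearer to `z` than `c` is, so they coincide; but then the walk from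
  -- `x` to `y` could avoid `c`.
  have h1 := hT.dist_eq_dist_add_one_of_adj z hp
  have h2 := hT.dist_eq_dist_add_one_of_adj z hq
  have : p = q := hT.parent_unique (r := z) hp hq (by omega) (by omega)
  subst this
  have h3 := hT.connected.dist_triangle (u := x) (v := p) (w := y)
  rw [T.dist_comm (u := p) (v := y)] at h3
  rw [T.dist_comm (u := c) (v := y)] at h
  omega

theorem exists_between (hT : T.IsTree) {x y : W} (m : ℕ) (hm : m ≤ T.dist x y) :
    ∃ c, T.dist x c = m ∧ T.dist c y = T.dist x y - m := by
  induction m with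
  | zero => exact ⟨x, by simp, by simp⟩
  | succ m ih =>
    obtain ⟨c, h1, h2⟩ := ih (by omega)
    have hne : c ≠ y := by
      rintro rfl
      simp at h2
      omega
    obtain ⟨w, hw, hd⟩ := hT.exists_adj_dist_eq hne
    rw [T.dist_comm, T.dist_comm (u := y)] at hd
    have h3 := hT.connected.dist_triangle (u := x) (v := w) (w := y)
    have h4 := hT.dist_eq_dist_add_one_of_adj x hw
    exact ⟨w, by omega, by omega⟩

/-- A finite set of nodes at pairwise distance at most `4` is contained in a ball of radius `2`. -/
theorem exists_center (hT : T.IsTree) {A : Set W} (hA : A.Finite) (hne : A.Nonempty)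
    (h : ∀ x ∈ A, ∀ y ∈ A, T.dist x y ≤ 4) : ∃ c, ∀ x ∈ A, T.dist c x ≤ 2 := by
  obtain ⟨⟨x, y⟩, ⟨hx, hy⟩, hmax⟩ := Set.exists_max_image (A ×ˢ A) (fun p => T.dist p.1 p.2)
    (hA.prod hA) (hne.prod hne)
  simp only [Set.mem_prod, Prod.forall, and_imp] at hmax hx hy
  have hxy := h x hx y hy
  -- The middle of a farthest pair. Seen from any `z`, one end of the pair lies behind `c`, so `z`
  -- cannot be farther from `c` than the longer half.
  obtain ⟨c, h1, h2⟩ := hT.exists_between (x := x) (y := y) (T.dist x y / 2) (by omega)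
  refine ⟨c, fun z hz => ?_⟩
  have hzx := hmax z x hz hx
  have hzy := hmax z y hz hy
  have h3 := hT.between_or_between (x := x) (y := y) (c := c) (by omega) z
  have h4 := h z hz x hx
  have h5 := h z hz y hy
  rw [T.dist_comm (u := c) (v := x), T.dist_comm (u := z) (v := c)] at h3
  omega

/-! ### Subtrees and spans -/

theorem dist_induce (hT : T.IsTree) {B : Set W} (hB : (T.induce B).Connected) (x y : B) :
    (T.induce B).dist x y = T.dist (x : W) y := by
  obtain ⟨p, hp, hl⟩ := hB.exists_path_of_dist x y
  have hp' : (p.map (SimpleGraph.Embedding.induce (G := T) B).toHom).IsPath :=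
    hp.map Subtype.val_injective
  rw [← hl, ← p.length_map (SimpleGraph.Embedding.induce (G := T) B).toHom]
  exact hT.length_eq_dist hp'

theorem mem_of_between (hT : T.IsTree) {B : Set W} (hB : (T.induce B).Connected) {x y w : W}
    (hx : x ∈ B) (hy : y ∈ B) (h : T.dist x w + T.dist w y = T.dist x y) : w ∈ B := by
  obtain ⟨p, hp, hl⟩ := hB.exists_path_of_dist ⟨x, hx⟩ ⟨y, hy⟩
  have hp' : (p.map (SimpleGraph.Embedding.induce (G := T) B).toHom).IsPath :=
    hp.map Subtype.val_injective
  obtain ⟨q, hq⟩ := hT.connected.exists_walk_length_eq_dist x w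
  obtain ⟨r, hr⟩ := hT.connected.exists_walk_length_eq_dist w y
  have hqr : (q.append r).IsPath := by
    apply SimpleGraph.Walk.isPath_of_length_eq_dist
    rw [SimpleGraph.Walk.length_append]
    omega
  have e := (hT.existsUnique_path x y).unique hp' hqr
  have hw : w ∈ (q.append r).support := by
    rw [SimpleGraph.Walk.mem_support_append_iff]
    exact Or.inl q.end_mem_support
  rw [← e] at hw
  have hw' : w ∈ p.support.map (SimpleGraph.Embedding.induce (G := T) B).toHom := by
    rw [← SimpleGraph.Walk.support_map]
    exact hw
  obtain ⟨b, -, rfl⟩ := List.mem_map.1 hw'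
  exact b.2

/-- The nodes on the paths from `c` to the nodes of `A`. -/
theorem connected_induce_between (hT : T.IsTree) (c : W) {A : Set W} (hA : A.Nonempty) :
    (T.induce {w | ∃ u ∈ A, T.dist c w + T.dist w u = T.dist c u}).Connected := by
  set B := {w | ∃ u ∈ A, T.dist c w + T.dist w u = T.dist c u} with hB
  have hc : c ∈ B := by
    obtain ⟨u, hu⟩ := hA
    exact ⟨u, hu, by simp⟩
  have key : ∀ n, ∀ w (hw : w ∈ B), T.dist c w = n →
      (T.induce B).Reachable ⟨w, hw⟩ ⟨c, hc⟩ := by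
    intro n
    induction n with
    | zero =>
      intro w hw h0
      obtain rfl := (hT.connected.dist_eq_zero_iff).1 h0
      exact SimpleGraph.Reachable.refl _
    | succ n ih =>
      intro w hw hn
      have hne : w ≠ c := by rintro rfl; simp at hn
      obtain ⟨v, hv, hd⟩ := hT.exists_adj_dist_eq hne
      obtain ⟨u, hu, hdu⟩ := hw
      have h1 := hT.connected.dist_triangle (u := c) (v := v) (w := u)
      have h2 := hT.dist_eq_dist_add_one_of_adj u hv
      rw [T.dist_comm (u := u), T.dist_comm (u := u)] at h2
      have hvB : v ∈ B := ⟨u, hu, by omega⟩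
      have hadj : (T.induce B).Adj ⟨w, ⟨u, hu, hdu⟩⟩ ⟨v, hvB⟩ := hv
      exact hadj.reachable.trans (ih v hvB (by omega))
  have : Nonempty B := ⟨⟨c, hc⟩⟩
  exact ⟨fun x y => (key _ x.1 x.2 rfl).trans (key _ y.1 y.2 rfl).symm⟩

/-- The union of the paths from `c` is itself connected, and every connected set containing `A` also
contains `c` and hence these paths. -/
theorem spanNodes_eq (hT : T.IsTree) {c : W} {A : Set W} (hA : A.Nonempty)
    (hc : c ∈ spanNodes T A) :
    spanNodes T A = {w | ∃ u ∈ A, T.dist c w + T.dist w u = T.dist c u} := by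
  apply Set.Subset.antisymm
  · exact Set.sInter_subset_of_mem ⟨fun u hu => ⟨u, hu, by simp⟩, hT.connected_induce_between c hA⟩
  · rintro w ⟨u, hu, h⟩ B ⟨hAB, hB⟩
    exact hT.mem_of_between hB (hc B ⟨hAB, hB⟩) (hAB hu) h

theorem subset_spanNodes (T : SimpleGraph W) (A : Set W) : A ⊆ spanNodes T A :=
  Set.subset_sInter fun _ hB => hB.1

theorem mem_spanNodes_of_between (hT : T.IsTree) {A : Set W} {x y w : W}
    (hx : x ∈ spanNodes T A) (hy : y ∈ spanNodes T A)
    (h : T.dist x w + T.dist w y = T.dist x y) : w ∈ spanNodes T A :=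
  fun B hB => hT.mem_of_between hB.2 (hx B hB) (hy B hB) h

theorem connected_spanTree (hT : T.IsTree) {A : Set W} (hA : A.Nonempty) :
    (spanTree T A).Connected := by
  obtain ⟨c, hc⟩ := hA
  rw [spanTree, hT.spanNodes_eq ⟨c, hc⟩ (subset_spanNodes T A hc)]
  exact hT.connected_induce_between c ⟨c, hc⟩

theorem dist_spanTree (hT : T.IsTree) {A : Set W} (hA : A.Nonempty) (x y : spanNodes T A) :
    (spanTree T A).dist x y = T.dist (x : W) y :=
  hT.dist_induce (hT.connected_spanTree hA) x y

theorem edist_spanTree (hT : T.IsTree) {A : Set W} (hA : A.Nonempty) (x y : spanNodes T A) :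
    (spanTree T A).edist x y = (T.dist (x : W) y : ℕ∞) := by
  rw [← hT.dist_spanTree hA]
  exact (((hT.connected_spanTree hA) x y).coe_dist_eq_edist).symm

end SimpleGraph.IsTree

/-! ### Codes of trees of depth two -/

/-- Trees are minimal connected graphs, so a connected graph mapped bijectively into a tree misses
none of its edges. This spares the check of non-adjacency. -/
theorem SimpleGraph.IsTree.adj_iff_of_connected {α β : Type*} {A : SimpleGraph α}
    {B : SimpleGraph β} (hB : B.IsTree) (hA : A.Connected) (ψ : α ≃ β)
    (h : ∀ x y, A.Adj x y → B.Adj (ψ x) (ψ y)) (x y : α) : B.Adj (ψ x) (ψ y) ↔ A.Adj x y := by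
  have hC : (B.comap ψ).IsTree := (SimpleGraph.Iso.comap ψ B).isTree_iff.2 hB
  have hle : A ≤ B.comap ψ := fun x y hxy => h x y hxy
  have := (SimpleGraph.isTree_iff_minimal_connected.1 hC).2 hA hle
  exact ⟨fun hxy => this hxy, h x y⟩

/-- Following fathers leads to `0`, which gives connectedness; and each edge is the father edge of
some `y ≠ 0`, so there are at most `N - 1` edges. -/
theorem SimpleGraph.isTree_of_parent {N : ℕ} [NeZero N] {A : SimpleGraph (Fin N)}
    (E : Fin N → Fin N → Prop) (hadj : ∀ x y, A.Adj x y ↔ E x y ∨ E y x)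
    (hlt : ∀ x y, E x y → x < y) (huniq : ∀ x x' y, E x y → E x' y → x = x')
    (hex : ∀ y, y ≠ 0 → ∃ x, E x y) : A.IsTree := by
  classical
  have hreach : ∀ n : ℕ, ∀ y : Fin N, (y : ℕ) = n → A.Reachable y 0 := by
    intro n
    induction n using Nat.strong_induction_on with
    | _ n ih =>
      intro y hy
      by_cases h0 : y = 0
      · rw [h0]
      · obtain ⟨x, hx⟩ := hex y h0
        have hxy := hlt x y hx
        exact (SimpleGraph.Adj.reachable ((hadj y x).2 (Or.inr hx))).trans
          (ih x (by rw [← hy]; exact hxy) x rfl)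
  have hconn : A.Connected := ⟨fun x y => (hreach _ x rfl).trans (hreach _ y rfl).symm⟩
  choose! par hpar using hex
  rw [SimpleGraph.isTree_iff_connected_and_card]
  refine ⟨hconn, le_antisymm ?_ hconn.card_vert_le_card_edgeSet_add_one⟩
  have hsub : A.edgeSet ⊆ (fun y => s(par y, y)) '' {y : Fin N | y ≠ 0} := by
    intro e he
    induction e using Sym2.ind with
    | _ x y =>
      rw [SimpleGraph.mem_edgeSet, hadj] at he
      rcases he with h | h
      · have hy : y ≠ 0 := by
          rintro rfl
          exact absurd (hlt _ _ h) (Fin.not_lt_zero _)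
        exact ⟨y, hy, by change s(par y, y) = _; rw [huniq _ _ _ (hpar y hy) h]⟩
      · have hx : x ≠ 0 := by
          rintro rfl
          exact absurd (hlt _ _ h) (Fin.not_lt_zero _)
        exact ⟨x, hx, by change s(par x, x) = _; rw [huniq _ _ _ (hpar x hx) h, Sym2.eq_swap]⟩
  have h1 : Nat.card A.edgeSet ≤ Nat.card {y : Fin N // y ≠ 0} := by
    refine (Nat.card_mono (Set.toFinite _) hsub).trans ?_
    exact Set.ncard_image_le (Set.toFinite _)
  rw [Nat.card_eq_fintype_card (α := {y : Fin N // y ≠ 0}), Fintype.card_subtype_compl,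
    Fintype.card_subtype_eq, Fintype.card_fin] at h1
  rw [Nat.card_eq_fintype_card (α := Fin N), Fintype.card_fin]
  have := NeZero.pos N
  omega

namespace TreeCode

/-- The number of nodes created for a vertex of type `t`: the types are `0` (the center), `1` (the
distinguished child of the center), `2` (a child of the center), `3` (a child of the distinguished
child) and all others (joined to the center by a path of length two). -/
def width (t : ℕ) : ℕ := if t ≤ 1 then 0 else if t ≤ 3 then 1 else 2

/-- The nodes `0` and `1` are reserved for the center and its distinguished child. The nodes created
for the vertices follow in consecutive blocks, and the block of `p` begins here. -/
def start (ty : ℕ → ℕ) (p : ℕ) : ℕ := 2 + ∑ q ∈ Finset.range p, width (ty q)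

/-- The end of the first edge for the vertex `p`. -/
def lower (ty : ℕ → ℕ) (p : ℕ) : ℕ := if ty p ≤ 1 then 1 else start ty p

/-- Every vertex contributes exactly two edges; a vertex that needs only one repeats it, and one
that needs none repeats the edge from `0` to `1`. So the number of listed edges does not depend on
the types. -/
def upper (ty : ℕ → ℕ) (p : ℕ) : ℕ := if ty p = 3 then 1 else 0

def upper' (ty : ℕ → ℕ) (p : ℕ) : ℕ := if ty p ≤ 3 then upper ty p else start ty p

/-- The end of the second edge for the vertex `p`. -/
def lower' (ty : ℕ → ℕ) (p : ℕ) : ℕ := if ty p ≤ 3 then lower ty p else start ty p + 1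

def nodeOf (ty : ℕ → ℕ) (p : ℕ) : ℕ := if ty p = 0 then 0 else lower' ty p

variable {k : ℕ} {ty : ℕ → ℕ}

theorem start_succ (p : ℕ) : start ty (p + 1) = start ty p + width (ty p) := by
  rw [start, start, Finset.sum_range_succ, add_assoc]

theorem start_mono : Monotone (start ty) :=
  monotone_nat_of_le_succ fun p => by rw [start_succ]; omega

theorem two_le_start (p : ℕ) : 2 ≤ start ty p := Nat.le_add_right _ _

theorem start_add_width_le {p q : ℕ} (h : p < q) : start ty p + width (ty p) ≤ start ty q := by
  rw [← start_succ]
  exact start_mono h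

theorem lower'_lt {p : ℕ} (hp : p < k) : lower' ty p < start ty k := by
  have h1 := start_add_width_le (ty := ty) hp
  have h2 := two_le_start (ty := ty) k
  unfold lower' lower
  unfold width at h1
  split_ifs at * <;> omega

theorem lower_lt {p : ℕ} (hp : p < k) : lower ty p < start ty k := by
  have h1 := start_add_width_le (ty := ty) hp
  have h2 := two_le_start (ty := ty) k
  unfold lower
  unfold width at h1
  split_ifs at * <;> omega

theorem upper_lt_lower (p : ℕ) : upper ty p < lower ty p := by
  have h2 := two_le_start (ty := ty) p
  unfold lower upper
  split_ifs at * <;> omega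

theorem upper'_lt_lower' (p : ℕ) : upper' ty p < lower' ty p := by
  have h2 := two_le_start (ty := ty) p
  unfold lower' lower upper' upper
  split_ifs at * <;> omega

theorem nodeOf_lt {p : ℕ} (hp : p < k) : nodeOf ty p < start ty k := by
  have h1 := lower'_lt (ty := ty) hp
  unfold nodeOf
  split_ifs <;> omega

/-- The node `x` is created for the vertex `p`. -/
def InBlock (ty : ℕ → ℕ) (p x : ℕ) : Prop := start ty p ≤ x ∧ x < start ty p + width (ty p)

theorem InBlock.unique {p q x : ℕ} (hp : InBlock ty p x) (hq : InBlock ty q x) : p = q := by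
  obtain ⟨h1, h2⟩ := hp
  obtain ⟨h3, h4⟩ := hq
  rcases lt_trichotomy p q with h | h | h
  · have := start_add_width_le (ty := ty) h
    omega
  · exact h
  · have := start_add_width_le (ty := ty) h
    omega

theorem exists_inBlock {x : ℕ} (h2 : 2 ≤ x) (hx : x < start ty k) : ∃ p < k, InBlock ty p x := by
  induction k with
  | zero => simp [start] at hx; omega
  | succ k ih =>
    by_cases h : x < start ty k
    · obtain ⟨p, hp, hb⟩ := ih h
      exact ⟨p, by omega, hb⟩
    · rw [start_succ] at hx
      exact ⟨k, by omega, by omega, hx⟩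

/-- `x` is the father of `y`. -/
def Par (k : ℕ) (ty : ℕ → ℕ) (x y : ℕ) : Prop :=
  (x = 0 ∧ y = 1) ∨ ∃ p < k, (x = upper ty p ∧ y = lower ty p) ∨ (x = upper' ty p ∧ y = lower' ty p)

theorem Par.lt {x y : ℕ} (h : Par k ty x y) : x < y := by
  rcases h with ⟨rfl, rfl⟩ | ⟨p, -, ⟨rfl, rfl⟩ | ⟨rfl, rfl⟩⟩
  · omega
  · exact upper_lt_lower p
  · exact upper'_lt_lower' p

/-- A child other than `1` lies in exactly one block, and the block determines its father;
uniqueness of fathers follows. -/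
theorem Par.eq {x y : ℕ} (h : Par k ty x y) : (y = 1 ∧ x = 0) ∨ ∃ p < k, InBlock ty p y ∧
    x = if y = start ty p then upper ty p else start ty p := by
  have key : ∀ p < k, ((x = upper ty p ∧ y = lower ty p) ∨ (x = upper' ty p ∧ y = lower' ty p)) →
      (y = 1 ∧ x = 0) ∨ (InBlock ty p y ∧
        x = if y = start ty p then upper ty p else start ty p) := by
    intro p _ hxy
    unfold InBlock width
    unfold upper' upper lower' lower at *
    have h2 := two_le_start (ty := ty) p
    by_cases h1 : ty p ≤ 1
    · left
      have h3 : ty p ≤ 3 := by omega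
      have h4 : ty p ≠ 3 := by omega
      simp only [h1, h3, h4, if_true, if_false] at hxy
      omega
    · right
      by_cases h3 : ty p ≤ 3
      · simp only [h1, h3, if_true, if_false] at hxy ⊢
        have e : y = start ty p := by rcases hxy with h | h <;> exact h.2
        have e' : x = if ty p = 3 then 1 else 0 := by rcases hxy with h | h <;> exact h.1
        simp [e, e']
      · have h4 : ty p ≠ 3 := by omega
        simp only [h1, h3, h4, if_false] at hxy ⊢
        rcases hxy with ⟨rfl, rfl⟩ | ⟨rfl, rfl⟩
        · simp
        · simp
  rcases h with ⟨rfl, rfl⟩ | ⟨p, hp, h⟩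
  · exact Or.inl ⟨rfl, rfl⟩
  · rcases key p hp h with h | h
    · exact Or.inl h
    · exact Or.inr ⟨p, hp, h⟩

theorem Par.unique {x x' y : ℕ} (h : Par k ty x y) (h' : Par k ty x' y) : x = x' := by
  have hb : ∀ p, ¬ InBlock ty p 1 := fun p hp => by
    have := two_le_start (ty := ty) p
    have := hp.1
    omega
  rcases h.eq with ⟨hy, rfl⟩ | ⟨p, hp, hbp, rfl⟩
  · rcases h'.eq with ⟨-, rfl⟩ | ⟨q, hq, hbq, -⟩
    · rfl
    · exact absurd (hy ▸ hbq) (hb q)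
  · rcases h'.eq with ⟨hy, -⟩ | ⟨q, hq, hbq, rfl⟩
    · exact absurd (hy ▸ hbp) (hb p)
    · rw [hbp.unique hbq]

theorem exists_par {y : ℕ} (h0 : y ≠ 0) (hy : y < start ty k) : ∃ x, Par k ty x y := by
  by_cases h1 : y = 1
  · exact ⟨0, Or.inl ⟨rfl, h1⟩⟩
  obtain ⟨p, hp, hb1, hb2⟩ := exists_inBlock (by omega) hy
  unfold width at hb2
  by_cases hs : y = start ty p
  · refine ⟨upper ty p, Or.inr ⟨p, hp, Or.inl ⟨rfl, ?_⟩⟩⟩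
    unfold lower
    split_ifs at * <;> omega
  · refine ⟨upper' ty p, Or.inr ⟨p, hp, Or.inr ⟨rfl, ?_⟩⟩⟩
    unfold lower' lower
    split_ifs at * <;> omega

def edgesOfTypes (k : ℕ) (ty : ℕ → ℕ) : List (Fin (start ty k) × Fin (start ty k)) :=
  (⟨0, by have := two_le_start (ty := ty) k; omega⟩, ⟨1, two_le_start k⟩) ::
    (List.finRange k).flatMap fun p : Fin k =>
      [(⟨upper ty p, (upper_lt_lower _).trans (lower_lt p.2)⟩, ⟨lower ty p, lower_lt p.2⟩),
        (⟨upper' ty p, (upper'_lt_lower' _).trans (lower'_lt p.2)⟩, ⟨lower' ty p, lower'_lt p.2⟩)]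

theorem mem_edgesOfTypes (x y : Fin (start ty k)) :
    (x, y) ∈ edgesOfTypes k ty ↔ Par k ty x y := by
  simp only [edgesOfTypes, List.mem_cons, List.mem_flatMap, List.mem_finRange, true_and,
    Prod.mk.injEq, Fin.ext_iff, List.not_mem_nil, or_false, Par]
  refine or_congr Iff.rfl ⟨?_, ?_⟩
  · rintro ⟨p, h⟩
    exact ⟨p, p.2, h⟩
  · rintro ⟨p, hp, h⟩
    exact ⟨⟨p, hp⟩, h⟩

/-- The tree described by the types of the vertices. -/
def ofTypes (k : ℕ) (ty : ℕ → ℕ) : TreeCode k where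
  size := start ty k
  edges := edgesOfTypes k ty
  label p := ⟨nodeOf ty p, nodeOf_lt p.2⟩

theorem adj_ofTypes (x y : Fin (ofTypes k ty).size) :
    (ofTypes k ty).graph.Adj x y ↔ Par k ty x y ∨ Par k ty y x := by
  refine (SimpleGraph.fromRel_adj _ _ _).trans ((and_congr Iff.rfl (or_congr (mem_edgesOfTypes x y)
    (mem_edgesOfTypes y x))).trans ?_)
  refine ⟨fun h => h.2, fun h => ⟨?_, h⟩⟩
  rintro rfl
  rcases h with h | h <;> exact absurd h.lt (lt_irrefl _)

instance : NeZero (ofTypes k ty).size :=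
  ⟨by have := two_le_start (ty := ty) k; simp only [ofTypes]; omega⟩

theorem isTree_ofTypes : (ofTypes k ty).graph.IsTree := by
  refine SimpleGraph.isTree_of_parent (fun x y => Par k ty x y) adj_ofTypes
    (fun x y h => h.lt) (fun x x' y h h' => Fin.ext (h.unique h')) ?_
  intro y hy
  obtain ⟨x, hx⟩ := exists_par (k := k) (ty := ty) (y := y) (fun h => hy (Fin.ext h)) y.2
  exact ⟨⟨x, hx.lt.trans y.2⟩, hx⟩

/-- For every choice of types the real nodes lie in a ball of radius two, whence their pairwise
distances are at most `4`. -/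
theorem dist_zero_label_le (p : Fin k) :
    (ofTypes k ty).graph.dist 0 ((ofTypes k ty).label p) ≤ 2 := by
  have hadj : ∀ (x y : ℕ) (hx : x < (ofTypes k ty).size) (hy : y < (ofTypes k ty).size),
      Par k ty x y → (ofTypes k ty).graph.dist ⟨x, hx⟩ ⟨y, hy⟩ ≤ 1 := fun x y hx hy h =>
    ((SimpleGraph.dist_eq_one_iff_adj).2 ((adj_ofTypes _ _).2 (Or.inl h))).le
  have h01 : Par k ty 0 1 := Or.inl ⟨rfl, rfl⟩
  have hs : 1 < (ofTypes k ty).size := two_le_start (ty := ty) k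
  have hz : (0 : Fin (ofTypes k ty).size) = ⟨0, by omega⟩ := Fin.ext rfl
  have two : ∀ (x y : ℕ) (hx : x < (ofTypes k ty).size) (hy : y < (ofTypes k ty).size),
      Par k ty 0 x → Par k ty x y → (ofTypes k ty).graph.dist 0 ⟨y, hy⟩ ≤ 2 := by
    intro x y hx hy h h'
    rw [hz]
    exact (isTree_ofTypes.connected.dist_triangle (v := ⟨x, hx⟩)).trans
      (add_le_add (hadj 0 x (by omega) hx h) (hadj x y hx hy h'))
  have one : ∀ (y : ℕ) (hy : y < (ofTypes k ty).size),
      Par k ty 0 y → (ofTypes k ty).graph.dist 0 ⟨y, hy⟩ ≤ 2 := by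
    intro y hy h
    rw [hz]
    exact (hadj 0 y (by omega) hy h).trans (by omega)
  by_cases h0 : ty p = 0
  · have : (ofTypes k ty).label p = 0 := Fin.ext (by simp [ofTypes, nodeOf, h0])
    rw [this]
    simp
  have hn : nodeOf ty p = lower' ty p := if_neg h0
  have hlt := nodeOf_lt (ty := ty) p.2
  change (ofTypes k ty).graph.dist 0 ⟨nodeOf ty p, hlt⟩ ≤ 2
  have hpar : Par k ty (upper' ty p) (lower' ty p) := Or.inr ⟨p, p.2, Or.inr ⟨rfl, rfl⟩⟩
  by_cases h3 : ty p ≤ 3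
  · by_cases h4 : ty p = 3
    · refine two 1 _ hs _ h01 ?_
      rw [hn]
      simpa [upper', upper, h4] using hpar
    · refine one _ _ ?_
      rw [hn]
      simpa [upper', upper, h3, h4] using hpar
  · have hlow : lower ty p = start ty p := if_neg (by omega)
    have hup : upper ty p = 0 := if_neg (by omega)
    refine two (lower ty p) _ (lower_lt p.2) _ ?_ ?_
    · exact Or.inr ⟨p, p.2, Or.inl ⟨hup.symm, rfl⟩⟩
    · rw [hn, hlow]
      simpa [upper', h3] using hpar

/-- At most one vertex is the center, and at most one is its distinguished child. -/
def TypesValid (k : ℕ) (ty : ℕ → ℕ) : Prop :=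
  ∀ p < k, ∀ q < k, ty p ≤ 1 → ty p = ty q → p = q

theorem nodeOf_inBlock {p : ℕ} (h : 2 ≤ ty p) : InBlock ty p (nodeOf ty p) := by
  unfold InBlock nodeOf lower' lower width
  split_ifs <;> omega

theorem nodeOf_le_one {p : ℕ} (h : ty p ≤ 1) : nodeOf ty p = ty p := by
  unfold nodeOf lower' lower
  split_ifs <;> omega

theorem nodeOf_injective (hty : TypesValid k ty) {p q : ℕ} (hp : p < k) (hq : q < k)
    (h : nodeOf ty p = nodeOf ty q) : p = q := by
  by_cases h1 : ty p ≤ 1 <;> by_cases h2 : ty q ≤ 1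
  · rw [nodeOf_le_one h1, nodeOf_le_one h2] at h
    exact hty p hp q hq h1 h
  · have := (nodeOf_inBlock (ty := ty) (p := q) (by omega)).1
    have := two_le_start (ty := ty) q
    rw [← h, nodeOf_le_one h1] at *
    omega
  · have := (nodeOf_inBlock (ty := ty) (p := p) (by omega)).1
    have := two_le_start (ty := ty) p
    rw [h, nodeOf_le_one h2] at *
    omega
  · have h3 := nodeOf_inBlock (ty := ty) (p := p) (by omega)
    have h4 := nodeOf_inBlock (ty := ty) (p := q) (by omega)
    rw [h] at h3
    exact h3.unique h4

/-- A root of a complete graph only needs distinct real nodes at pairwise distance at most `4`.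
Hence every candidate of the algorithm is admissible without any test. -/
theorem isSteinerRoot_ofTypes {n : ℕ} {G : SimpleGraph (Fin n)} {K : Finset (Fin n)}
    (hK : G.IsClique (K : Set (Fin n))) (hty : TypesValid K.card ty) :
    IsSteinerRoot 4 (G.induce {v | v ∈ K}) (ofTypes K.card ty).graph (ofTypes K.card ty).real where
  isTree := isTree_ofTypes
  injective := by
    intro u v h
    have h' := nodeOf_injective hty (Fin.is_lt _) (Fin.is_lt _) (congrArg Fin.val h)
    exact (K.orderIsoOfFin rfl).symm.injective (Fin.ext h')
  induced := by
    ext u v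
    simp only [SimpleGraph.comap_adj, graphPower]
    constructor
    · rintro ⟨h, -⟩
      refine hK u.2 v.2 fun e => ?_
      rw [Subtype.ext e] at h
      simp at h
    · intro h
      refine ⟨?_, ?_⟩
      · refine isTree_ofTypes.connected.pos_dist_of_ne fun e => ?_
        have h' := nodeOf_injective hty (Fin.is_lt _) (Fin.is_lt _) (congrArg Fin.val e)
        have h'' := (K.orderIsoOfFin rfl).symm.injective (Fin.ext h')
        rw [h''] at h
        exact h.ne rfl
      · have h1 := dist_zero_label_le (ty := ty) ((K.orderIsoOfFin rfl).symm u)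
        have h2 := dist_zero_label_le (ty := ty) ((K.orderIsoOfFin rfl).symm v)
        have h3 := (isTree_ofTypes (k := K.card) (ty := ty)).connected.dist_triangle
          (u := (ofTypes K.card ty).real u) (v := 0) (w := (ofTypes K.card ty).real v)
        rw [SimpleGraph.dist_comm (v := 0)] at h3
        change (ofTypes K.card ty).graph.dist 0 ((ofTypes K.card ty).real u) ≤ 2 at h1
        change (ofTypes K.card ty).graph.dist 0 ((ofTypes K.card ty).real v) ≤ 2 at h2
        omega

open Classical in
/-- The node of a tree that corresponds to a node of the code. -/
noncomputable def place {W : Type*} (k : ℕ) (ty : ℕ → ℕ) (c b : W) (r m : ℕ → W) (x : ℕ) : W :=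
  if x = 0 then c else if x = 1 then b else
    if h : ∃ p < k, InBlock ty p x then
      if x = nodeOf ty h.choose then r h.choose else m h.choose
    else c

theorem place_inBlock {W : Type*} {c b : W} {r m : ℕ → W} {p x : ℕ} (hp : p < k)
    (h : InBlock ty p x) :
    place k ty c b r m x = if x = nodeOf ty p then r p else m p := by
  have h2 := two_le_start (ty := ty) p
  have h3 := h.1
  have hex : ∃ p < k, InBlock ty p x := ⟨p, hp, h⟩
  have e : hex.choose = p := hex.choose_spec.2.unique h
  rw [place, if_neg (by omega), if_neg (by omega), dif_pos hex, e]

/-- A tree with a center `c`, a distinguished child `b` of it and real nodes `r p`, `p < k`,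
joined to them as the types tell (with middle nodes `m p`), is isomorphic to the code. -/
theorem exists_iso_ofTypes {W : Type*} {T : SimpleGraph W} (hT : T.IsTree) (c b : W) (r m : ℕ → W)
    (hcb : T.Adj c b)
    (h0 : ∀ p < k, ty p = 0 ↔ r p = c) (h1 : ∀ p < k, ty p = 1 ↔ r p = b)
    (h2 : ∀ p < k, ty p = 2 → T.Adj c (r p)) (h3 : ∀ p < k, ty p = 3 → T.Adj b (r p))
    (h4 : ∀ p < k, 4 ≤ ty p → T.Adj c (m p) ∧ T.Adj (m p) (r p))
    (hr : ∀ p < k, ∀ q < k, r p = r q → p = q)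
    (hm : ∀ p < k, ∀ q < k, 4 ≤ ty p → 4 ≤ ty q → m p = m q → p = q)
    (hmb : ∀ p < k, 4 ≤ ty p → m p ≠ b) (hmr : ∀ p < k, ∀ q < k, 4 ≤ ty p → m p ≠ r q)
    (hsurj : ∀ w, w = c ∨ w = b ∨ (∃ p < k, w = r p) ∨ ∃ p < k, 4 ≤ ty p ∧ w = m p) :
    ∃ φ : T ≃g (ofTypes k ty).graph, ∀ p : Fin k, φ (r p) = (ofTypes k ty).label p := by
  have hs2 := two_le_start (ty := ty)
  set ψ : ℕ → W := place k ty c b r m with hψ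
  have p0 : ψ 0 = c := by simp [hψ, place]
  have p1 : ψ 1 = b := by simp [hψ, place]
  have hnode : ∀ p < k, ψ (nodeOf ty p) = r p := by
    intro p hp
    by_cases ht : ty p ≤ 1
    · rw [nodeOf_le_one ht]
      by_cases ht0 : ty p = 0
      · rw [ht0, p0, (h0 p hp).1 ht0]
      · have ht1 : ty p = 1 := by omega
        rw [ht1, p1, (h1 p hp).1 ht1]
    · rw [hψ, place_inBlock hp (nodeOf_inBlock (by omega)), if_pos rfl]
  have hmid : ∀ p < k, 4 ≤ ty p → ψ (start ty p) = m p := by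
    intro p hp ht
    have hn : nodeOf ty p = start ty p + 1 := by
      rw [nodeOf, if_neg (by omega), lower', if_neg (by omega)]
    have hb : InBlock ty p (start ty p) := ⟨le_rfl, by rw [width]; split_ifs <;> omega⟩
    rw [hψ, place_inBlock hp hb, if_neg (by omega)]
  have hblock : ∀ p < k, ∀ x, InBlock ty p x → x ≠ nodeOf ty p → 4 ≤ ty p ∧ x = start ty p := by
    intro p hp x hx hne
    have := hs2 p
    unfold InBlock width at hx
    unfold nodeOf lower' lower at hne
    split_ifs at * <;> omega
  have hcase : ∀ x < start ty k, x = 0 ∨ x = 1 ∨ (∃ p < k, 2 ≤ ty p ∧ x = nodeOf ty p) ∨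
      ∃ p < k, 4 ≤ ty p ∧ x = start ty p := by
    intro x hx
    by_cases hx2 : 2 ≤ x
    · obtain ⟨p, hp, hb⟩ := exists_inBlock hx2 hx
      by_cases hne : x = nodeOf ty p
      · refine Or.inr (Or.inr (Or.inl ⟨p, hp, ?_, hne⟩))
        by_contra h
        have : width (ty p) = 0 := if_pos (by omega)
        have := hb.1
        have := hb.2
        omega
      · exact Or.inr (Or.inr (Or.inr ⟨p, hp, hblock p hp x hb hne⟩))
    · omega
  have hmc : ∀ p < k, 4 ≤ ty p → m p ≠ c := fun p hp ht e => (h4 p hp ht).1.ne e.symm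
  have hcb' := hcb.ne
  have hinj : ∀ x < start ty k, ∀ y < start ty k, ψ x = ψ y → x = y := by
    intro x hx y hy hxy
    rcases hcase x hx with rfl | rfl | ⟨p, hp, ht, rfl⟩ | ⟨p, hp, ht, rfl⟩ <;>
    rcases hcase y hy with rfl | rfl | ⟨q, hq, hu, rfl⟩ | ⟨q, hq, hu, rfl⟩
    · rfl
    · rw [p0, p1] at hxy; exact absurd hxy hcb'
    · rw [p0, hnode q hq] at hxy; have := (h0 q hq).2 hxy.symm; omega
    · rw [p0, hmid q hq hu] at hxy; exact absurd hxy.symm (hmc q hq hu)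
    · rw [p0, p1] at hxy; exact absurd hxy.symm hcb'
    · rfl
    · rw [p1, hnode q hq] at hxy; have := (h1 q hq).2 hxy.symm; omega
    · rw [p1, hmid q hq hu] at hxy; exact absurd hxy.symm (hmb q hq hu)
    · rw [p0, hnode p hp] at hxy; have := (h0 p hp).2 hxy; omega
    · rw [p1, hnode p hp] at hxy; have := (h1 p hp).2 hxy; omega
    · rw [hnode p hp, hnode q hq] at hxy; rw [hr p hp q hq hxy]
    · rw [hnode p hp, hmid q hq hu] at hxy; exact absurd hxy.symm (hmr q hq p hp hu)
    · rw [p0, hmid p hp ht] at hxy; exact absurd hxy (hmc p hp ht)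
    · rw [p1, hmid p hp ht] at hxy; exact absurd hxy (hmb p hp ht)
    · rw [hmid p hp ht, hnode q hq] at hxy; exact absurd hxy (hmr p hp q hq ht)
    · rw [hmid p hp ht, hmid q hq hu] at hxy; rw [hm p hp q hq ht hu hxy]
  have hbij : Function.Bijective fun x : Fin (start ty k) => ψ x := by
    refine ⟨fun x y h => Fin.ext (hinj x x.2 y y.2 h), fun w => ?_⟩
    have hk := hs2 k
    rcases hsurj w with rfl | rfl | ⟨p, hp, rfl⟩ | ⟨p, hp, ht, rfl⟩
    · exact ⟨⟨0, by omega⟩, p0⟩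
    · exact ⟨⟨1, by omega⟩, p1⟩
    · exact ⟨⟨nodeOf ty p, nodeOf_lt hp⟩, hnode p hp⟩
    · have : start ty p < start ty k := by
        have := start_add_width_le (ty := ty) hp
        have hw : width (ty p) = 2 := by
          rw [width, if_neg (by omega), if_neg (by omega)]
        omega
      exact ⟨⟨start ty p, this⟩, hmid p hp ht⟩
  have hadj : ∀ x y, Par k ty x y → T.Adj (ψ x) (ψ y) := by
    rintro x y (⟨rfl, rfl⟩ | ⟨p, hp, hxy⟩)
    · rw [p0, p1]; exact hcb
    by_cases t1 : ty p ≤ 1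
    · have e : x = 0 ∧ y = 1 := by
        unfold upper' upper lower' lower at hxy
        split_ifs at hxy <;> omega
      rw [e.1, e.2, p0, p1]; exact hcb
    by_cases t2 : ty p = 2
    · have e : x = 0 ∧ y = nodeOf ty p := by
        unfold upper' upper lower' lower at hxy
        unfold nodeOf lower' lower
        split_ifs at * <;> omega
      rw [e.1, e.2, p0, hnode p hp]; exact h2 p hp t2
    by_cases t3 : ty p = 3
    · have e : x = 1 ∧ y = nodeOf ty p := by
        unfold upper' upper lower' lower at hxy
        unfold nodeOf lower' lower
        split_ifs at * <;> omega
      rw [e.1, e.2, p1, hnode p hp]; exact h3 p hp t3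
    · have t4 : 4 ≤ ty p := by omega
      have e : (x = 0 ∧ y = start ty p) ∨ (x = start ty p ∧ y = nodeOf ty p) := by
        unfold upper' upper lower' lower at hxy
        unfold nodeOf lower' lower
        split_ifs at * <;> omega
      rcases e with ⟨rfl, rfl⟩ | ⟨rfl, rfl⟩
      · rw [p0, hmid p hp t4]; exact (h4 p hp t4).1
      · rw [hmid p hp t4, hnode p hp]; exact (h4 p hp t4).2
  let e : Fin (ofTypes k ty).size ≃ W := Equiv.ofBijective _ hbij
  -- The bijection carries edges of the connected code to edges of the tree `T`, and this is enough
  -- for an isomorphism.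
  have hiso := hT.adj_iff_of_connected (isTree_ofTypes (k := k) (ty := ty)).connected e (by
    intro x y hxy
    rcases (adj_ofTypes x y).1 hxy with h | h
    · exact hadj x y h
    · exact (hadj y x h).symm)
  let φ : (ofTypes k ty).graph ≃g T := ⟨e, fun {x y} => hiso x y⟩
  refine ⟨φ.symm, fun p => ?_⟩
  rw [RelIso.symm_apply_eq]
  exact (hnode p p.2).symm

/-- The part of the encoding of `ofTypes` that describes edges. -/
theorem encode_ofTypes : (ofTypes k ty).encode =
    [start ty k, 1 + ∑ _p ∈ Finset.range k, 2] ++ [0, 1] ++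
      (List.range k).flatMap (fun p => [upper ty p, lower ty p, upper' ty p, lower' ty p]) ++
      (List.range k).flatMap fun p => [nodeOf ty p] := by
  have hr : List.range k = (List.finRange k).map Fin.val := by simp
  have hl : (List.finRange k).map (fun p : Fin k => nodeOf ty p) =
      (List.finRange k).flatMap fun p : Fin k => [nodeOf ty p] := (List.flatMap_pure_eq_map _ _).symm
  rw [hr, encode]
  simp only [ofTypes, edgesOfTypes, List.flatMap_cons, List.length_cons, List.flatMap_map, List.flatMap_assoc,
    List.length_flatMap, List.flatMap_nil, List.append_nil, Finset.sum_const, Finset.card_range,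
    List.ofFn_eq_map, hl]
  simp [add_comm]

end TreeCode

/-! ### The part of a well-structured root that is spanned by a leaf of a clique-tree -/

section LeafCliques

variable {V W : Type*} {G : SimpleGraph V} {T : SimpleGraph W} {ρ : V → W}

theorem IsSteinerRoot.adj_iff {k : ℕ} (h : IsSteinerRoot k G T ρ) (u v : V) :
    G.Adj u v ↔ u ≠ v ∧ T.dist (ρ u) (ρ v) ≤ k := by
  have e : G.Adj u v ↔ 0 < T.dist (ρ u) (ρ v) ∧ T.dist (ρ u) (ρ v) ≤ k := by
    conv_lhs => rw [← h.induced]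
    rfl
  rw [e]
  refine and_congr_left fun _ => ⟨?_, fun hne => ?_⟩
  · rintro h0 rfl
    simp at h0
  · exact h.isTree.connected.pos_dist_of_ne fun e => hne (h.injective e)

/-! ### Maximal cliques as balls of radius two -/

namespace IsMaxClique

variable {K K' : Set V}

theorem dist_le (hK : IsMaxClique G K) (h : IsSteinerRoot 4 G T ρ) {u v : V} (hu : u ∈ K)
    (hv : v ∈ K) : T.dist (ρ u) (ρ v) ≤ 4 := by
  by_cases e : u = v
  · subst e; simp
  · exact ((h.adj_iff u v).1 (hK.prop hu hv e)).2

theorem mem_of_dist_le (hK : IsMaxClique G K) (h : IsSteinerRoot 4 G T ρ) {v : V}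
    (hv : ∀ u ∈ K, T.dist (ρ v) (ρ u) ≤ 4) : v ∈ K := by
  have hc : G.IsClique (insert v K) := by
    rw [SimpleGraph.isClique_insert]
    exact ⟨hK.prop, fun u hu hne => (h.adj_iff v u).2 ⟨hne, hv u hu⟩⟩
  exact hK.le_of_ge hc (Set.subset_insert v K) (Set.mem_insert v K)

theorem eq_of_subset (hK : IsMaxClique G K) (hK' : IsMaxClique G K') (h : K ⊆ K') : K = K' :=
  hK.eq_of_le hK'.prop h

/-- Real nodes in a common ball of radius two are pairwise adjacent, so by maximality the clique
exhausts the ball. -/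
theorem mem_iff_dist_le (hK : IsMaxClique G K) (h : IsSteinerRoot 4 G T ρ) {c : W}
    (hc : ∀ v ∈ K, T.dist c (ρ v) ≤ 2) (v : V) : v ∈ K ↔ T.dist c (ρ v) ≤ 2 := by
  refine ⟨hc v, fun hv => hK.mem_of_dist_le h fun u hu => ?_⟩
  have h1 := h.isTree.connected.dist_triangle (u := ρ v) (v := c) (w := ρ u)
  have h2 := hc u hu
  rw [T.dist_comm (v := c)] at h1
  omega

theorem nonempty [Nonempty V] (hK : IsMaxClique G K) : K.Nonempty := by
  rw [Set.nonempty_iff_ne_empty]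
  rintro rfl
  obtain ⟨v⟩ := ‹Nonempty V›
  have := hK.le_of_ge (y := {v}) (SimpleGraph.IsClique.of_subsingleton Set.subsingleton_singleton)
    (Set.empty_subset _)
  exact this (Set.mem_singleton v)

theorem exists_ball [Finite V] [Nonempty V] (hK : IsMaxClique G K) (h : IsSteinerRoot 4 G T ρ) :
    ∃ c, ∀ v, v ∈ K ↔ T.dist c (ρ v) ≤ 2 := by
  obtain ⟨c, hc⟩ := h.isTree.exists_center (A := ρ '' K) (Set.toFinite _) (hK.nonempty.image ρ) (by
    rintro _ ⟨u, hu, rfl⟩ _ ⟨v, hv, rfl⟩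
    exact hK.dist_le h hu hv)
  exact ⟨c, hK.mem_iff_dist_le h fun v hv => hc _ ⟨v, hv, rfl⟩⟩

end IsMaxClique

/-- `K` is a maximal clique that meets every other maximal clique in a subset of `S`, where `S` is
empty or the intersection of `K` with another maximal clique. -/
structure IsLeafClique (G : SimpleGraph V) (K S : Set V) : Prop where
  isMax : IsMaxClique G K
  subset : S ⊆ K
  inter_subset : ∀ K', IsMaxClique G K' → K' ≠ K → K ∩ K' ⊆ S
  sep : S = ∅ ∨ ∃ P, IsMaxClique G P ∧ P ≠ K ∧ S = K ∩ P

/-- `c` is the center of the part of the root that is spanned by `K`. -/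
structure IsLeafCenter (T : SimpleGraph W) (ρ : V → W) (K S : Set V) (c : W) : Prop where
  mem_span : c ∈ spanNodes T (ρ '' K)
  mem_iff : ∀ v, v ∈ K ↔ T.dist c (ρ v) ≤ 2
  dist_eq : ∀ x ∈ K, x ∉ S → T.dist c (ρ x) = 2
  middle : ∀ x ∈ K, x ∉ S → ∀ w, T.Adj c w → T.Adj w (ρ x) →
    w ∉ Set.range ρ ∧ ∀ u, T.dist c (ρ u) = 2 → T.Adj w (ρ u) → u = x

namespace IsLeafClique

variable {K S : Set V}

/-- A clique-intersection properly inside `K` is contained in the trace of another maximal clique,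
hence in `S`. A sandwich is impossible because no clique-intersection properly contains a maximal
clique. -/
theorem isFree (hL : IsLeafClique G K S) {x : V} (hx : x ∈ K) (hxS : x ∉ S) : IsFree G K x := by
  refine ⟨hx, ?_, ?_⟩
  · rintro ⟨X, ⟨F, -, hF, rfl⟩, hXK, hxX, -⟩
    have : ∃ K' ∈ F, K' ≠ K := by
      by_contra! hall
      exact hXK.2 fun v hv K' hK' => (hall K' hK') ▸ hv
    obtain ⟨K', hK', hne⟩ := this
    exact hxS (hL.inter_subset K' (hF K' hK') hne ⟨hx, hxX K' hK'⟩)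
  · rintro ⟨X, -, ⟨F, ⟨K', hK'⟩, hF, rfl⟩, -, hKX, -, -⟩
    have h1 : K ⊆ K' := hKX.1.trans (Set.sInter_subset_of_mem hK')
    have h2 := hL.isMax.eq_of_subset (hF K' hK') h1
    exact hKX.2 ((Set.sInter_subset_of_mem hK').trans h2.symm.subset)

theorem exists_notMem [Nonempty V] (hL : IsLeafClique G K S) : ∃ x ∈ K, x ∉ S := by
  by_contra! h
  rcases hL.sep with rfl | ⟨P, hP, hne, rfl⟩
  · obtain ⟨x, hx⟩ := hL.isMax.nonempty
    exact h x hx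
  · exact hne (hL.isMax.eq_of_subset hP fun x hx => (h x hx).2).symm

/-- A leaf clique spans a tree of diameter `4`, in which the vertices outside `S` hang at the
center on private paths of length two. -/
theorem exists_isLeafCenter [Nonempty V] [Finite W] (hL : IsLeafClique G K S)
    (hT : IsWellStructured G T ρ) : ∃ c, IsLeafCenter T ρ K S c := by
  have hTree := hT.root.isTree
  obtain ⟨x₁, hx₁, hx₁S⟩ := hL.exists_notMem
  have hne : (ρ '' K).Nonempty := ⟨_, x₁, hx₁, rfl⟩
  have hKI : IsCliqueInter G K := ⟨{K}, ⟨K, rfl⟩, by rintro _ rfl; exact hL.isMax, by simp⟩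
  have hdiam := hT.diam K hL.isMax ⟨x₁, hL.isFree hx₁ hx₁S⟩
  set A := spanNodes T (ρ '' K) with hA
  have hsub : ρ '' K ⊆ A := SimpleGraph.IsTree.subset_spanNodes T _
  have : Nonempty A := ⟨⟨_, hsub hne.choose_spec⟩⟩
  have htop : (spanTree T (ρ '' K)).ediam ≠ ⊤ :=
    SimpleGraph.ediam_ne_top_of_diam_ne_zero (by rw [hdiam]; omega)
  have hediam : (spanTree T (ρ '' K)).ediam = 4 := by
    rw [SimpleGraph.diam] at hdiam
    rw [← ENat.natCast_toNat htop, hdiam]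
    rfl
  have hle4 : ∀ x ∈ A, ∀ y ∈ A, T.dist x y ≤ 4 := by
    intro x hx y hy
    rw [← hdiam, ← hTree.dist_spanTree hne ⟨x, hx⟩ ⟨y, hy⟩]
    exact SimpleGraph.dist_le_diam htop
  obtain ⟨x₀, y₀, hxy⟩ := SimpleGraph.exists_dist_eq_diam (G := spanTree T (ρ '' K))
  rw [hdiam, hTree.dist_spanTree hne] at hxy
  -- The center is the midpoint of a diametral path of length `4`.
  obtain ⟨c, hc1, hc2⟩ := hTree.exists_between (x := (x₀ : W)) (y := y₀) 2 (by omega)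
  have hcA : c ∈ A := hTree.mem_spanNodes_of_between x₀.2 y₀.2 (by omega)
  have hball : ∀ w ∈ A, T.dist c w ≤ 2 := by
    intro w hw
    have h1 := hTree.between_or_between (x := (x₀ : W)) (y := y₀) (c := c) (by omega) w
    have h2 := hle4 w hw x₀ x₀.2
    have h3 := hle4 w hw y₀ y₀.2
    rw [T.dist_comm (u := c) (v := x₀), T.dist_comm (u := w) (v := c)] at h1
    omega
  have hcen : (⟨c, hcA⟩ : A) ∈ (spanTree T (ρ '' K)).center := by
    rw [SimpleGraph.mem_center_iff]
    refine le_antisymm ?_ SimpleGraph.radius_le_eccent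
    have h1 : (spanTree T (ρ '' K)).eccent ⟨c, hcA⟩ ≤ 2 := by
      rw [SimpleGraph.eccent_le_iff]
      intro w
      rw [hTree.edist_spanTree hne]
      exact_mod_cast hball w w.2
    refine h1.trans ?_
    have h2 := SimpleGraph.ediam_le_two_mul_radius (G := spanTree T (ρ '' K))
    rw [hediam] at h2
    by_contra hlt
    rw [not_le] at hlt
    have h3 : (spanTree T (ρ '' K)).radius ≤ 1 := by simpa using hlt
    have h4 : (4 : ℕ∞) ≤ 2 * 1 := h2.trans (by gcongr)
    norm_num at h4
  have hrad : (spanTree T (ρ '' K)).radius ≤ 2 := by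
    rw [← (SimpleGraph.mem_center_iff _).1 hcen, SimpleGraph.eccent_le_iff]
    intro w
    rw [hTree.edist_spanTree hne]
    exact_mod_cast hball w w.2
  have hKne : K.Nonempty := ⟨x₁, hx₁⟩
  -- A free vertex has eccentricity `4`, so some node of the span is at distance `4` from it; as
  -- both lie in the ball of radius two around `c`, the free vertex is at distance exactly two from
  -- `c`.
  have hfar : ∀ x (hx : x ∈ K), x ∉ S → ∃ z ∈ A, T.dist (ρ x) z = 4 := by
    intro x hx hxS
    have h1 := (hT.leaf K hKI hKne x (hL.isFree hx hxS) ⟨ρ x, hsub ⟨x, hx, rfl⟩⟩ rfl).2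
    obtain ⟨z, hz⟩ := SimpleGraph.exists_edist_eq_eccent_of_finite (G := spanTree T (ρ '' K))
      ⟨ρ x, hsub ⟨x, hx, rfl⟩⟩
    rw [h1, hediam, hTree.edist_spanTree hne] at hz
    exact ⟨z, z.2, by exact_mod_cast hz⟩
  have hmem : ∀ v, v ∈ K ↔ T.dist c (ρ v) ≤ 2 :=
    hL.isMax.mem_iff_dist_le hT.root fun v hv => hball _ (hsub ⟨v, hv, rfl⟩)
  have hdist : ∀ x ∈ K, x ∉ S → T.dist c (ρ x) = 2 := by
    intro x hx hxS
    obtain ⟨z, hz, hxz⟩ := hfar x hx hxS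
    have h1 := hTree.connected.dist_triangle (u := ρ x) (v := c) (w := z)
    have h2 := hball z hz
    have h3 := (hmem x).1 hx
    rw [T.dist_comm (v := c)] at h1
    omega
  refine ⟨c, hcA, hmem, hdist, ?_⟩
  intro x hx hxS w hcw hwx
  have hxA : ρ x ∈ A := hsub ⟨x, hx, rfl⟩
  have hd := hdist x hx hxS
  have hcw1 : T.dist c w = 1 := SimpleGraph.dist_eq_one_iff_adj.2 hcw
  have hwx1 : T.dist w (ρ x) = 1 := SimpleGraph.dist_eq_one_iff_adj.2 hwx
  have hwA : w ∈ A := hTree.mem_spanNodes_of_between hcA hxA (by omega)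
  obtain ⟨z, hz, hxz⟩ := hfar x hx hxS
  -- The middle node `w` is at distance at least `3` from the node opposite to `ρ x`, so it is not
  -- central and the condition on inner nodes applies to it.
  have hwcen : (⟨w, hwA⟩ : A) ∉ (spanTree T (ρ '' K)).center := by
    rw [SimpleGraph.mem_center_iff]
    intro h
    have h1 : (spanTree T (ρ '' K)).edist ⟨w, hwA⟩ ⟨z, hz⟩ ≤ 2 :=
      SimpleGraph.edist_le_eccent.trans (h.le.trans hrad)
    rw [hTree.edist_spanTree hne] at h1
    have h2 : T.dist w z ≤ 2 := by exact_mod_cast h1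
    have h3 := hTree.connected.dist_triangle (u := ρ x) (v := w) (w := z)
    rw [T.dist_comm (v := w)] at h3
    omega
  obtain ⟨h1, h2⟩ := hT.inner K hKI hKne x (hL.isFree hx hxS) ⟨c, hcA⟩ hcen ⟨w, hwA⟩ hwcen
    hwx.ne (by
      simp only
      rw [T.dist_comm (v := w), T.dist_comm (v := c), T.dist_comm (v := c)]
      omega)
  refine ⟨h1, fun u hu hwu => ?_⟩
  -- Otherwise `c`, `ρ x` and `ρ u` would be three neighbours of `w` in the span, where `w` has
  -- degree two.
  by_contra hne'
  have huA : ρ u ∈ A := hsub ⟨u, (hmem u).2 hu.le, rfl⟩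
  have hsub3 : ({⟨c, hcA⟩, ⟨ρ x, hxA⟩, ⟨ρ u, huA⟩} : Set A) ⊆
      (spanTree T (ρ '' K)).neighborSet ⟨w, hwA⟩ := by
    rintro _ (rfl | rfl | rfl)
    · exact hcw.symm
    · exact hwx
    · exact hwu
  have h3 := Set.ncard_le_ncard hsub3 (Set.toFinite _)
  rw [h2, Set.ncard_insert_of_notMem, Set.ncard_pair] at h3
  · omega
  · intro e
    exact hne' (hT.root.injective (congrArg Subtype.val e)).symm
  · rintro (e | e)
    · have : c = ρ x := congrArg Subtype.val e
      rw [← this] at hd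
      simp at hd
    · have : c = ρ u := congrArg Subtype.val e
      rw [← this] at hu
      simp at hu

end IsLeafClique

namespace IsLeafCenter

variable {K S : Set V} {c : W}

/-- The vertices of `S` at distance two from the center have the same father. -/
theorem father_eq (hc : IsLeafCenter T ρ K S c) (hL : IsLeafClique G K S)
    (hT : IsSteinerRoot 4 G T ρ) {u v : V} (hu : u ∈ S) (hv : v ∈ S) {b w : W}
    (hub : T.Adj c b) (hub' : T.Adj b (ρ u)) (hu2 : T.dist c (ρ u) = 2)
    (hvw : T.Adj c w) (hvw' : T.Adj w (ρ v)) (hv2 : T.dist c (ρ v) = 2) : b = w := by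
  rcases hL.sep with rfl | ⟨P, hP, hne, rfl⟩
  · exact absurd hu (Set.notMem_empty u)
  by_contra hbw
  have hTree := hT.isTree
  have d1 : T.dist c b = 1 := SimpleGraph.dist_eq_one_iff_adj.2 hub
  have d2 : T.dist b (ρ u) = 1 := SimpleGraph.dist_eq_one_iff_adj.2 hub'
  have d3 : T.dist c w = 1 := SimpleGraph.dist_eq_one_iff_adj.2 hvw
  have d4 : T.dist w (ρ v) = 1 := SimpleGraph.dist_eq_one_iff_adj.2 hvw'
  have h1 : T.dist (ρ v) b ≠ 1 := by
    intro h
    have hvb : T.Adj (ρ v) b := SimpleGraph.dist_eq_one_iff_adj.1 h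
    exact hbw (hTree.parent_unique (r := c) hvb hvw'.symm (by omega) (by omega))
  have h2 := hTree.dist_eq_dist_add_one_of_adj (ρ v) hub
  rw [T.dist_comm (v := c)] at h2
  have h3 := hTree.dist_eq_of_split hub (x := ρ v) (y := ρ u)
    (by rw [T.dist_comm (v := c)]; omega)
    (by rw [T.dist_comm (v := c), T.dist_comm (v := b)]; omega)
  rw [T.dist_comm (v := c), hv2, d2] at h3
  -- Here `c` is the midpoint of the path of length four from `v` to `u`. Every vertex of `P` is
  -- within distance `4` of both ends, hence within distance `2` of `c`, so `P ⊆ K`.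
  refine hne (hP.eq_of_subset hL.isMax fun y hy => ?_)
  rw [hc.mem_iff]
  have h4 := hTree.between_or_between (x := ρ v) (y := ρ u) (c := c)
    (by rw [T.dist_comm (v := c)]; omega) (ρ y)
  have h5 := hP.dist_le hT hy hu.2
  have h6 := hP.dist_le hT hy hv.2
  rw [T.dist_comm (u := ρ y) (v := c)] at h4
  omega

end IsLeafCenter

/-- The vertices of `K` at distance two from `c` that are adjacent to `b`. -/
def lowerSet (T : SimpleGraph W) (ρ : V → W) (c b : W) : Set V :=
  {u | T.dist c (ρ u) = 2 ∧ T.Adj b (ρ u)}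

/-- The admissible choices of the distinguished child `b` of the center `c`. -/
structure IsLeafChild (T : SimpleGraph W) (ρ : V → W) (K S : Set V) (c b : W) : Prop where
  adj : T.Adj c b
  mem_span : b ∈ spanNodes T (ρ '' K)
  adj_of_mem : ∀ u ∈ S, T.dist c (ρ u) = 2 → T.Adj b (ρ u)

theorem SimpleGraph.IsTree.dist_eq_two (hT : T.IsTree) {a b c : W} (h : T.Adj a b)
    (h' : T.Adj b c) (hne : a ≠ c) : T.dist a c = 2 := by
  have h1 : T.dist a b = 1 := SimpleGraph.dist_eq_one_iff_adj.2 h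
  have h2 := hT.dist_eq_dist_add_one_of_adj a h'
  have h3 := hT.connected.pos_dist_of_ne hne
  omega

theorem SimpleGraph.IsTree.exists_middle (hT : T.IsTree) {a c : W} (h : T.dist a c = 2) :
    ∃ b, T.Adj a b ∧ T.Adj b c := by
  obtain ⟨b, h1, h2⟩ := hT.exists_between (x := a) (y := c) 1 (by omega)
  rw [h] at h2
  exact ⟨b, SimpleGraph.dist_eq_one_iff_adj.1 h1, SimpleGraph.dist_eq_one_iff_adj.1 h2⟩

/-- If a vertex of `S` is at distance two from `c`, its father is the only possible choice, and no
private path can pass through it. Otherwise any child of `c` would do, and it is chosen in the span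
so that at most one vertex lies below it. -/
theorem IsLeafCenter.exists_isLeafChild [Nonempty V] {K S : Set V} {c : W}
    (hc : IsLeafCenter T ρ K S c) (hL : IsLeafClique G K S) (hT : IsSteinerRoot 4 G T ρ) :
    ∃ b, IsLeafChild T ρ K S c b ∧ ((∃ x, lowerSet T ρ c b ⊆ {x} ∧ lowerSet T ρ c b ∩ S = ∅) ∨
      ((∃ s ∈ S, s ∈ lowerSet T ρ c b) ∧ lowerSet T ρ c b ⊆ S)) := by
  have hTree := hT.isTree
  have hsub : ρ '' K ⊆ spanNodes T (ρ '' K) := SimpleGraph.IsTree.subset_spanNodes T _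
  by_cases hA : ∃ s ∈ S, T.dist c (ρ s) = 2
  · obtain ⟨s, hs, hs2⟩ := hA
    obtain ⟨b, hcb, hbs⟩ := hTree.exists_middle hs2
    refine ⟨b, ⟨hcb, ?_, ?_⟩, Or.inr ⟨⟨s, hs, hs2, hbs⟩, ?_⟩⟩
    · refine hTree.mem_spanNodes_of_between hc.mem_span (hsub ⟨s, hL.subset hs, rfl⟩) ?_
      rw [hs2, SimpleGraph.dist_eq_one_iff_adj.2 hcb, SimpleGraph.dist_eq_one_iff_adj.2 hbs]
    · intro u hu hu2
      obtain ⟨w, hcw, hwu⟩ := hTree.exists_middle hu2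
      rw [hc.father_eq hL hT hs hu hcb hbs hs2 hcw hwu hu2]
      exact hwu
    · rintro x ⟨hx2, hbx⟩
      by_contra hxS
      have hsx := (hc.middle x ((hc.mem_iff x).2 hx2.le) hxS b hcb hbx).2 s hs2 hbs
      exact hxS (hsx ▸ hs)
  push Not at hA
  -- No vertex of `S` is at distance two. A vertex of `S` other than the center then sits on a child
  -- of `c`, and nothing lies below this real node because middle nodes of private paths are Steiner
  -- nodes.
  by_cases hB : ∃ s ∈ S, ρ s ≠ c
  · obtain ⟨s, hs, hsc⟩ := hB
    have h1 := (hc.mem_iff s).1 (hL.subset hs)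
    have h2 := hA s hs
    have h3 := hTree.connected.pos_dist_of_ne hsc.symm
    have hcs : T.Adj c (ρ s) := SimpleGraph.dist_eq_one_iff_adj.1 (by omega)
    refine ⟨ρ s, ⟨hcs, hsub ⟨s, hL.subset hs, rfl⟩, fun u hu hu2 => absurd hu2 (hA u hu)⟩,
      Or.inl ⟨s, ?_, ?_⟩⟩
    · rintro x ⟨hx2, hsx⟩
      exfalso
      by_cases hxS : x ∈ S
      · exact hA x hxS hx2
      · exact (hc.middle x ((hc.mem_iff x).2 hx2.le) hxS _ hcs hsx).1 ⟨s, rfl⟩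
    · ext x
      simp only [Set.mem_inter_iff, Set.mem_empty_iff_false, iff_false, not_and]
      exact fun hx hxS => hA x hxS hx.1
  -- Now no vertex of `S` lies off the center. The middle node of a private path serves as `b`, and
  -- its end is the one vertex below `b`.
  · push Not at hB
    obtain ⟨x, hx, hxS⟩ := hL.exists_notMem
    obtain ⟨b, hcb, hbx⟩ := hTree.exists_middle (hc.dist_eq x hx hxS)
    refine ⟨b, ⟨hcb, ?_, fun u hu hu2 => absurd hu2 (hA u hu)⟩, Or.inl ⟨x, ?_, ?_⟩⟩
    · refine hTree.mem_spanNodes_of_between hc.mem_span (hsub ⟨x, hx, rfl⟩) ?_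
      rw [hc.dist_eq x hx hxS, SimpleGraph.dist_eq_one_iff_adj.2 hcb,
        SimpleGraph.dist_eq_one_iff_adj.2 hbx]
    · rintro u ⟨hu2, hbu⟩
      exact (hc.middle x hx hxS b hcb hbx).2 u hu2 hbu
    · ext u
      simp only [Set.mem_inter_iff, Set.mem_empty_iff_false, iff_false, not_and]
      exact fun hu huS => hA u huS hu.1

/-- The tree spanned by a leaf clique, with its vertices enumerated as `v 0, …, v (k - 1)`, is
described by the types of the vertices. -/
theorem IsLeafChild.exists_iso {K S : Set V} {c b : W} (hb : IsLeafChild T ρ K S c b)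
    (hc : IsLeafCenter T ρ K S c) (hT : IsSteinerRoot 4 G T ρ) (k : ℕ) (v : ℕ → V)
    (hv : ∀ u, u ∈ K ↔ ∃ p < k, v p = u) (hinj : ∀ p < k, ∀ q < k, v p = v q → p = q) (ty : ℕ → ℕ)
    (hty : ∀ p < k, (ρ (v p) = c ∧ ty p = 0) ∨ (ρ (v p) = b ∧ ty p = 1) ∨
      (v p ∈ lowerSet T ρ c b ∧ ty p = 3) ∨
      (ρ (v p) ≠ c ∧ ρ (v p) ≠ b ∧ v p ∉ lowerSet T ρ c b ∧ v p ∈ S ∧ ty p = 2) ∨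
      (ρ (v p) ≠ c ∧ ρ (v p) ≠ b ∧ v p ∉ lowerSet T ρ c b ∧ v p ∉ S ∧ ty p = 4)) :
    ∃ φ : spanTree T (ρ '' K) ≃g (TreeCode.ofTypes k ty).graph,
      ∀ (p : Fin k) (h : ρ (v p) ∈ spanNodes T (ρ '' K)),
        φ ⟨ρ (v p), h⟩ = (TreeCode.ofTypes k ty).label p := by
  classical
  have hTree := hT.isTree
  have hsub : ρ '' K ⊆ spanNodes T (ρ '' K) := SimpleGraph.IsTree.subset_spanNodes T _
  have hKne : (ρ '' K).Nonempty := by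
    rw [Set.nonempty_iff_ne_empty]
    intro h
    -- For empty `K` the single node `c` is a connected set containing the image, so the span could
    -- not contain `b ≠ c`.
    have : spanNodes T (ρ '' K) ⊆ {c} := by
      rw [h]
      refine Set.sInter_subset_of_mem ⟨Set.empty_subset _, ?_⟩
      exact (SimpleGraph.IsTree.of_subsingleton (V := ({c} : Set W))).connected
    exact hb.adj.ne (this hb.mem_span).symm
  have hvK : ∀ p < k, v p ∈ K := fun p hp => (hv _).2 ⟨p, hp, rfl⟩
  have hspan := hTree.spanNodes_eq hKne hc.mem_span
  have hSpanTree : (spanTree T (ρ '' K)).IsTree :=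
    ⟨hTree.connected_spanTree hKne, hTree.isAcyclic.induce _⟩
  have dcb : T.dist c b = 1 := SimpleGraph.dist_eq_one_iff_adj.2 hb.adj
  have hcb := hb.adj.ne
  have hleg : ∀ p < k, 4 ≤ ty p → v p ∉ lowerSet T ρ c b ∧ v p ∉ S := by
    intro p hp h
    rcases hty p hp with h' | h' | h' | h' | h'
    · omega
    · omega
    · omega
    · omega
    · exact ⟨h'.2.2.1, h'.2.2.2.1⟩
  have hmid : ∀ p, ∃ w, p < k → 4 ≤ ty p → T.Adj c w ∧ T.Adj w (ρ (v p)) := by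
    intro p
    by_cases h : p < k ∧ 4 ≤ ty p
    · obtain ⟨w, hw⟩ := hTree.exists_middle (hc.dist_eq _ (hvK p h.1) (hleg p h.1 h.2).2)
      exact ⟨w, fun _ _ => hw⟩
    · exact ⟨c, fun h1 h2 => absurd ⟨h1, h2⟩ h⟩
  choose m hm using hmid
  have hmspan : ∀ p < k, 4 ≤ ty p → m p ∈ spanNodes T (ρ '' K) := by
    intro p hp h
    refine hTree.mem_spanNodes_of_between hc.mem_span (hsub ⟨v p, hvK p hp, rfl⟩) ?_
    rw [hc.dist_eq _ (hvK p hp) (hleg p hp h).2, SimpleGraph.dist_eq_one_iff_adj.2 (hm p hp h).1,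
      SimpleGraph.dist_eq_one_iff_adj.2 (hm p hp h).2]
  let C : spanNodes T (ρ '' K) := ⟨c, hc.mem_span⟩
  let r : ℕ → spanNodes T (ρ '' K) := fun p =>
    if h : p < k then ⟨ρ (v p), hsub ⟨v p, hvK p h, rfl⟩⟩ else C
  let m' : ℕ → spanNodes T (ρ '' K) := fun p =>
    if h : p < k ∧ 4 ≤ ty p then ⟨m p, hmspan p h.1 h.2⟩ else C
  have hr : ∀ p < k, (r p : W) = ρ (v p) := fun p hp => by simp only [r]; rw [dif_pos hp]
  have hm' : ∀ p < k, 4 ≤ ty p → (m' p : W) = m p := fun p hp h => by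
    simp only [m']; rw [dif_pos ⟨hp, h⟩]
  have hlow : ∀ u, u ∈ lowerSet T ρ c b → ρ u ≠ c ∧ ρ u ≠ b := by
    rintro u ⟨hu, -⟩
    constructor
    · intro e; rw [e] at hu; simp at hu
    · intro e; rw [e] at hu; omega
  have hadj : ∀ x y : spanNodes T (ρ '' K), (spanTree T (ρ '' K)).Adj x y ↔ T.Adj (x : W) y :=
    fun x y => Iff.rfl
  suffices H : ∃ φ : spanTree T (ρ '' K) ≃g (TreeCode.ofTypes k ty).graph,
      ∀ p : Fin k, φ (r p) = (TreeCode.ofTypes k ty).label p by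
    obtain ⟨φ, hφ⟩ := H
    refine ⟨φ, fun p h => ?_⟩
    rw [← hφ p]
    congr 1
    exact Subtype.ext (hr p p.2).symm
  refine TreeCode.exists_iso_ofTypes hSpanTree C ⟨b, hb.mem_span⟩ r m'
    hb.adj ?_ ?_ ?_ ?_ ?_ ?_ ?_ ?_ ?_ ?_
  · intro p hp
    rw [Subtype.ext_iff, hr p hp]
    change _ ↔ ρ (v p) = c
    rcases hty p hp with h' | h' | h' | h' | h'
    · exact iff_of_true h'.2 h'.1
    · exact iff_of_false (by omega) (by rw [h'.1]; exact hcb.symm)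
    · exact iff_of_false (by omega) (hlow _ h'.1).1
    · exact iff_of_false (by omega) h'.1
    · exact iff_of_false (by omega) h'.1
  · intro p hp
    rw [Subtype.ext_iff, hr p hp]
    change _ ↔ ρ (v p) = b
    rcases hty p hp with h' | h' | h' | h' | h'
    · exact iff_of_false (by omega) (by rw [h'.1]; exact hcb)
    · exact iff_of_true h'.2 h'.1
    · exact iff_of_false (by omega) (hlow _ h'.1).2
    · exact iff_of_false (by omega) h'.2.1
    · exact iff_of_false (by omega) h'.2.1
  · intro p hp h
    rw [hadj, hr p hp]
    change T.Adj c _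
    rcases hty p hp with h' | h' | h' | h' | h'
    · omega
    · omega
    · omega
    · have h1 := (hc.mem_iff _).1 (hvK p hp)
      have h2 := hTree.connected.pos_dist_of_ne h'.1.symm
      have h3 : T.dist c (ρ (v p)) ≠ 2 := fun e =>
        h'.2.2.1 ⟨e, hb.adj_of_mem _ h'.2.2.2.1 e⟩
      exact SimpleGraph.dist_eq_one_iff_adj.1 (by omega)
    · omega
  · intro p hp h
    rw [hadj, hr p hp]
    change T.Adj b _
    rcases hty p hp with h' | h' | h' | h' | h'
    · omega
    · omega
    · exact h'.1.2
    · omega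
    · omega
  · intro p hp h
    rw [hadj, hadj, hr p hp, hm' p hp h]
    exact hm p hp h
  · intro p hp q hq h
    rw [Subtype.ext_iff, hr p hp, hr q hq] at h
    exact hinj p hp q hq (hT.injective h)
  · intro p hp q hq h h' e
    rw [Subtype.ext_iff, hm' p hp h, hm' q hq h'] at e
    have h1 := hm q hq h'
    refine hinj p hp q hq ((hc.middle (v q) (hvK q hq) (hleg q hq h').2 _ h1.1 h1.2).2 (v p) ?_ ?_)
    · exact hc.dist_eq _ (hvK p hp) (hleg p hp h).2
    · rw [← e]
      exact (hm p hp h).2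
  · intro p hp h e
    rw [Subtype.ext_iff, hm' p hp h] at e
    change m p = b at e
    refine (hleg p hp h).1 ⟨hc.dist_eq _ (hvK p hp) (hleg p hp h).2, ?_⟩
    rw [← e]
    exact (hm p hp h).2
  · intro p hp q hq h e
    rw [Subtype.ext_iff, hm' p hp h, hr q hq] at e
    have h1 := hm p hp h
    exact (hc.middle (v p) (hvK p hp) (hleg p hp h).2 _ h1.1 h1.2).1 ⟨v q, e.symm⟩
  -- Every node of the span lies on the path from `c` to a real node of `K`. An inner node of such a
  -- path is `b` or the middle node of a private path.
  · rintro ⟨w, hw⟩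
    have hw' := hw
    rw [hspan] at hw'
    obtain ⟨_, ⟨u, hu, rfl⟩, hd⟩ := hw'
    obtain ⟨p, hp, rfl⟩ := (hv u).1 hu
    change T.dist c w + T.dist w (ρ (v p)) = T.dist c (ρ (v p)) at hd
    have hu2 := (hc.mem_iff _).1 hu
    by_cases h0 : T.dist c w = 0
    · left
      exact Subtype.ext ((hTree.connected.dist_eq_zero_iff).1 h0).symm
    by_cases h0' : T.dist w (ρ (v p)) = 0
    · right; right; left
      refine ⟨p, hp, Subtype.ext ?_⟩
      rw [hr p hp]
      exact (hTree.connected.dist_eq_zero_iff).1 h0'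
    have hcw : T.Adj c w := SimpleGraph.dist_eq_one_iff_adj.1 (by omega)
    have hwp : T.Adj w (ρ (v p)) := SimpleGraph.dist_eq_one_iff_adj.1 (by omega)
    have hp2 : T.dist c (ρ (v p)) = 2 := by omega
    have hb' : T.Adj b (ρ (v p)) → w = b := fun h =>
      hTree.parent_unique (r := c) hwp.symm h.symm (by omega) (by omega)
    rcases hty p hp with h' | h' | h' | h' | h'
    · rw [h'.1] at hp2; simp at hp2
    · rw [h'.1] at hp2; omega
    · right; left
      exact Subtype.ext (hb' h'.1.2)
    · right; left
      exact Subtype.ext (hb' (hb.adj_of_mem _ h'.2.2.2.1 hp2))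
    · right; right; right
      have h4 : 4 ≤ ty p := by omega
      refine ⟨p, hp, h4, Subtype.ext ?_⟩
      rw [hm' p hp h4]
      change w = m p
      have h1 := hm p hp h4
      have h2 : T.dist c (m p) = 1 := SimpleGraph.dist_eq_one_iff_adj.2 h1.1
      exact hTree.parent_unique (r := c) hwp.symm h1.2.symm (by omega) (by omega)

end LeafCliques

/-! ### Traces of maximal cliques on a leaf clique -/

section Traces

variable {V W : Type*} {G : SimpleGraph V} {T : SimpleGraph W} {ρ : V → W}

/-- The ball of radius two around a node `z` on the side of `a` of an edge `ab`, restricted to a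
set of vertices on nodes that are equal or adjacent to `a` or `b`. -/
theorem SimpleGraph.IsTree.ball_cases (hT : T.IsTree) {a b z : W} (hab : T.Adj a b)
    (hz : T.dist z a < T.dist z b) {S : Set W} (hS : ∀ v ∈ S, T.dist a v ≤ 1 ∨ T.dist b v ≤ 1) :
    z = a ∨ (∀ v ∈ S, T.dist z v ≤ 2 ↔ v = a ∨ ¬ T.Adj b v) ∨
    (2 ≤ T.dist z a ∧ (∀ v ∈ S, T.dist z v ≤ 2 → v = a ∨ (T.Adj a v ∧ v ≠ b)) ∧
      ∀ v ∈ S, ∀ v' ∈ S, T.dist z v ≤ 2 → T.dist z v' ≤ 2 → v ≠ a → v' ≠ a → v = v') := by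
  have hab1 : T.dist a b = 1 := SimpleGraph.dist_eq_one_iff_adj.2 hab
  have hzb : T.dist z b = T.dist z a + 1 := by
    have := hT.dist_eq_dist_add_one_of_adj z hab
    omega
  have hlow : ∀ v, T.Adj b v → v ≠ a → T.dist z v = T.dist z a + 2 := by
    intro v hbv hva
    have h1 := hT.dist_eq_two hab hbv hva.symm
    have h2 : T.dist b v = 1 := SimpleGraph.dist_eq_one_iff_adj.2 hbv
    have := hT.dist_eq_of_split hab (x := z) (y := v) hz
      (by rw [T.dist_comm (u := v), T.dist_comm (u := v)]; omega)
    omega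
  have hcase : ∀ v ∈ S, v = a ∨ v = b ∨ (T.Adj a v ∧ v ≠ b ∧ ¬ T.Adj b v) ∨
      (T.Adj b v ∧ v ≠ a ∧ ¬ T.Adj a v) := by
    intro v hv
    by_cases hva : v = a
    · exact Or.inl hva
    by_cases hvb : v = b
    · exact Or.inr (Or.inl hvb)
    have hnot : ¬ (T.Adj a v ∧ T.Adj b v) := by
      rintro ⟨h1, h2⟩
      have := hT.dist_eq_two hab h2 (Ne.symm hva)
      rw [SimpleGraph.dist_eq_one_iff_adj.2 h1] at this
      omega
    have h3 := hT.connected.pos_dist_of_ne (Ne.symm hva)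
    have h4 := hT.connected.pos_dist_of_ne (Ne.symm hvb)
    rcases hS v hv with h | h
    · have : T.Adj a v := SimpleGraph.dist_eq_one_iff_adj.1 (by omega)
      exact Or.inr (Or.inr (Or.inl ⟨this, hvb, fun h' => hnot ⟨this, h'⟩⟩))
    · have : T.Adj b v := SimpleGraph.dist_eq_one_iff_adj.1 (by omega)
      exact Or.inr (Or.inr (Or.inr ⟨this, hva, fun h' => hnot ⟨h', this⟩⟩))
  by_cases h0 : T.dist z a = 0
  · exact Or.inl ((hT.connected.dist_eq_zero_iff).1 h0)
  by_cases h1 : T.dist z a = 1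
  · right; left
    intro v hv
    rcases hcase v hv with rfl | rfl | ⟨hav, hvb, hbv⟩ | ⟨hbv, hva, -⟩
    · simp [h1]
    · simp [hzb, h1]
    · simp only [hbv, not_false_iff, or_true, iff_true]
      have := hT.connected.dist_triangle (u := z) (v := a) (w := v)
      rw [SimpleGraph.dist_eq_one_iff_adj.2 hav] at this
      omega
    · have := hlow v hbv hva
      simp only [hbv, hva, not_true, or_self, iff_false]
      omega
  · right; right
    -- When `z` is at distance at least two from `a`, the ball can reach, besides `a`, only the
    -- neighbour of `a` in the direction of `z`; there is just one.
    have hup : ∀ v ∈ S, T.dist z v ≤ 2 → v = a ∨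
        (T.Adj a v ∧ v ≠ b ∧ T.dist z a = T.dist z v + 1) := by
      intro v hv hzv
      rcases hcase v hv with rfl | rfl | ⟨hav, hvb, hbv⟩ | ⟨hbv, hva, -⟩
      · exact Or.inl rfl
      · omega
      · have := hT.dist_eq_dist_add_one_of_adj z hav
        exact Or.inr ⟨hav, hvb, by omega⟩
      · have := hlow v hbv hva
        omega
    refine ⟨by omega, fun v hv h => ?_, fun v hv v' hv' h h' hva hva' => ?_⟩
    · rcases hup v hv h with h | h
      · exact Or.inl h
      · exact Or.inr ⟨h.1, h.2.1⟩
    · rcases hup v hv h with h | h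
      · exact absurd h hva
      rcases hup v' hv' h' with h' | h'
      · exact absurd h' hva'
      exact hT.parent_unique (r := z) h.1 h'.1 h.2.2 h'.2.2

/-- The other vertices of `S` at the center `c`. -/
def upperSet (T : SimpleGraph W) (ρ : V → W) (S : Set V) (c b : W) : Set V :=
  {u | u ∈ S ∧ T.Adj c (ρ u) ∧ ρ u ≠ b}

/-- A set of the form `{c, u}`, or smaller, for a vertex `u` adjacent to `c`. -/
def IsSmallTrace (ρ : V → W) (c : W) (L X : Set V) : Prop :=
  (∀ v ∈ X, ρ v = c ∨ v ∈ L) ∧ ∀ v ∈ X, ∀ v' ∈ X, ρ v ≠ c → ρ v' ≠ c → v = v'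

/-- The center of a leaf clique with a distinguished child, both having real children in `S`. -/
structure IsBistar (T : SimpleGraph W) (ρ : V → W) (K S : Set V) (c b : W) : Prop where
  center : IsLeafCenter T ρ K S c
  child : IsLeafChild T ρ K S c b
  lower_subset : lowerSet T ρ c b ⊆ S
  lower : (lowerSet T ρ c b).Nonempty
  upper : (upperSet T ρ S c b).Nonempty

namespace IsBistar

variable {K S : Set V} {c b : W}

theorem dist_le (h : IsBistar T ρ K S c b) (hL : IsLeafClique G K S)
    {v : V} (hv : v ∈ S) : T.dist c (ρ v) ≤ 1 ∨ T.dist b (ρ v) ≤ 1 := by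
  have h1 := (h.center.mem_iff v).1 (hL.subset hv)
  by_cases h2 : T.dist c (ρ v) = 2
  · right
    exact (SimpleGraph.dist_eq_one_iff_adj.2 (h.child.adj_of_mem v hv h2)).le
  · left; omega

theorem mem_cases (h : IsBistar T ρ K S c b) (hL : IsLeafClique G K S) (hT : IsSteinerRoot 4 G T ρ)
    {v : V} (hv : v ∈ S) : ρ v = c ∨ ρ v = b ∨ v ∈ upperSet T ρ S c b ∨ v ∈ lowerSet T ρ c b := by
  by_cases hc : ρ v = c
  · exact Or.inl hc
  by_cases hb : ρ v = b
  · exact Or.inr (Or.inl hb)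
  have h1 := (h.center.mem_iff v).1 (hL.subset hv)
  have h2 := hT.isTree.connected.pos_dist_of_ne (Ne.symm hc)
  by_cases h3 : T.dist c (ρ v) = 2
  · exact Or.inr (Or.inr (Or.inr ⟨h3, h.child.adj_of_mem v hv h3⟩))
  · exact Or.inr (Or.inr (Or.inl ⟨hv, SimpleGraph.dist_eq_one_iff_adj.1 (by omega), hb⟩))

theorem upper_notMem_lower {u : V} (hu : u ∈ upperSet T ρ S c b) : u ∉ lowerSet T ρ c b := by
  rintro ⟨h, -⟩
  rw [SimpleGraph.dist_eq_one_iff_adj.2 hu.2.1] at h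
  omega

theorem lower_ne {u : V} (hu : u ∈ lowerSet T ρ c b) :
    ρ u ≠ c ∧ ρ u ≠ b := by
  refine ⟨fun e => ?_, hu.2.ne.symm⟩
  have := hu.1
  rw [e] at this
  simp at this

theorem upper_ne {u : V} (hu : u ∈ upperSet T ρ S c b) : ρ u ≠ c ∧ ρ u ≠ b :=
  ⟨hu.2.1.ne.symm, hu.2.2⟩

theorem adj_iff_lower (h : IsBistar T ρ K S c b) (hT : IsSteinerRoot 4 G T ρ) {v : V} :
    (ρ v = c ∨ ¬ T.Adj b (ρ v)) ↔ v ∉ lowerSet T ρ c b := by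
  constructor
  · rintro (e | e) hv
    · exact (lower_ne hv).1 e
    · exact e hv.2
  · intro hv
    by_contra! hn
    exact hv ⟨hT.isTree.dist_eq_two h.child.adj hn.2 hn.1.symm, hn.2⟩

/-- The clique `K'` is a ball around some `z`, and removing the edge `cb` leaves `z` on one side. On
the side of `c`, the position `z = c` would give `K' = K`, a neighbour of `c` loses exactly the
vertices below `b`, and a farther `z` sees at most the center and one vertex of the upper set; the
side of `b` is symmetric, with `z = b` giving all of `S`. Two alternatives keep the position of `z`,
which is needed to rule out sandwiched vertices. -/
theorem trace_cases [Finite V] [Nonempty V] (h : IsBistar T ρ K S c b) (hL : IsLeafClique G K S)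
    (hT : IsSteinerRoot 4 G T ρ) {K' : Set V} (hK' : IsMaxClique G K') (hne : K' ≠ K) :
    (K ∩ K' = S ∧ ∀ v, v ∈ K' ↔ T.dist b (ρ v) ≤ 2) ∨ K ∩ K' = S \ lowerSet T ρ c b ∨
      K ∩ K' = S \ upperSet T ρ S c b ∨
      (IsSmallTrace ρ c (upperSet T ρ S c b) (K ∩ K') ∧
        ∃ z, 2 ≤ T.dist z c ∧ T.dist z c < T.dist z b ∧ ∀ v, v ∈ K' ↔ T.dist z (ρ v) ≤ 2) ∨
      IsSmallTrace ρ b (lowerSet T ρ c b) (K ∩ K') := by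
  have hTree := hT.isTree
  obtain ⟨z, hz⟩ := hK'.exists_ball hT
  have hS : ∀ w ∈ ρ '' S, T.dist c w ≤ 1 ∨ T.dist b w ≤ 1 := by
    rintro _ ⟨v, hv, rfl⟩
    exact h.dist_le hL hv
  have hin := hL.inter_subset K' hK' hne
  have hside := hTree.dist_eq_dist_add_one_of_adj z h.child.adj
  by_cases hzc : T.dist z c < T.dist z b
  · rcases hTree.ball_cases h.child.adj hzc hS with rfl | h1 | ⟨h2, h3, h4⟩
    · exact absurd (hK'.eq_of_subset hL.isMax fun v hv =>
        (h.center.mem_iff v).2 ((hz v).1 hv)) hne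
    · right; left
      ext v
      constructor
      · intro hv
        have hvS := hin hv
        exact ⟨hvS, (h.adj_iff_lower hT).1 ((h1 _ ⟨v, hvS, rfl⟩).1 ((hz v).1 hv.2))⟩
      · rintro ⟨hvS, hv⟩
        exact ⟨hL.subset hvS, (hz v).2 ((h1 _ ⟨v, hvS, rfl⟩).2 ((h.adj_iff_lower hT).2 hv))⟩
    · right; right; right; left
      refine ⟨⟨fun v hv => ?_, fun v hv v' hv' hc hc' => ?_⟩, z, h2, hzc, hz⟩
      · rcases h3 _ ⟨v, hin hv, rfl⟩ ((hz v).1 hv.2) with e | ⟨e, e'⟩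
        · exact Or.inl e
        · exact Or.inr ⟨hin hv, e, e'⟩
      · exact hT.injective (h4 _ ⟨v, hin hv, rfl⟩ _ ⟨v', hin hv', rfl⟩ ((hz v).1 hv.2)
          ((hz v').1 hv'.2) hc hc')
  · rcases hTree.ball_cases h.child.adj.symm (z := z) (by omega) (fun w hw => (hS w hw).symm) with
      rfl | h1 | ⟨h2, h3, h4⟩
    · left
      refine ⟨Set.Subset.antisymm hin fun v hv => ⟨hL.subset hv, (hz v).2 ?_⟩, hz⟩
      rcases h.dist_le hL hv with h5 | h5
      · have h6 := hTree.connected.dist_triangle (u := z) (v := c) (w := ρ v)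
        rw [SimpleGraph.dist_eq_one_iff_adj.2 h.child.adj.symm] at h6
        omega
      · omega
    · right; right; left
      have key : ∀ v ∈ S, (ρ v = b ∨ ¬ T.Adj c (ρ v)) ↔ v ∉ upperSet T ρ S c b := by
        intro v hv
        constructor
        · rintro (e | e) hv'
          · exact hv'.2.2 e
          · exact e hv'.2.1
        · intro hv'
          by_contra! hn
          exact hv' ⟨hv, hn.2, hn.1⟩
      ext v
      constructor
      · intro hv
        have hvS := hin hv
        exact ⟨hvS, (key v hvS).1 ((h1 _ ⟨v, hvS, rfl⟩).1 ((hz v).1 hv.2))⟩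
      · rintro ⟨hvS, hv⟩
        exact ⟨hL.subset hvS, (hz v).2 ((h1 _ ⟨v, hvS, rfl⟩).2 ((key v hvS).2 hv))⟩
    · right; right; right; right
      refine ⟨fun v hv => ?_, fun v hv v' hv' hc hc' => ?_⟩
      · rcases h3 _ ⟨v, hin hv, rfl⟩ ((hz v).1 hv.2) with e | ⟨e, e'⟩
        · exact Or.inl e
        · exact Or.inr ⟨hTree.dist_eq_two h.child.adj e (Ne.symm e'), e⟩
      · exact hT.injective (h4 _ ⟨v, hin hv, rfl⟩ _ ⟨v', hin hv', rfl⟩ ((hz v).1 hv.2)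
          ((hz v').1 hv'.2) hc hc')

theorem _root_.IsSmallTrace.ncard_le [Finite V] {L X : Set V} {c : W} (h : IsSmallTrace ρ c L X)
    (hρ : Function.Injective ρ) : X.ncard ≤ 2 := by
  have h1 : X ⊆ {v | v ∈ X ∧ ρ v = c} ∪ {v | v ∈ X ∧ ρ v ≠ c} := by
    intro v hv
    by_cases e : ρ v = c
    · exact Or.inl ⟨hv, e⟩
    · exact Or.inr ⟨hv, e⟩
  have h2 : {v | v ∈ X ∧ ρ v = c}.ncard ≤ 1 := by
    rw [Set.ncard_le_one (Set.toFinite _)]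
    rintro u ⟨-, hu⟩ v ⟨-, hv⟩
    exact hρ (hu.trans hv.symm)
  have h3 : {v | v ∈ X ∧ ρ v ≠ c}.ncard ≤ 1 := by
    rw [Set.ncard_le_one (Set.toFinite _)]
    rintro u ⟨hu, hu'⟩ v ⟨hv, hv'⟩
    exact h.2 u hu v hv hu' hv'
  have h4 := Set.ncard_le_ncard h1 (Set.toFinite _)
  have h5 := Set.ncard_union_le {v | v ∈ X ∧ ρ v = c} {v | v ∈ X ∧ ρ v ≠ c}
  omega

end IsBistar

/-- `v` is adjacent to the real center because the pair of them is a trace. -/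
def IsPairTrace (G : SimpleGraph V) (ρ : V → W) (K : Set V) (c : W) (v : V) : Prop :=
  ∃ a, ρ a = c ∧ v ≠ a ∧ ∃ K', IsMaxClique G K' ∧ K' ≠ K ∧ K ∩ K' = {a, v}

namespace IsBistar

variable {K S : Set V} {c b : W}

section NoSplit

variable [Finite V] [Nonempty V] (h : IsBistar T ρ K S c b) (hL : IsLeafClique G K S)
    (hT : IsSteinerRoot 4 G T ρ)
    (hno : ∀ K', IsMaxClique G K' → K' ≠ K →
      K ∩ K' ≠ S \ lowerSet T ρ c b ∧ K ∩ K' ≠ S \ upperSet T ρ S c b)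

include h hL hT hno

/-- A pair of the center and a vertex below `b` misses the upper set, so it is not `S`; the two
splitting traces are excluded; and a small trace on the side of `c` has no vertex below `b`, while
one on the side of `b` does not contain the center. -/
theorem not_isPairTrace {v : V} (hv : v ∈ lowerSet T ρ c b) : ¬ IsPairTrace G ρ K c v := by
  rintro ⟨a, ha, hva, K', hK', hne, e⟩
  obtain ⟨u, hu⟩ := h.upper
  rcases h.trace_cases hL hT hK' hne with ⟨h1, -⟩ | h1 | h1 | ⟨h1, -⟩ | h1
  · have huS : u ∈ K ∩ K' := h1 ▸ hu.1
    rw [e] at huS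
    rcases huS with rfl | rfl
    · exact (upper_ne hu).1 ha
    · exact upper_notMem_lower hu hv
  · exact (hno K' hK' hne).1 h1
  · exact (hno K' hK' hne).2 h1
  · rcases h1.1 v (by rw [e]; exact Or.inr rfl) with h2 | h2
    · exact (lower_ne hv).1 h2
    · exact upper_notMem_lower h2 hv
  · rcases h1.1 a (by rw [e]; exact Or.inl rfl) with h2 | h2
    · exact h.child.adj.ne (ha.symm.trans h2)
    · exact (lower_ne h2).1 ha

/-- In the absence of splitting traces, a vertex of the upper set can be constrained only
internally, by a small trace on the side of `c` with two elements, and such a trace is the pair with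
the center. -/
theorem isPairTrace {v : V} (hv : v ∈ upperSet T ρ S c b) (hfree : ¬ IsFree G S v) :
    IsPairTrace G ρ K c v := by
  have hTree := hT.isTree
  obtain ⟨w, hw⟩ := h.lower
  have hvS := hv.1
  have hsmall : ∀ K', IsSmallTrace ρ b (lowerSet T ρ c b) (K ∩ K') → v ∉ K' := by
    intro K' hs hvK'
    rcases hs.1 v ⟨hL.subset hvS, hvK'⟩ with h2 | h2
    · exact (upper_ne hv).2 h2
    · exact upper_notMem_lower hv h2
  have hcon : IsInternallyConstrained G S v ∨ IsSandwiched G S v := by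
    by_contra! hn
    exact hfree ⟨hvS, hn⟩
  rcases hcon with ⟨X, ⟨F, -, hF, rfl⟩, hXS, hvX, hX⟩ | ⟨X₁, X₂, ⟨F₁, ⟨K₁, hK₁⟩, hF₁, rfl⟩,
      ⟨F₂, -, hF₂, rfl⟩, hS₁, hS₂, h12⟩
  -- Internal case: a member of the family that does not contain `S` has a small trace, and this
  -- trace contains `v` and a second vertex.
  · have : ∃ K' ∈ F, ¬ S ⊆ K' := by
      by_contra! hall
      exact hXS.2 fun s hs K' hK' => hall K' hK' hs
    obtain ⟨K', hK', hSK'⟩ := this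
    have hne : K' ≠ K := fun e => hSK' (e ▸ hL.subset)
    have hXK : ⋂₀ F ⊆ K ∩ K' := fun y hy => ⟨hL.subset (hXS.1 hy), hy K' hK'⟩
    obtain ⟨v₂, hv₂, hv₂ne⟩ := hX.exists_ne v
    rcases h.trace_cases hL hT (hF K' hK') hne with ⟨h1, -⟩ | h1 | h1 | ⟨h1, -⟩ | h1
    · exact absurd (h1.symm.subset.trans Set.inter_subset_right) hSK'
    · exact absurd h1 (hno K' (hF K' hK') hne).1
    · exact absurd h1 (hno K' (hF K' hK') hne).2
    · have e2 : ρ v₂ = c := by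
        by_contra hc
        exact hv₂ne (h1.2 v₂ (hXK hv₂) v (hXK hvX) hc (upper_ne hv).1)
      refine ⟨v₂, e2, hv₂ne.symm, K', hF K' hK', hne, ?_⟩
      ext y
      constructor
      · intro hy
        by_cases hyc : ρ y = c
        · exact Or.inl (hT.injective (hyc.trans e2.symm))
        · exact Or.inr (h1.2 y hy v (hXK hvX) hyc (upper_ne hv).1)
      · rintro (rfl | rfl)
        · exact hXK hv₂
        · exact hXK hvX
    · exact absurd (hXK hvX).2 (hsmall K' h1)
  -- Sandwiched case: `x` lies in a clique `K₁` containing `S` and in a clique `K'` that contains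
  -- `v` but avoids a vertex below `b`.
  · exfalso
    have hvX₂ : v ∈ ⋂₀ F₂ := (hS₂.symm.subset (Set.mem_singleton v)).2
    obtain ⟨x, hx, hxv⟩ := Set.exists_of_ssubset h12
    have hxS : x ∉ S := fun hxS => hxv (hS₂ ▸ ⟨hxS, hx.2⟩)
    have hwv : w ≠ v := fun e => upper_notMem_lower hv (e ▸ hw)
    have hwX₂ : w ∉ ⋂₀ F₂ := fun hwX => hwv (hS₂.subset ⟨h.lower_subset hw, hwX⟩)
    simp only [Set.mem_sInter, not_forall] at hwX₂
    obtain ⟨K', hK', hwK'⟩ := hwX₂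
    have hwK : w ∈ K := hL.subset (h.lower_subset hw)
    have hne : K' ≠ K := fun e => hwK' (e ▸ hwK)
    have hxK' := hx.2 K' hK'
    have hxK : x ∉ K := fun hxK => hxS (hL.inter_subset K' (hF₂ K' hK') hne ⟨hxK, hxK'⟩)
    have hSK₁ : S ⊆ K₁ := hS₁.1.trans (Set.sInter_subset_of_mem hK₁)
    have hxK₁ := hx.1 K₁ hK₁
    have hne₁ : K₁ ≠ K := fun e => hxK (e ▸ hxK₁)
    obtain ⟨u, hu⟩ := h.upper
    have hu₁ : u ∈ K ∩ K₁ := ⟨hL.subset hu.1, hSK₁ hu.1⟩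
    have hw₁ : w ∈ K ∩ K₁ := ⟨hwK, hSK₁ (h.lower_subset hw)⟩
    -- The trace of `K₁` has vertices on both sides of the edge, so it is all of `S` and `K₁` is the
    -- ball around `b`.
    have hball : ∀ y, y ∈ K₁ ↔ T.dist b (ρ y) ≤ 2 := by
      rcases h.trace_cases hL hT (hF₁ K₁ hK₁) hne₁ with ⟨-, h1⟩ | h1 | h1 | ⟨h1, -⟩ | h1
      · exact h1
      · exact absurd h1 (hno K₁ (hF₁ K₁ hK₁) hne₁).1
      · exact absurd h1 (hno K₁ (hF₁ K₁ hK₁) hne₁).2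
      · rcases h1.1 w hw₁ with h2 | h2
        · exact absurd h2 (lower_ne hw).1
        · exact absurd hw (upper_notMem_lower h2)
      · rcases h1.1 u hu₁ with h2 | h2
        · exact absurd h2 (upper_ne hu).2
        · exact absurd h2 (upper_notMem_lower hu)
    rcases h.trace_cases hL hT (hF₂ K' hK') hne with ⟨h1, -⟩ | h1 | h1 | ⟨-, z, hz2, hzb, hz⟩ | h1
    · exact hwK' (h1.symm.subset (h.lower_subset hw)).2
    · exact (hno K' (hF₂ K' hK') hne).1 h1
    · exact (hno K' (hF₂ K' hK') hne).2 h1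
    -- Since `x` is within distance two of `b` but not of `c`, it lies on the side of `b`, while `z`
    -- lies on the side of `c` at distance at least two from `c`. So `x` is too far from `z` to
    -- belong to `K'`.
    · have h3 := (hball x).1 hxK₁
      have h4 : ¬ T.dist c (ρ x) ≤ 2 := fun h => hxK ((IsBistar.center ‹_›).mem_iff x |>.2 h)
      have h5 := (hz x).1 hxK'
      have h6 := hTree.connected.dist_triangle (u := c) (v := b) (w := ρ x)
      rw [SimpleGraph.dist_eq_one_iff_adj.2 h.child.adj] at h6
      have h7 := hTree.dist_eq_of_split h.child.adj (x := z) (y := ρ x) hzb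
        (by rw [T.dist_comm (v := b), T.dist_comm (v := c)]; omega)
      omega
    · exact hsmall K' h1 (hvX₂ K' hK')

end NoSplit

/-- All free vertices of `S` but one are on the same side of the edge between `c` and `b`. -/
theorem exists_exception [Finite W] (h : IsBistar T ρ K S c b) (hL : IsLeafClique G K S)
    (hT : IsWellStructured G T ρ) : ∃ e, (∀ v ∈ lowerSet T ρ c b, IsFree G S v → v = e) ∨
      ∀ v ∈ upperSet T ρ S c b, IsFree G S v → v = e := by
  have hTree := hT.root.isTree
  obtain ⟨u, hu⟩ := h.upper
  obtain ⟨w, hw⟩ := h.lower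
  have hSne : S.Nonempty := ⟨u, hu.1⟩
  have hSI : IsCliqueInter G S := by
    rcases hL.sep with rfl | ⟨P, hP, -, rfl⟩
    · exact absurd hSne Set.not_nonempty_empty
    · exact ⟨{K, P}, ⟨K, Or.inl rfl⟩, by rintro _ (rfl | rfl); exacts [hL.isMax, hP], by simp⟩
  have hne : (ρ '' S).Nonempty := hSne.image ρ
  set A := spanNodes T (ρ '' S) with hA
  have hsub : ρ '' S ⊆ A := SimpleGraph.IsTree.subset_spanNodes T _
  have hcb1 : T.dist c b = 1 := SimpleGraph.dist_eq_one_iff_adj.2 h.child.adj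
  have hcu : T.dist c (ρ u) = 1 := SimpleGraph.dist_eq_one_iff_adj.2 hu.2.1
  have hbu : T.dist b (ρ u) = 2 := hTree.dist_eq_two h.child.adj.symm hu.2.1 hu.2.2.symm
  have hlow : ∀ v ∈ lowerSet T ρ c b, T.dist b (ρ v) = 1 :=
    fun v hv => SimpleGraph.dist_eq_one_iff_adj.2 hv.2
  have hsplit : ∀ x v, T.dist x c < T.dist x b → v ∈ lowerSet T ρ c b →
      T.dist x (ρ v) = T.dist x c + 2 := by
    intro x v hx hv
    have h1 := hlow v hv
    have h2 := hv.1
    have h3 := hTree.dist_eq_of_split h.child.adj (x := x) (y := ρ v) hx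
      (by rw [T.dist_comm (v := b), T.dist_comm (v := c)]; omega)
    omega
  have hup : ∀ v ∈ upperSet T ρ S c b, T.dist c (ρ v) = 1 ∧ T.dist b (ρ v) = 2 := fun v hv =>
    ⟨SimpleGraph.dist_eq_one_iff_adj.2 hv.2.1,
      hTree.dist_eq_two h.child.adj.symm hv.2.1 hv.2.2.symm⟩
  have huw : T.dist (ρ u) (ρ w) = 3 := by
    rw [hsplit (ρ u) w (by rw [T.dist_comm (v := c), T.dist_comm (v := b)]; omega) hw,
      T.dist_comm (v := c), hcu]
  have hcA : c ∈ A := hTree.mem_spanNodes_of_between (hsub ⟨u, hu.1, rfl⟩)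
    (hsub ⟨w, h.lower_subset hw, rfl⟩) (by rw [T.dist_comm (v := c), hcu, hw.1, huw])
  have hbA : b ∈ A := hTree.mem_spanNodes_of_between (hsub ⟨u, hu.1, rfl⟩)
    (hsub ⟨w, h.lower_subset hw, rfl⟩) (by rw [T.dist_comm (v := b), hbu, hlow w hw, huw])
  have hcS : ∀ v ∈ S, T.dist c (ρ v) ≤ 2 := fun v hv => (h.center.mem_iff v).1 (hL.subset hv)
  have hbS : ∀ v ∈ S, T.dist b (ρ v) ≤ 2 := by
    intro v hv
    rcases h.dist_le hL hv with h1 | h1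
    · have := hTree.connected.dist_triangle (u := b) (v := c) (w := ρ v)
      rw [T.dist_comm (u := b) (v := c)] at this
      omega
    · omega
  -- The span of `S` contains two nodes at distance `3`, so its radius is at least two and every
  -- node within distance two of all of `S` is central. This applies to both `c` and `b`.
  have hcen : ∀ d (hd : d ∈ A), (∀ v ∈ S, T.dist d (ρ v) ≤ 2) →
      (⟨d, hd⟩ : A) ∈ (spanTree T (ρ '' S)).center := by
    intro d hd hdS
    rw [SimpleGraph.mem_center_iff]
    refine le_antisymm ?_ SimpleGraph.radius_le_eccent
    have h1 : (spanTree T (ρ '' S)).eccent ⟨d, hd⟩ ≤ 2 := by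
      rw [SimpleGraph.eccent_le_iff]
      rintro ⟨x, hx⟩
      rw [hTree.edist_spanTree hne]
      have hx' := hx
      rw [hTree.spanNodes_eq hne hd] at hx'
      obtain ⟨_, ⟨v, hv, rfl⟩, hdx⟩ := hx'
      have h2 := hdS v hv
      have h3 : T.dist d x ≤ 2 := by omega
      exact_mod_cast h3
    refine h1.trans ?_
    have h2 : (3 : ℕ∞) ≤ (spanTree T (ρ '' S)).ediam := by
      have h3 := SimpleGraph.edist_le_ediam (G := spanTree T (ρ '' S))
        (u := ⟨ρ u, hsub ⟨u, hu.1, rfl⟩⟩) (v := ⟨ρ w, hsub ⟨w, h.lower_subset hw, rfl⟩⟩)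
      rw [hTree.edist_spanTree hne, huw] at h3
      exact_mod_cast h3
    have h4 := h2.trans SimpleGraph.ediam_le_two_mul_radius
    by_contra hlt
    have h5 : (spanTree T (ρ '' S)).radius ≤ 1 := by
      rw [not_le] at hlt
      simpa using hlt
    have h6 : (3 : ℕ∞) ≤ 2 * 1 := h4.trans (by gcongr)
    norm_num at h6
  obtain ⟨⟨x, hxA⟩, hx, e, he⟩ := hT.side S hSI hSne
  refine ⟨e, ?_⟩
  -- The common closest central node `x` lies on one side of the edge. A free vertex adjacent to `b`
  -- or `c` on the other side has that end as a strictly closer central node, so it must be the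
  -- exception `e`.
  have hpar := hTree.dist_eq_dist_add_one_of_adj x h.child.adj
  by_cases hxc : T.dist x c < T.dist x b
  · left
    intro v hv hfree
    by_contra hve
    have h1 := he v hfree hve ⟨b, hbA⟩ (hcen b hbA hbS)
    have h2 := hsplit x v hxc hv
    have h3 := hlow v hv
    simp only at h1
    rw [T.dist_comm (v := x), T.dist_comm (v := b)] at h1
    omega
  · right
    intro v hv hfree
    by_contra hve
    have h1 := he v hfree hve ⟨c, hcA⟩ (hcen c hcA hcS)
    obtain ⟨h2, h3⟩ := hup v hv
    have h4 := hTree.dist_eq_of_split h.child.adj (x := ρ v) (y := x)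
      (by rw [T.dist_comm (v := c), T.dist_comm (v := b)]; omega) (by omega)
    simp only at h1
    rw [T.dist_comm (u := ρ v) (v := c)] at h1 h4
    omega

end IsBistar

/-- The candidates for the set of vertices below the distinguished child: `m` is a mode, `X` a
trace and `A` the set of vertices paired with the center by a trace. -/
def baseSet (S F A X : Set V) : ℕ → Set V
  | 0 => ∅
  | 1 => S
  | 2 => {v | v ∈ S ∧ v ∉ F ∧ v ∉ A}
  | 3 => {v | v ∈ S ∧ v ∉ A}
  | 4 => X
  | _ => S \ X

open Classical in
/-- Few sets decide which vertices are below the distinguished child. -/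
theorem exists_baseSet [Finite V] [Nonempty V] [Finite W] {K S : Set V} (hL : IsLeafClique G K S)
    (hT : IsWellStructured G T ρ) {c : W} (hc : IsLeafCenter T ρ K S c) :
    ∃ b, IsLeafChild T ρ K S c b ∧ ∃ (m : ℕ) (X : Set V) (e : Option V), m < 6 ∧
      (2 ≤ m → ∃ Y Z, ∀ K', IsMaxClique G K' → K' ≠ K →
        K ∩ K' = S ∨ K ∩ K' = Y ∨ K ∩ K' = Z ∨ (K ∩ K').ncard ≤ 2) ∧
      (4 ≤ m → ∃ K', IsMaxClique G K' ∧ K' ≠ K ∧ X = K ∩ K') ∧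
      ∀ v ∈ K, ρ v ≠ c → ρ v ≠ b → (v ∈ lowerSet T ρ c b ↔
        ¬ (v ∈ baseSet S {v | IsFree G S v} {v | IsPairTrace G ρ K c v} X m ↔ e = some v)) := by
  have hroot := hT.root
  obtain ⟨b, hb, ⟨x, hx, -⟩ | ⟨⟨s, hs, hsl⟩, hlS⟩⟩ := hc.exists_isLeafChild hL hroot
  -- At most one vertex lies below `b`: start from the empty set and use the exception for this
  -- vertex.
  · refine ⟨b, hb, 0, ∅, ?_⟩
    by_cases hxl : x ∈ lowerSet T ρ c b
    · refine ⟨some x, by omega, fun h => absurd h (by omega), fun h => absurd h (by omega),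
        fun v _ _ _ => ?_⟩
      simp only [baseSet, Set.mem_empty_iff_false, Option.some.injEq, false_iff, not_not]
      refine ⟨fun hv => (hx hv).symm, ?_⟩
      rintro rfl
      exact hxl
    · refine ⟨none, by omega, fun h => absurd h (by omega), fun h => absurd h (by omega),
        fun v _ _ _ => ?_⟩
      simp only [baseSet, Set.mem_empty_iff_false, reduceCtorEq, iff_false, not_true]
      exact fun hv => hxl (hx hv ▸ hv)
  by_cases hup : (upperSet T ρ S c b).Nonempty
  swap
  · refine ⟨b, hb, 1, ∅, none, by omega, fun h => absurd h (by omega), fun h => absurd h (by omega),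
      fun v hv hvc hvb => ?_⟩
    simp only [baseSet, reduceCtorEq, iff_false, not_not]
    refine ⟨fun h => hlS h, fun h => ?_⟩
    have h1 := (hc.mem_iff v).1 hv
    have h2 := hroot.isTree.connected.pos_dist_of_ne hvc.symm
    by_cases h3 : T.dist c (ρ v) = 2
    · exact ⟨h3, hb.adj_of_mem v h h3⟩
    · exact absurd ⟨v, h, SimpleGraph.dist_eq_one_iff_adj.1 (by omega), hvb⟩ hup
  have h : IsBistar T ρ K S c b := ⟨hc, hb, hlS, ⟨s, hsl⟩, hup⟩
  -- With vertices on both sides of the edge, all traces but three have at most two elements; this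
  -- is what later bounds the number of traces.
  have hcount : ∃ Y Z, ∀ K', IsMaxClique G K' → K' ≠ K →
      K ∩ K' = S ∨ K ∩ K' = Y ∨ K ∩ K' = Z ∨ (K ∩ K').ncard ≤ 2 := by
    refine ⟨S \ lowerSet T ρ c b, S \ upperSet T ρ S c b, fun K' hK' hne => ?_⟩
    rcases h.trace_cases hL hroot hK' hne with ⟨h1, -⟩ | h1 | h1 | ⟨h1, -⟩ | h1
    · exact Or.inl h1
    · exact Or.inr (Or.inl h1)
    · exact Or.inr (Or.inr (Or.inl h1))
    · exact Or.inr (Or.inr (Or.inr (h1.ncard_le hroot.injective)))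
    · exact Or.inr (Or.inr (Or.inr (h1.ncard_le hroot.injective)))
  have hcase : ∀ v ∈ S, ρ v ≠ c → ρ v ≠ b → v ∉ lowerSet T ρ c b → v ∈ upperSet T ρ S c b := by
    intro v hv h1 h2 h3
    rcases h.mem_cases hL hroot hv with h' | h' | h' | h'
    · exact absurd h' h1
    · exact absurd h' h2
    · exact h'
    · exact absurd h' h3
  -- A splitting trace reveals the lower set: it is the complement in `S` of such a trace, or, in
  -- the next case, the trace itself up to `c` and `b`.
  by_cases hlow : ∃ K', IsMaxClique G K' ∧ K' ≠ K ∧ K ∩ K' = S \ lowerSet T ρ c b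
  · obtain ⟨K', hK', hne, hX⟩ := hlow
    refine ⟨b, hb, 5, K ∩ K', none, by omega, fun _ => hcount, fun _ => ⟨K', hK', hne, rfl⟩,
      fun v hv hvc hvb => ?_⟩
    simp only [baseSet, reduceCtorEq, iff_false, not_not, hX,
      Set.sdiff_sdiff_right_self, Set.mem_inter_iff]
    exact ⟨fun h => ⟨hlS h, h⟩, fun h => h.2⟩
  by_cases hupp : ∃ K', IsMaxClique G K' ∧ K' ≠ K ∧ K ∩ K' = S \ upperSet T ρ S c b
  · obtain ⟨K', hK', hne, hX⟩ := hupp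
    refine ⟨b, hb, 4, K ∩ K', none, by omega, fun _ => hcount, fun _ => ⟨K', hK', hne, rfl⟩,
      fun v hv hvc hvb => ?_⟩
    simp only [baseSet, reduceCtorEq, iff_false, not_not, hX]
    refine ⟨fun h => ⟨hlS h, fun h' => IsBistar.upper_notMem_lower h' h⟩, fun h => ?_⟩
    by_contra hvl
    exact h.2 (hcase v h.1 hvc hvb hvl)
  have hno : ∀ K', IsMaxClique G K' → K' ≠ K →
      K ∩ K' ≠ S \ lowerSet T ρ c b ∧ K ∩ K' ≠ S \ upperSet T ρ S c b :=
    fun K' hK' hne => ⟨fun e => hlow ⟨K', hK', hne, e⟩, fun e => hupp ⟨K', hK', hne, e⟩⟩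
  have hA : ∀ v ∈ lowerSet T ρ c b, ¬ IsPairTrace G ρ K c v :=
    fun v hv => h.not_isPairTrace hL hroot hno hv
  have hA' : ∀ v ∈ upperSet T ρ S c b, ¬ IsFree G S v → IsPairTrace G ρ K c v :=
    fun v hv hf => h.isPairTrace hL hroot hno hv hf
  obtain ⟨e, he | he⟩ := h.exists_exception hL hT
  -- Free vertices belong above, with `e` as the only possible exception; the others are below
  -- exactly if they are not paired with the center.
  · refine ⟨b, hb, 2, ∅, if e ∈ lowerSet T ρ c b ∧ IsFree G S e then some e else none,
      by omega, fun _ => hcount, fun h => absurd h (by omega), fun v hv hvc hvb => ?_⟩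
    simp only [baseSet, Set.mem_ofPred_eq]
    have hE : ((if e ∈ lowerSet T ρ c b ∧ IsFree G S e then some e else none) = some v) ↔
        v ∈ lowerSet T ρ c b ∧ IsFree G S v := by
      split_ifs with hif
      · rw [Option.some.injEq]
        refine ⟨fun h => h ▸ hif, fun h => (he v h.1 h.2).symm⟩
      · simp only [false_iff]
        intro h
        exact hif ((he v h.1 h.2) ▸ h)
    rw [hE]
    by_cases hvl : v ∈ lowerSet T ρ c b
    · have h1 := hlS hvl
      have h2 := hA v hvl
      tauto
    · have h1 := hcase v
      have h2 := hA' v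
      tauto
  -- Free vertices belong below, with `e` as the only possible exception. If `e` is above and paired
  -- with the center, the base set already omits it and no exception must be made.
  · refine ⟨b, hb, 3, ∅, if e ∈ upperSet T ρ S c b ∧ IsFree G S e ∧ ¬ IsPairTrace G ρ K c e
      then some e else none,
      by omega, fun _ => hcount, fun h => absurd h (by omega), fun v hv hvc hvb => ?_⟩
    simp only [baseSet, Set.mem_ofPred_eq]
    have hE : ((if e ∈ upperSet T ρ S c b ∧ IsFree G S e ∧ ¬ IsPairTrace G ρ K c e
        then some e else none) = some v) ↔
        v ∈ upperSet T ρ S c b ∧ IsFree G S v ∧ ¬ IsPairTrace G ρ K c v := by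
      split_ifs with hif
      · rw [Option.some.injEq]
        refine ⟨fun h => h ▸ hif, fun h => (he v h.1 h.2.1).symm⟩
      · simp only [false_iff]
        intro h
        exact hif ((he v h.1 h.2.1) ▸ h)
    rw [hE]
    by_cases hvl : v ∈ lowerSet T ρ c b
    · have hvu : v ∉ upperSet T ρ S c b := fun h' => IsBistar.upper_notMem_lower h' hvl
      have h1 := hlS hvl
      have h2 := hA v hvl
      tauto
    · have h1 : v ∈ S → v ∈ upperSet T ρ S c b := fun h => hcase v h hvc hvb hvl
      have h2 := hA' v
      have h3 : v ∈ upperSet T ρ S c b → v ∈ S := fun h => h.1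
      tauto

end Traces

/-! ### Logic in the expression language -/

namespace RAM

namespace Ex

/-- The expression `e` is true, that is, nonzero. -/
def Holds (inp : List ℕ) (e : Ex) (σ : ℕ → ℕ) : Prop := e.eval inp σ ≠ 0

def bool (e : Ex) : Ex := cond e (const 1) (const 0)

def neg (e : Ex) : Ex := cond e (const 0) (const 1)

def and (a b : Ex) : Ex := cond a b (const 0)

def or (a b : Ex) : Ex := cond a (const 1) b

def imp (a b : Ex) : Ex := cond a b (const 1)

def iff (a b : Ex) : Ex := cond a b (neg b)

def lt (a b : Ex) : Ex := sub b a

def eq (a b : Ex) : Ex := neg (add (sub a b) (sub b a))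

def all (x y : ℕ) (e : Ex) : Ex := neg (sum x y (neg e))

/-- The product of two variables. -/
def mul (x y : ℕ) : Ex := sum 50 x (var y)

variable {inp : List ℕ} {σ : ℕ → ℕ} {a b e : Ex} {x y c : ℕ}

open Classical in
theorem eval_bool : e.bool.eval inp σ = if e.Holds inp σ then 1 else 0 := by
  simp only [bool, eval, Holds]
  congr

@[simp] theorem holds_neg : e.neg.Holds inp σ ↔ ¬ e.Holds inp σ := by
  by_cases h : e.eval inp σ = 0 <;> simp [Holds, neg, eval, h]

@[simp] theorem holds_and : (a.and b).Holds inp σ ↔ a.Holds inp σ ∧ b.Holds inp σ := by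
  by_cases h : a.eval inp σ = 0 <;> simp [Holds, and, eval, h]

@[simp] theorem holds_or : (a.or b).Holds inp σ ↔ a.Holds inp σ ∨ b.Holds inp σ := by
  by_cases h : a.eval inp σ = 0 <;> simp [Holds, or, eval, h]

@[simp] theorem holds_imp : (a.imp b).Holds inp σ ↔ (a.Holds inp σ → b.Holds inp σ) := by
  by_cases h : a.eval inp σ = 0 <;> simp [Holds, imp, eval, h]

@[simp] theorem holds_iff : (a.iff b).Holds inp σ ↔ (a.Holds inp σ ↔ b.Holds inp σ) := by
  by_cases h : a.eval inp σ = 0 <;> by_cases h' : b.eval inp σ = 0 <;>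
    simp [Holds, iff, neg, eval, h, h']

@[simp] theorem holds_lt : (lt a b).Holds inp σ ↔ a.eval inp σ < b.eval inp σ := by
  simp only [Holds, lt, eval]
  omega

@[simp] theorem holds_eq : (eq a b).Holds inp σ ↔ a.eval inp σ = b.eval inp σ := by
  rw [eq, holds_neg]
  simp only [Holds, eval]
  omega

@[simp] theorem holds_sum :
    (sum x y e).Holds inp σ ↔ ∃ v < σ y, e.Holds inp (Function.update σ x v) := by
  simp [Holds, eval, Finset.sum_eq_zero_iff]

@[simp] theorem holds_all :
    (all x y e).Holds inp σ ↔ ∀ v < σ y, e.Holds inp (Function.update σ x v) := by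
  simp [all]

@[simp] theorem eval_const : (const c).eval inp σ = c := rfl

@[simp] theorem eval_var : (var x).eval inp σ = σ x := rfl

@[simp] theorem eval_add : (add a b).eval inp σ = a.eval inp σ + b.eval inp σ := rfl

@[simp] theorem eval_sub : (sub a b).eval inp σ = a.eval inp σ - b.eval inp σ := rfl

theorem eval_mul (hy : y ≠ 50) : (mul x y).eval inp σ = σ x * σ y := by
  simp [mul, eval, hy]

theorem holds_read : (read a).Holds inp σ ↔ inp.getD (a.eval inp σ) 0 ≠ 0 := Iff.rfl

theorem eval_read : (read a).eval inp σ = inp.getD (a.eval inp σ) 0 := rfl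

end Ex

open Classical in
theorem Stmt.out_ite {inp : List ℕ} {σ : ℕ → ℕ} {e : Ex} {a b : Stmt} :
    (Stmt.ite e a b).out inp σ = if e.Holds inp σ then a.out inp σ else b.out inp σ := by
  simp only [Stmt.out, Ex.Holds]
  congr

end RAM

/-! ### Auxiliary facts on lists -/

theorem List.getD_flatMap_uniform {α β : Type*} (f : α → List β) (b : ℕ) (d : β) :
    ∀ (l : List α) (_ : ∀ x ∈ l, (f x).length = b) (u v : ℕ) (hu : u < l.length), v < b →
      (l.flatMap f).getD (u * b + v) d = (f l[u]).getD v d := by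
  intro l
  induction l with
  | nil => intro _ u v hu; simp at hu
  | cons x l ih =>
    intro hl u v hu hv
    have hx : (f x).length = b := hl x List.mem_cons_self
    rw [List.flatMap_cons]
    cases u with
    | zero =>
      rw [List.getD_append _ _ _ _ (by omega)]
      simp
    | succ u =>
      rw [List.getD_append_right _ _ _ _ (by rw [hx]; nlinarith)]
      rw [hx, show (u + 1) * b + v - b = u * b + v by
        rw [Nat.succ_mul]; omega]
      rw [ih (fun x hx => hl x (List.mem_cons_of_mem _ hx)) u v (by simpa using hu) hv]
      simp

theorem List.length_flatMap_uniform {α β : Type*} (f : α → List β) (b : ℕ) (l : List α)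
    (h : ∀ x ∈ l, (f x).length = b) : (l.flatMap f).length = l.length * b := by
  induction l with
  | nil => simp
  | cons x l ih =>
    rw [List.flatMap_cons, List.length_append, h x List.mem_cons_self,
      ih fun y hy => h y (List.mem_cons_of_mem _ hy), List.length_cons]
    ring

theorem List.getD_matrix {a b : ℕ} (f : Fin a → Fin b → ℕ) (u : Fin a) (v : Fin b) (l : List ℕ) :
    ((List.finRange a).flatMap (fun u => (List.finRange b).map (f u)) ++ l).getD (u * b + v) 0 =
      f u v := by
  have hlen : ∀ x ∈ List.finRange a, ((List.finRange b).map (f x)).length = b := by simp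
  have hlt : (u : ℕ) * b + v < a * b := by
    have h1 := u.2
    have h2 := v.2
    calc (u : ℕ) * b + v < u * b + b := by omega
      _ = (u + 1) * b := by ring
      _ ≤ a * b := Nat.mul_le_mul_right _ h1
  rw [List.getD_append _ _ _ _ (by
    rw [List.length_flatMap_uniform _ b _ hlen, List.length_finRange]; exact hlt),
    List.getD_flatMap_uniform _ b 0 _ hlen u v (by simp) v.2]
  simp

/-- The elements of `l.map f` without duplicates come from the last positions of their values. -/
theorem List.dedup_map_eq {β : Type*} [DecidableEq β] (f : ℕ → β) (P : ℕ → Prop)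
    [DecidablePred P] (l : List ℕ) (hl : l.Pairwise (· < ·)) :
    ((l.filter P).map f).dedup =
      (l.filter fun j => P j ∧ ∀ j' ∈ l, j < j' → P j' → f j' ≠ f j).map f := by
  induction l with
  | nil => simp
  | cons x l ih =>
    rw [List.pairwise_cons] at hl
    have htail : (l.filter fun j => P j ∧ ∀ j' ∈ x :: l, j < j' → P j' → f j' ≠ f j) =
        l.filter fun j => P j ∧ ∀ j' ∈ l, j < j' → P j' → f j' ≠ f j := by
      refine List.filter_congr fun j hj => ?_
      have : ¬ j < x := not_lt.2 (hl.1 j hj).le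
      simp [this]
    have hhead : (P x ∧ ∀ j' ∈ x :: l, x < j' → P j' → f j' ≠ f x) ↔
        P x ∧ f x ∉ (l.filter P).map f := by
      refine and_congr_right fun _ => ?_
      simp only [List.mem_cons, forall_eq_or_imp, lt_irrefl, false_imp_iff, true_and, List.mem_map,
        List.mem_filter, decide_eq_true_eq, not_exists, not_and]
      exact ⟨fun h j' hj => h j' hj.1 (hl.1 j' hj.1) hj.2, fun h j' hj _ hP => h j' ⟨hj, hP⟩⟩
    rw [List.filter_cons, List.filter_cons, htail]
    simp only [decide_eq_true_eq]
    by_cases hP : P x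
    · rw [if_pos hP, List.map_cons]
      by_cases hm : f x ∈ (l.filter P).map f
      · rw [List.dedup_cons_of_mem hm, if_neg (fun h => (hhead.1 h).2 hm), ih hl.2]
      · rw [List.dedup_cons_of_notMem hm, if_pos (hhead.2 ⟨hP, hm⟩), List.map_cons, ih hl.2]
    · rw [if_neg hP, if_neg (fun h => hP h.1), ih hl.2]

theorem List.flatMap_ite_nil {α β : Type*} (P : α → Prop) [DecidablePred P] (f : α → List β)
    (l : List α) : (l.flatMap fun x => if P x then f x else []) = (l.filter P).flatMap f := by
  induction l with
  | nil => rfl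
  | cons x l ih =>
    rw [List.flatMap_cons, List.filter_cons, ih]
    by_cases h : P x <;> simp [h]

theorem Finset.sort_eq_filter_finRange {n : ℕ} (K : Finset (Fin n)) :
    K.sort (· ≤ ·) = (List.finRange n).filter (· ∈ K) := by
  refine List.Perm.eq_of_pairwise (le := (· ≤ ·)) (fun a b _ _ => le_antisymm)
    (Finset.pairwise_sort K _)
    ((List.pairwise_le_finRange n).filter _) ?_
  rw [List.perm_ext_iff_of_nodup (Finset.sort_nodup _ _) ((List.nodup_finRange n).filter _)]
  simp

theorem Finset.ofFn_orderEmbOfFin {n : ℕ} {β : Type*} (K : Finset (Fin n)) (f : Fin n → β) :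
    (List.ofFn fun p => f (K.orderEmbOfFin rfl p)) =
      ((List.finRange n).filter (· ∈ K)).map f := by
  rw [← Finset.sort_eq_filter_finRange]
  apply List.ext_getElem
  · simp
  · intro i h1 h2
    simp [Finset.orderEmbOfFin_apply]

/-! ### Free vertices of a separator -/

section FreeVertices

variable {V : Type*} {G : SimpleGraph V} {S : Set V} {v : V}

theorem IsCliqueInter.inter_isMaxClique {K : Set V} (hS : IsCliqueInter G S)
    (hK : IsMaxClique G K) : IsCliqueInter G (S ∩ K) := by
  obtain ⟨F, -, hF, rfl⟩ := hS
  refine ⟨insert K F, ⟨K, Set.mem_insert _ _⟩, ?_, ?_⟩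
  · rintro _ (rfl | h)
    exacts [hK, hF _ h]
  · rw [Set.sInter_insert, Set.inter_comm]

/-- One member of the family that does not contain `S` suffices as a witness: intersecting `S` with
it can only enlarge the given clique-intersection, which stays proper. -/
theorem isInternallyConstrained_iff (hS : IsCliqueInter G S) (hv : v ∈ S) :
    IsInternallyConstrained G S v ↔
      ∃ K, IsMaxClique G K ∧ v ∈ K ∧ (∃ u ∈ S, u ∉ K) ∧ ∃ u ∈ S, u ∈ K ∧ u ≠ v := by
  constructor
  · rintro ⟨X, ⟨F, -, hF, rfl⟩, hXS, hvX, hX⟩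
    obtain ⟨u, hu, huX⟩ := Set.exists_of_ssubset hXS
    simp only [Set.mem_sInter, not_forall] at huX
    obtain ⟨K, hK, huK⟩ := huX
    obtain ⟨w, hw, hwv⟩ := hX.exists_ne v
    exact ⟨K, hF K hK, hvX K hK, ⟨u, hu, huK⟩, w, hXS.1 hw, hw K hK, hwv⟩
  · rintro ⟨K, hK, hvK, ⟨u, hu, huK⟩, w, hw, hwK, hwv⟩
    refine ⟨S ∩ K, hS.inter_isMaxClique hK, ⟨Set.inter_subset_left, fun h => huK (h hu).2⟩,
      ⟨hv, hvK⟩, w, ⟨hw, hwK⟩, v, ⟨hv, hvK⟩, hwv⟩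

/-- The larger set may be replaced by one maximal clique, which contains `S` properly since `S` is
not maximal. The other set may be replaced by the intersection of all maximal cliques through `v`
and `x`, the smallest possible choice. Exponentially many families are thus reduced to quantifiers
over cliques and vertices. -/
theorem isSandwiched_iff (hS : ¬ IsMaxClique G S) (hv : v ∈ S) :
    IsSandwiched G S v ↔ ∃ K, IsMaxClique G K ∧ S ⊆ K ∧ ∃ x ∈ K, x ≠ v ∧
      ∀ u ∈ S, u ≠ v → ∃ K', IsMaxClique G K' ∧ v ∈ K' ∧ x ∈ K' ∧ u ∉ K' := by
  constructor
  · rintro ⟨X₁, X₂, ⟨F₁, ⟨K, hK⟩, hF₁, rfl⟩, ⟨F₂, -, hF₂, rfl⟩, hS₁, hS₂, h12⟩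
    obtain ⟨x, hx, hxv⟩ := Set.exists_of_ssubset h12
    have hvX₂ : v ∈ ⋂₀ F₂ := (hS₂.symm.subset (Set.mem_singleton v)).2
    refine ⟨K, hF₁ K hK, hS₁.1.trans (Set.sInter_subset_of_mem hK), x, hx.1 K hK, hxv,
      fun u hu huv => ?_⟩
    have huX : u ∉ ⋂₀ F₂ := fun h => huv (hS₂.subset ⟨hu, h⟩)
    simp only [Set.mem_sInter, not_forall] at huX
    obtain ⟨K', hK', huK'⟩ := huX
    exact ⟨K', hF₂ K' hK', hvX₂ K' hK', hx.2 K' hK', huK'⟩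
  · rintro ⟨K, hK, hSK, x, hx, hxv, hall⟩
    refine ⟨K, ⋂₀ {K' | IsMaxClique G K' ∧ v ∈ K' ∧ x ∈ K'}, ⟨{K}, ⟨K, rfl⟩, ?_, by simp⟩,
      ⟨{K' | IsMaxClique G K' ∧ v ∈ K' ∧ x ∈ K'}, ⟨K, hK, hSK hv, hx⟩, fun K' h => h.1, rfl⟩, ⟨hSK, fun h => ?_⟩, ?_, ?_⟩
    · rintro _ rfl
      exact hK
    · exact hS (Set.Subset.antisymm hSK h ▸ hK)
    · ext u
      simp only [Set.mem_inter_iff, Set.mem_sInter, Set.mem_ofPred_eq, and_imp,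
        Set.mem_singleton_iff]
      constructor
      · rintro ⟨hu, hu'⟩
        by_contra huv
        obtain ⟨K', h1, h2, h3, h4⟩ := hall u hu huv
        exact h4 (hu' K' h1 h2 h3)
      · rintro rfl
        exact ⟨hv, fun _ _ h _ => h⟩
    · refine ⟨?_, fun h => hxv (h ⟨hx, fun K' hK' => hK'.2.2⟩)⟩
      rintro _ rfl
      exact ⟨hSK hv, fun K' hK' => hK'.2.1⟩

end FreeVertices

/-! ### Separators and leaves of rooted clique-trees -/

namespace RootedCliqueTree

variable {n : ℕ} {G : SimpleGraph (Fin n)} (C : RootedCliqueTree G)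

theorem isMaxClique (j : Fin C.size) : IsMaxClique G (C.clique j : Set (Fin n)) :=
  (C.isMaxClique_iff _).2 ⟨j, rfl⟩

theorem exists_isMaxClique_iff (P : Set (Fin n) → Prop) :
    (∃ K, IsMaxClique G K ∧ P K) ↔ ∃ j, P (C.clique j : Set (Fin n)) := by
  classical
  constructor
  · rintro ⟨K, hK, hP⟩
    obtain ⟨j, hj⟩ := (C.isMaxClique_iff K.toFinset).1 (by simpa using hK)
    exact ⟨j, by rw [hj]; simpa using hP⟩
  · rintro ⟨j, hj⟩
    exact ⟨_, C.isMaxClique j, hj⟩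

variable {C} {i : Fin C.size}

/-- A neighbour in a rooted tree is the father or a child, and a leaf has no child. So the algorithm
needs no distances from the root. -/
theorem IsLeaf.isFather_iff (hi : C.IsLeaf i) (j : Fin C.size) :
    C.IsFather j i ↔ C.tree.Adj j i := by
  refine ⟨fun h => h.1, fun h => ⟨h, ?_⟩⟩
  have h1 := C.isTree.dist_eq_dist_add_one_of_adj C.root h
  have h2 : ¬ (C.tree.dist C.root j = C.tree.dist C.root i + 1) := fun e => hi j ⟨h.symm, e⟩
  omega

theorem mem_sep (v : Fin n) :
    v ∈ C.sep i ↔ v ∈ C.clique i ∧ ∃ j, C.IsFather j i ∧ v ∈ C.clique j := by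
  simp only [sep, Finset.mem_filter]

theorem IsLeaf.mem_sep_iff (hi : C.IsLeaf i) (v : Fin n) :
    v ∈ C.sep i ↔ v ∈ C.clique i ∧ ∃ j, C.tree.Adj j i ∧ v ∈ C.clique j := by
  rw [mem_sep]
  simp only [hi.isFather_iff]

theorem IsFather.unique {j j' : Fin C.size} (h : C.IsFather j i) (h' : C.IsFather j' i) : j = j' :=
  C.isTree.parent_unique (r := C.root) h.1.symm h'.1.symm h.2 h'.2

theorem sep_eq {j : Fin C.size} (h : C.IsFather j i) :
    (C.sep i : Set (Fin n)) = (C.clique i : Set (Fin n)) ∩ C.clique j := by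
  ext v
  rw [Finset.mem_coe, mem_sep, Set.mem_inter_iff, Finset.mem_coe, Finset.mem_coe]
  refine and_congr_right fun _ => ⟨?_, fun hv => ⟨j, h, hv⟩⟩
  rintro ⟨j', h', hv⟩
  rwa [h.unique h']

theorem sep_subset : (C.sep i : Set (Fin n)) ⊆ C.clique i := fun v hv =>
  ((mem_sep v).1 hv).1

theorem IsFather.ne {j : Fin C.size} (h : C.IsFather j i) :
    (C.clique j : Set (Fin n)) ≠ C.clique i := by
  intro e
  exact h.1.ne (C.clique_injective (Finset.coe_injective e))

theorem IsLeaf.isLeafClique (hi : C.IsLeaf i) :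
    IsLeafClique G (C.clique i : Set (Fin n)) (C.sep i : Set (Fin n)) where
  isMax := C.isMaxClique i
  subset := sep_subset
  inter_subset := by
    intro K' hK' hne v hv
    obtain ⟨j, hne, hvj⟩ := (C.exists_isMaxClique_iff
      fun K => K ≠ (C.clique i : Set (Fin n)) ∧ v ∈ K).1 ⟨K', hK', hne, hv.2⟩
    have hji : j ≠ i := by rintro rfl; exact hne rfl
    rw [Finset.mem_coe, hi.mem_sep_iff]
    refine ⟨hv.1, ?_⟩
    -- The path from the leaf to `j` inside the subtree of `v` begins with a neighbour of the leaf,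
    -- which also contains `v`.
    have hconn := C.subtree v
    obtain ⟨p⟩ := hconn ⟨i, hv.1⟩ ⟨j, hvj⟩
    cases p with
    | nil => exact absurd rfl hji
    | cons h q =>
      rename_i l
      exact ⟨l, (show C.tree.Adj i l from h).symm, l.2⟩
  sep := by
    by_cases h : ∃ j, C.IsFather j i
    · obtain ⟨j, hj⟩ := h
      exact Or.inr ⟨_, C.isMaxClique j, hj.ne, sep_eq hj⟩
    · left
      ext v
      simp only [Finset.mem_coe, mem_sep, Set.mem_empty_iff_false, iff_false]
      rintro ⟨-, j, hj, -⟩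
      exact h ⟨j, hj⟩

theorem mem_freeSep (v : Fin n) :
    v ∈ C.freeSep i ↔ v ∈ C.sep i ∧ IsFree G (C.sep i : Set (Fin n)) v := by
  simp only [freeSep, Finset.mem_filter]

/-- All quantifiers range over vertices and tree nodes, so that bounded sums can evaluate the
condition. -/
theorem mem_freeSep_iff (v : Fin n) :
    v ∈ C.freeSep i ↔ v ∈ C.sep i ∧
      (¬ ∃ j, v ∈ C.clique j ∧ (∃ u ∈ C.sep i, u ∉ C.clique j) ∧
        ∃ u ∈ C.sep i, u ∈ C.clique j ∧ u ≠ v) ∧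
      ¬ ∃ j, C.sep i ⊆ C.clique j ∧ ∃ x ∈ C.clique j, x ≠ v ∧
        ∀ u ∈ C.sep i, u ≠ v → ∃ l, v ∈ C.clique l ∧ x ∈ C.clique l ∧ u ∉ C.clique l := by
  rw [mem_freeSep]
  refine and_congr_right fun hv => ?_
  have hv' : v ∈ (C.sep i : Set (Fin n)) := hv
  obtain ⟨j, hj, -⟩ := ((mem_sep v).1 hv).2
  have hSI : IsCliqueInter G (C.sep i : Set (Fin n)) := by
    rw [sep_eq hj]
    exact ⟨{↑(C.clique i), ↑(C.clique j)}, ⟨_, Or.inl rfl⟩, by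
      rintro _ (rfl | rfl); exacts [C.isMaxClique i, C.isMaxClique j], by simp⟩
  have hSM : ¬ IsMaxClique G (C.sep i : Set (Fin n)) := by
    intro h
    have h1 := h.eq_of_subset (C.isMaxClique i) sep_subset
    rw [sep_eq hj] at h1
    exact hj.ne ((C.isMaxClique i).eq_of_subset (C.isMaxClique j) (h1 ▸ Set.inter_subset_right)).symm
  rw [IsFree, isInternallyConstrained_iff hSI hv', isSandwiched_iff hSM hv']
  refine (and_iff_right hv').trans (and_congr (not_congr ?_) (not_congr ?_))
  · rw [C.exists_isMaxClique_iff]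
    rfl
  · rw [C.exists_isMaxClique_iff]
    refine exists_congr fun j => and_congr (by rw [Finset.coe_subset]) (exists_congr fun x =>
      and_congr Iff.rfl (and_congr Iff.rfl (forall_congr' fun u => imp_congr Iff.rfl
        (imp_congr Iff.rfl ?_))))
    exact C.exists_isMaxClique_iff fun K => v ∈ K ∧ x ∈ K ∧ u ∉ K

/-- `v` is a vertex of the clique `j`. -/
def InClique (C : RootedCliqueTree G) (j v : ℕ) : Prop :=
  ∃ (hj : j < C.size) (hv : v < n), (⟨v, hv⟩ : Fin n) ∈ C.clique ⟨j, hj⟩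

def TreeAdj (C : RootedCliqueTree G) (j l : ℕ) : Prop :=
  ∃ (hj : j < C.size) (hl : l < C.size), C.tree.Adj ⟨j, hj⟩ ⟨l, hl⟩

theorem inClique_iff (j : Fin C.size) (v : Fin n) : C.InClique j v ↔ v ∈ C.clique j :=
  ⟨fun ⟨_, _, h⟩ => h, fun h => ⟨j.2, v.2, h⟩⟩

theorem treeAdj_iff (j l : Fin C.size) : C.TreeAdj j l ↔ C.tree.Adj j l :=
  ⟨fun ⟨_, _, h⟩ => h, fun h => ⟨j.2, l.2, h⟩⟩

/-! ### Positions in the input word -/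

theorem length_input : (C.input i).length =
    4 + n * n + C.size * n + C.size * C.size := by
  classical
  simp only [input, List.length_append]
  rw [List.length_flatMap_uniform _ n _ (by simp), List.length_flatMap_uniform _ n _ (by simp),
    List.length_flatMap_uniform _ C.size _ (by simp)]
  simp

theorem input_clique (j : Fin C.size) (v : Fin n) :
    (C.input i).getD (4 + n * n + (j * n + v)) 0 ≠ 0 ↔ v ∈ C.clique j := by
  classical
  rw [input, List.append_assoc, List.getD_append_right, List.length_append,
    List.length_flatMap_uniform _ n _ (by simp), List.length_finRange]
  swap
  · rw [List.length_append, List.length_flatMap_uniform _ n _ (by simp), List.length_finRange]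
    simp only [List.length_cons, List.length_nil]
    omega
  rw [show 4 + n * n + ((j : ℕ) * n + v) - ([n, C.size, (C.root : ℕ), (i : ℕ)].length + n * n) =
    j * n + v by simp only [List.length_cons, List.length_nil]; omega]
  rw [List.getD_matrix]
  simp

theorem input_tree (j l : Fin C.size) :
    (C.input i).getD (4 + n * n + C.size * n + (j * C.size + l)) 0 ≠ 0 ↔ C.tree.Adj j l := by
  classical
  rw [input, List.getD_append_right, List.length_append, List.length_append,
    List.length_flatMap_uniform _ n _ (by simp), List.length_flatMap_uniform _ n _ (by simp),
    List.length_finRange, List.length_finRange]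
  swap
  · rw [List.length_append, List.length_append, List.length_flatMap_uniform _ n _ (by simp),
      List.length_flatMap_uniform _ n _ (by simp), List.length_finRange, List.length_finRange]
    simp only [List.length_cons, List.length_nil]
    omega
  rw [show 4 + n * n + C.size * n + ((j : ℕ) * C.size + l) -
    ([n, C.size, (C.root : ℕ), (i : ℕ)].length + n * n + C.size * n) = j * C.size + l by
      simp only [List.length_cons, List.length_nil]; omega]
  rw [← List.append_nil (List.flatMap _ _), List.getD_matrix]
  simp

end RootedCliqueTree

/-! ### The preprocessing algorithm -/

namespace RAM.Pre

open Ex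

/-- The value of the variable `v` is a vertex of the clique given by the variable `j`. The variables
`0`, `1`, `2` contain the number of vertices, the number of cliques, and the index of the leaf. -/
def inClique (j v : ℕ) : Ex :=
  .and (lt (var j) (var 1)) (.and (lt (var v) (var 0))
    (read (add (add (const 4) (mul 0 0)) (add (mul j 0) (var v)))))

def treeAdj (j l : ℕ) : Ex :=
  .and (lt (var j) (var 1)) (.and (lt (var l) (var 1))
    (read (add (add (add (const 4) (mul 0 0)) (mul 1 0)) (add (mul j 1) (var l)))))

def sep (v : ℕ) : Ex :=
  .and (inClique 2 v) (sum 10 1 (.and (treeAdj 10 2) (inClique 10 v)))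

def internal : Ex :=
  sum 11 1 (.and (inClique 11 3) (.and (sum 12 0 (.and (sep 12) (neg (inClique 11 12))))
    (sum 12 0 (.and (sep 12) (.and (inClique 11 12) (neg (eq (var 12) (var 3))))))))

def sandwiched : Ex :=
  sum 11 1 (.and (all 12 0 (imp (sep 12) (inClique 11 12)))
    (sum 13 0 (.and (inClique 11 13) (.and (neg (eq (var 13) (var 3)))
      (all 12 0 (imp (sep 12) (imp (neg (eq (var 12) (var 3)))
        (sum 14 1 (.and (inClique 14 3) (.and (inClique 14 13) (neg (inClique 14 12))))))))))))

def free : Ex := .and (sep 3) (.and (neg internal) (neg sandwiched))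

/-- The clique given by the variable `4` has another trace on the leaf than all later cliques. -/
def isLast : Ex :=
  .and (neg (eq (var 4) (var 2))) (all 5 1 (imp (lt (var 4) (var 5)) (imp (neg (eq (var 5) (var 2)))
    (sum 6 0 (.and (inClique 2 6) (neg (Ex.iff (inClique 4 6) (inClique 5 6))))))))

def row (e : Ex) : Stmt := .loop 3 0 (.ite (inClique 2 3) (.emit e.bool) .skip)

def body : Stmt :=
  .seq (.emit (sum 3 0 (inClique 2 3).bool)) (.seq (.emit (sum 4 1 isLast.bool))
    (.seq (row (sep 3)) (.seq (row free)
      (.loop 4 1 (.ite isLast (row (inClique 4 3)) .skip)))))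

def vars : List Ex := [read (const 0), read (const 1), read (const 3)]

variable {n : ℕ} {G : SimpleGraph (Fin n)} {C : RootedCliqueTree G} {i : Fin C.size} {σ : ℕ → ℕ}

theorem holds_inClique {j v : ℕ} (h0 : σ 0 = n) (h1 : σ 1 = C.size) :
    (inClique j v).Holds (C.input i) σ ↔ C.InClique (σ j) (σ v) := by
  simp only [inClique, holds_and, holds_lt, eval_var, holds_read, eval_add, eval_const,
    eval_mul (show (0 : ℕ) ≠ 50 by omega), h0, h1]
  constructor
  · rintro ⟨hj, hv, h⟩
    exact ⟨hj, hv, (RootedCliqueTree.input_clique ⟨σ j, hj⟩ ⟨σ v, hv⟩).1 h⟩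
  · rintro ⟨hj, hv, h⟩
    exact ⟨hj, hv, (RootedCliqueTree.input_clique ⟨σ j, hj⟩ ⟨σ v, hv⟩).2 h⟩

theorem holds_treeAdj {j l : ℕ} (h0 : σ 0 = n) (h1 : σ 1 = C.size) :
    (treeAdj j l).Holds (C.input i) σ ↔ C.TreeAdj (σ j) (σ l) := by
  simp only [treeAdj, holds_and, holds_lt, eval_var, holds_read, eval_add, eval_const,
    eval_mul (show (0 : ℕ) ≠ 50 by omega), eval_mul (show (1 : ℕ) ≠ 50 by omega), h0, h1]
  constructor
  · rintro ⟨hj, hl, h⟩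
    exact ⟨hj, hl, (RootedCliqueTree.input_tree ⟨σ j, hj⟩ ⟨σ l, hl⟩).1 h⟩
  · rintro ⟨hj, hl, h⟩
    exact ⟨hj, hl, (RootedCliqueTree.input_tree ⟨σ j, hj⟩ ⟨σ l, hl⟩).2 h⟩

theorem exists_lt_iff {m : ℕ} {P : ℕ → Prop} {Q : Fin m → Prop} (h : ∀ u : Fin m, P u ↔ Q u) :
    (∃ u < m, P u) ↔ ∃ u, Q u :=
  ⟨fun ⟨u, hu, hP⟩ => ⟨⟨u, hu⟩, (h ⟨u, hu⟩).1 hP⟩, fun ⟨u, hQ⟩ => ⟨u, u.2, (h u).2 hQ⟩⟩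

theorem forall_lt_iff {m : ℕ} {P : ℕ → Prop} {Q : Fin m → Prop} (h : ∀ u : Fin m, P u ↔ Q u) :
    (∀ u < m, P u) ↔ ∀ u, Q u :=
  ⟨fun hP u => (h u).1 (hP u u.2), fun hQ u hu => (h ⟨u, hu⟩).2 (hQ ⟨u, hu⟩)⟩

theorem holds_sep {v : ℕ} (hi : C.IsLeaf i) (h0 : σ 0 = n) (h1 : σ 1 = C.size) (h2 : σ 2 = i)
    (hv : v ≠ 10) {w : Fin n} (hw : σ v = w) :
    (sep v).Holds (C.input i) σ ↔ w ∈ C.sep i := by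
  have e : ∀ x, (Function.update σ 10 x) v = w := fun x => by
    rw [Function.update_of_ne hv, hw]
  rw [sep, holds_and, holds_inClique h0 h1, h2, hw, RootedCliqueTree.inClique_iff,
    hi.mem_sep_iff, holds_sum, h1]
  refine and_congr_right fun _ => exists_lt_iff fun j => ?_
  rw [holds_and, holds_treeAdj (by simpa using h0) (by simpa using h1),
    holds_inClique (by simpa using h0) (by simpa using h1), e]
  simp [h2, RootedCliqueTree.inClique_iff, RootedCliqueTree.treeAdj_iff]

theorem holds_free (hi : C.IsLeaf i) (h0 : σ 0 = n) (h1 : σ 1 = C.size) (h2 : σ 2 = i)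
    {w : Fin n} (hw : σ 3 = w) :
    free.Holds (C.input i) σ ↔ w ∈ C.freeSep i := by
  have hs : ∀ (τ : ℕ → ℕ) (v : ℕ) (w : Fin n), τ 0 = n → τ 1 = C.size → τ 2 = i → v ≠ 10 →
      τ v = w → ((sep v).Holds (C.input i) τ ↔ w ∈ C.sep i) :=
    fun τ v w h0 h1 h2 hv hw => holds_sep hi h0 h1 h2 hv hw
  have hc : ∀ (τ : ℕ → ℕ) (j v : ℕ) (l : Fin C.size) (w : Fin n), τ 0 = n → τ 1 = C.size →
      τ j = l → τ v = w → ((inClique j v).Holds (C.input i) τ ↔ w ∈ C.clique l) := by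
    intro τ j v l w h0 h1 hj hv
    rw [holds_inClique h0 h1, hj, hv, RootedCliqueTree.inClique_iff]
  rw [free, holds_and, hs σ 3 w h0 h1 h2 (by omega) hw, RootedCliqueTree.mem_freeSep_iff, holds_and,
    holds_neg, holds_neg, internal, sandwiched, holds_sum, holds_sum, h1]
  refine and_congr_right fun _ => and_congr (not_congr (exists_lt_iff fun j => ?_))
    (not_congr (exists_lt_iff fun j => ?_))
  · rw [holds_and, holds_and, holds_sum, holds_sum]
    refine and_congr ?_ (and_congr ?_ ?_)
    · exact hc _ _ _ j w (by simpa using h0) (by simpa using h1) (by simp) (by simpa using hw)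
    · rw [show Function.update σ 11 (j : ℕ) 0 = n by simpa using h0]
      refine exists_lt_iff fun u => ?_
      rw [holds_and, holds_neg, hs _ _ u (by simpa using h0) (by simpa using h1) (by simpa using h2)
        (by omega) (by simp), hc _ _ _ j u (by simpa using h0) (by simpa using h1) (by simp)
        (by simp)]
    · rw [show Function.update σ 11 (j : ℕ) 0 = n by simpa using h0]
      refine exists_lt_iff fun u => ?_
      rw [holds_and, holds_and, holds_neg, hs _ _ u (by simpa using h0) (by simpa using h1)
        (by simpa using h2) (by omega) (by simp), hc _ _ _ j u (by simpa using h0)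
        (by simpa using h1) (by simp) (by simp), holds_eq]
      simp [hw, Fin.ext_iff]
  · rw [holds_and, holds_sum, holds_all,
      show Function.update σ 11 (j : ℕ) 0 = n by simpa using h0]
    refine and_congr ((forall_lt_iff fun u => ?_).trans Finset.subset_iff.symm)
      (exists_lt_iff fun x => ?_)
    · rw [holds_imp, hs _ _ u (by simpa using h0) (by simpa using h1) (by simpa using h2) (by omega)
        (by simp), hc _ _ _ j u (by simpa using h0) (by simpa using h1) (by simp) (by simp)]
    · rw [holds_and, holds_and, holds_neg, holds_all,
        hc _ _ _ j x (by simpa using h0) (by simpa using h1) (by simp) (by simp), holds_eq,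
        show Function.update (Function.update σ 11 (j : ℕ)) 13 (x : ℕ) 0 = n by simpa using h0]
      refine and_congr_right fun _ => and_congr (by simp [hw, Fin.ext_iff]) (forall_lt_iff fun u => ?_)
      rw [holds_imp, holds_imp, hs _ _ u (by simpa using h0) (by simpa using h1)
        (by simpa using h2) (by omega) (by simp), holds_neg, holds_eq, holds_sum,
        show Function.update (Function.update (Function.update σ 11 (j : ℕ)) 13 (x : ℕ)) 12
          (u : ℕ) 1 = C.size by simpa using h1]
      refine imp_congr_right fun _ => imp_congr (by simp [hw, Fin.ext_iff])
        (exists_lt_iff fun l => ?_)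
      rw [holds_and, holds_and, holds_neg,
        hc _ _ _ l w (by simpa using h0) (by simpa using h1) (by simp) (by simpa using hw),
        hc _ _ _ l x (by simpa using h0) (by simpa using h1) (by simp) (by simp),
        hc _ _ _ l u (by simpa using h0) (by simpa using h1) (by simp) (by simp)]

/-- The trace with number `j`. -/
def trace (C : RootedCliqueTree G) (i : Fin C.size) (j : ℕ) : Finset (Fin n) :=
  if h : j < C.size then C.clique i ∩ C.clique ⟨j, h⟩ else ∅

/-- Removal of duplicates keeps the last occurrence of each trace, so a clique contributes exactly
if no later one has the same trace. -/
theorem traces_eq : C.traces i = ((List.range C.size).filter fun j => j ≠ (i : ℕ) ∧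
    ∀ j' ∈ List.range C.size, j < j' → j' ≠ (i : ℕ) → trace C i j' ≠ trace C i j).map
      (trace C i) := by
  rw [← List.dedup_map_eq (trace C i) (fun j => j ≠ (i : ℕ)) (List.range C.size)
    List.pairwise_lt_range, RootedCliqueTree.traces,
    show List.range C.size = (List.finRange C.size).map Fin.val by simp, List.filter_map,
    List.map_map]
  congr 1
  have h1 : (List.finRange C.size).filter (fun j => decide (j ≠ i)) =
      (List.finRange C.size).filter ((fun j : ℕ => decide (j ≠ (i : ℕ))) ∘ Fin.val) := by
    refine List.filter_congr fun j _ => ?_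
    simp [Fin.ext_iff]
  rw [h1]
  refine List.map_congr_left fun j _ => ?_
  simp [trace]

theorem holds_isLast (h0 : σ 0 = n) (h1 : σ 1 = C.size) (h2 : σ 2 = i)
    (h4 : σ 4 < C.size) :
    isLast.Holds (C.input i) σ ↔ σ 4 ≠ i ∧
      ∀ j' ∈ List.range C.size, σ 4 < j' → j' ≠ (i : ℕ) → trace C i j' ≠ trace C i (σ 4) := by
  rw [isLast, holds_and, holds_neg, holds_eq, eval_var, eval_var, h2, holds_all, h1]
  refine and_congr_right fun _ => ?_
  simp only [List.mem_range]
  refine forall_congr' fun j => imp_congr_right fun hj => ?_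
  rw [holds_imp, holds_imp, holds_lt, holds_neg, holds_eq, holds_sum]
  refine imp_congr (by simp) (imp_congr (by simp [h2]) ?_)
  rw [show Function.update σ 5 j 0 = n by simpa using h0, trace, trace, dif_pos hj, dif_pos h4]
  rw [exists_lt_iff (Q := fun u : Fin n => u ∈ C.clique i ∧
    ¬ (u ∈ C.clique ⟨σ 4, h4⟩ ↔ u ∈ C.clique ⟨j, hj⟩))]
  · rw [Ne, Finset.ext_iff, not_forall]
    refine exists_congr fun u => ?_
    simp only [Finset.mem_inter]
    tauto
  · intro u
    rw [holds_and, holds_neg, holds_iff, holds_inClique (by simpa using h0) (by simpa using h1),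
      holds_inClique (by simpa using h0) (by simpa using h1),
      holds_inClique (by simpa using h0) (by simpa using h1)]
    rw [← RootedCliqueTree.inClique_iff, ← RootedCliqueTree.inClique_iff,
      ← RootedCliqueTree.inClique_iff]
    simp [h2]

theorem out_row (e : Ex) (A : Finset (Fin n)) (h0 : σ 0 = n) (h1 : σ 1 = C.size) (h2 : σ 2 = i)
    (hA : ∀ v : Fin n, v ∈ C.clique i →
      (e.Holds (C.input i) (Function.update σ 3 v) ↔ v ∈ A)) :
    (row e).out (C.input i) σ = C.row i A := by
  rw [RootedCliqueTree.row, Finset.ofFn_orderEmbOfFin (C.clique i) (fun v => if v ∈ A then 1 else 0),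
    row, Stmt.out, h0, show List.range n = (List.finRange n).map Fin.val by simp, List.flatMap_map,
    ← List.flatMap_pure_eq_map, ← List.flatMap_ite_nil]
  refine List.flatMap_congr fun v _ => ?_
  have hin : (inClique 2 3).Holds (C.input i) (Function.update σ 3 v) ↔ v ∈ C.clique i := by
    rw [holds_inClique (by simpa using h0) (by simpa using h1)]
    simp [h2, RootedCliqueTree.inClique_iff]
  rw [Stmt.out_ite]
  by_cases hv : v ∈ C.clique i
  · rw [if_pos (hin.2 hv), if_pos hv, Stmt.out, eval_bool]
    simp only [hA v hv]
    congr
  · rw [if_neg (fun h => hv (hin.1 h)), if_neg hv, Stmt.out]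

theorem out_body (hi : C.IsLeaf i) (h0 : σ 0 = n) (h1 : σ 1 = C.size) (h2 : σ 2 = i) :
    body.out (C.input i) σ = C.localData i := by
  classical
  have hlast : ∀ j < C.size, isLast.Holds (C.input i) (Function.update σ 4 j) ↔ j ≠ i ∧
      ∀ j' ∈ List.range C.size, j < j' → j' ≠ (i : ℕ) → trace C i j' ≠ trace C i j := by
    intro j hj
    have := holds_isLast (C := C) (i := i) (σ := Function.update σ 4 j) (by simpa using h0)
      (by simpa using h1) (by simpa using h2) (by simpa using hj)
    simpa using this
  have hcard : (sum 3 0 (inClique 2 3).bool).eval (C.input i) σ = (C.clique i).card := by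
    rw [Ex.eval, h0, Finset.sum_range]
    rw [Finset.card_eq_sum_ones, ← Finset.sum_filter_add_sum_filter_not Finset.univ (· ∈ C.clique i)]
    have hin : ∀ v : Fin n, (inClique 2 3).Holds (C.input i) (Function.update σ 3 v) ↔
        v ∈ C.clique i := by
      intro v
      rw [holds_inClique (by simpa using h0) (by simpa using h1)]
      simp [h2, RootedCliqueTree.inClique_iff]
    rw [Finset.sum_congr rfl (g := fun _ => 1), Finset.sum_congr rfl (g := fun _ => 0)
      (s₁ := Finset.univ.filter (¬ · ∈ C.clique i))]
    · simp
    · intro v hv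
      rw [eval_bool, if_neg (fun h => (Finset.mem_filter.1 hv).2 ((hin v).1 h))]
    · intro v hv
      rw [eval_bool, if_pos ((hin v).2 (Finset.mem_filter.1 hv).2)]
  have hfilter : (List.range C.size).filter (fun j =>
      decide (isLast.Holds (C.input i) (Function.update σ 4 j))) =
      (List.range C.size).filter fun j => j ≠ (i : ℕ) ∧
        ∀ j' ∈ List.range C.size, j < j' → j' ≠ (i : ℕ) → trace C i j' ≠ trace C i j := by
    refine List.filter_congr fun j hj => ?_
    rw [List.mem_range] at hj
    simp only [hlast j hj]
  have hlen : (sum 4 1 isLast.bool).eval (C.input i) σ = (C.traces i).length := by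
    rw [Ex.eval, h1, traces_eq, List.length_map, ← hfilter]
    simp only [eval_bool]
    rw [Finset.sum_boole]
    rfl
  rw [body, Stmt.out, Stmt.out, Stmt.out, Stmt.out, Stmt.out, Stmt.out, hcard, hlen,
    out_row (sep 3) (C.sep i) h0 h1 h2 (fun v _ => holds_sep hi (by simpa using h0)
      (by simpa using h1) (by simpa using h2) (by omega) (by simp)),
    out_row free (C.freeSep i) h0 h1 h2 (fun v _ => holds_free hi (by simpa using h0)
      (by simpa using h1) (by simpa using h2) (by simp)), Stmt.out, RootedCliqueTree.localData, h1]
  have htr : ((List.range C.size).flatMap fun j => (Stmt.ite isLast (row (inClique 4 3)) .skip).out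
      (C.input i) (Function.update σ 4 j)) = (C.traces i).flatMap (C.row i) := by
    rw [traces_eq, List.flatMap_map, ← hfilter, ← List.flatMap_ite_nil]
    refine List.flatMap_congr fun j hj => ?_
    rw [List.mem_range] at hj
    rw [Stmt.out_ite]
    by_cases hl : isLast.Holds (C.input i) (Function.update σ 4 j)
    · rw [if_pos hl, if_pos hl]
      refine out_row _ _ (by simpa using h0) (by simpa using h1) (by simpa using h2) fun v hv => ?_
      rw [holds_inClique (by simpa using h0) (by simpa using h1), trace, dif_pos hj,
        Finset.mem_inter, and_iff_right hv, ← RootedCliqueTree.inClique_iff]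
      simp
    · rw [if_neg hl, if_neg hl, Stmt.out]
  rw [htr]
  simp

/-- The preprocessing algorithm. -/
def prog : Prog := setVars vars 0 (body.comp 0)

theorem outputsWithin_prog (hi : C.IsLeaf i) :
    OutputsWithin prog (C.input i) (C.localData i)
      ((setVarsCost vars + body.cost).eval (C.input i).length) := by
  have hv : valsAfter (C.input i) vars 0 (fun _ => 0) = Function.update (Function.update
      (Function.update (fun _ => 0) 0 n) 1 C.size) 2 (i : ℕ) := rfl
  have h := outputsWithin_setVars (C.input i) (C.input i).length body vars (by
    -- The input contains an adjacency matrix of the graph and one of the tree, so its length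
    -- exceeds both dimensions and bounds all variables.
    have hn : n ≤ n * n := Nat.le_mul_self n
    have hm : C.size ≤ C.size * C.size := Nat.le_mul_self _
    have hi := i.2
    refine ⟨?_, ?_, ?_, trivial⟩
    · change n ≤ _
      rw [RootedCliqueTree.length_input]
      omega
    · change C.size ≤ _
      rw [RootedCliqueTree.length_input]
      omega
    · change (i : ℕ) ≤ _
      rw [RootedCliqueTree.length_input]
      omega)
  rwa [out_body hi (by rw [hv]; simp) (by rw [hv]; simp) (by rw [hv]; simp)] at h

end RAM.Pre

/-! ### Nested loops -/

namespace RAM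

/-- The assignments reached by nested loops. A pair `(x, y)` is a loop in which the variable `x`
runs over all values below the value of the variable `y`; the outermost loop comes first. -/
def envs : List (ℕ × ℕ) → (ℕ → ℕ) → List (ℕ → ℕ)
  | [], σ => [σ]
  | (x, y) :: l, σ => (List.range (σ y)).flatMap fun v => envs l (Function.update σ x v)

def Stmt.loops : List (ℕ × ℕ) → Stmt → Stmt
  | [], s => s
  | (x, y) :: l, s => .loop x y (loops l s)

def Ex.sums : List (ℕ × ℕ) → Ex → Ex
  | [], e => e
  | (x, y) :: l, e => .sum x y (sums l e)

variable {inp : List ℕ} {l : List (ℕ × ℕ)} {σ : ℕ → ℕ}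

theorem Stmt.out_loops (s : Stmt) :
    (Stmt.loops l s).out inp σ = (envs l σ).flatMap (s.out inp) := by
  induction l generalizing σ with
  | nil => simp [loops, envs]
  | cons xy l ih =>
    obtain ⟨x, y⟩ := xy
    simp only [loops, envs, Stmt.out, ih, List.flatMap_assoc]

theorem Ex.eval_sums_const : (Ex.sums l (const 1)).eval inp σ = (envs l σ).length := by
  induction l generalizing σ with
  | nil => simp [sums, envs]
  | cons xy l ih =>
    obtain ⟨x, y⟩ := xy
    simp only [sums, envs, Ex.eval, ih, List.length_flatMap]
    rw [Finset.sum_range, ← List.sum_ofFn, List.ofFn_eq_map]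
    congr 1
    rw [show List.range (σ y) = (List.finRange (σ y)).map Fin.val by simp, List.map_map]
    rfl

theorem mem_envs_cons {x y v : ℕ} {σ' : ℕ → ℕ} (hv : v < σ y)
    (h : σ' ∈ envs l (Function.update σ x v)) : σ' ∈ envs ((x, y) :: l) σ :=
  List.mem_flatMap.2 ⟨v, List.mem_range.2 hv, h⟩

theorem eq_of_mem_envs {σ' : ℕ → ℕ} (h : σ' ∈ envs l σ) {z : ℕ} (hz : z ∉ l.map Prod.fst) :
    σ' z = σ z := by
  induction l generalizing σ with
  | nil => rw [List.mem_singleton.1 h]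
  | cons xy l ih =>
    obtain ⟨x, y⟩ := xy
    obtain ⟨v, -, hv⟩ := List.mem_flatMap.1 h
    rw [List.map_cons, List.mem_cons, not_or] at hz
    rw [ih hv hz.2, Function.update_of_ne hz.1]

end RAM

/-! ### The algorithm for a leaf -/

namespace RAM.Leaf

open Ex

section Types

variable (inp : List ℕ) (σ : ℕ → ℕ)

/-- In these definitions the variables `0` and `1` contain the size of the clique and the number of
traces in use; `5` and `6` contain the vertices at the center and at its distinguished child, `7` the
exceptional vertex, `8` a trace and `9` a mode. -/
def IsSep (p : ℕ) : Prop := inp.getD (2 + p) 0 ≠ 0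

def IsFreeSep (p : ℕ) : Prop := inp.getD (2 + σ 0 + p) 0 ≠ 0

def InTrace (j p : ℕ) : Prop := inp.getD (2 + σ 0 + σ 0 + j * σ 0 + p) 0 ≠ 0

/-- A value of variable `5` equal to the size of the clique stands for a center that is a Steiner
node; then no vertex is paired. -/
def IsPaired (p : ℕ) : Prop :=
  σ 5 < σ 0 ∧ p ≠ σ 5 ∧ ∃ j < σ 1, ∀ q < σ 0, InTrace inp σ j q ↔ q = σ 5 ∨ q = p

/-- The counterpart of `baseSet` on vertex numbers; mode `0` satisfies no alternative and gives the
empty set. -/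
def InBase (p : ℕ) : Prop :=
  (σ 9 = 1 ∧ IsSep inp p) ∨ (σ 9 = 2 ∧ IsSep inp p ∧ ¬ IsFreeSep inp σ p ∧ ¬ IsPaired inp σ p) ∨
    (σ 9 = 3 ∧ IsSep inp p ∧ ¬ IsPaired inp σ p) ∨ (σ 9 = 4 ∧ InTrace inp σ (σ 8) p) ∨
    (σ 9 = 5 ∧ IsSep inp p ∧ ¬ InTrace inp σ (σ 8) p)

open Classical in
/-- The type of a vertex, in the sense of `TreeCode.ofTypes`. -/
noncomputable def type (p : ℕ) : ℕ :=
  if p = σ 5 then 0 else if p = σ 6 then 1 else if ¬ (InBase inp σ p ↔ p = σ 7) then 3 else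
    if IsSep inp p then 2 else 4

/-- Types `0` and `1` are each given to one number at most, whatever the parameters and the input
are. So even meaningless choices produce valid trees. -/
theorem typesValid (k : ℕ) : TreeCode.TypesValid k (type inp σ) := by
  intro p _ q _ h h'
  unfold type at h h'
  split_ifs at h h' <;> omega

variable {inp σ}

/-- The variables from `10` on are scratch variables of the loops and do not influence the types. -/
theorem type_update {x v : ℕ} (hx : 10 ≤ x) :
    type inp (Function.update σ x v) = type inp σ := by
  funext p
  have h : ∀ z < 10, Function.update σ x v z = σ z := fun z hz =>
    Function.update_of_ne (by omega) _ _
  have hB : InBase inp (Function.update σ x v) p = InBase inp σ p := by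
    simp only [InBase, IsPaired, InTrace, IsFreeSep, h 0 (by omega), h 1 (by omega),
      h 5 (by omega), h 8 (by omega), h 9 (by omega)]
  unfold type
  rw [hB, h 5 (by omega), h 6 (by omega), h 7 (by omega)]

end Types

/-! ### Expressions that compute the codes of the trees -/

def isSep (v : ℕ) : Ex := read (add (const 2) (var v))

def isFreeSep (v : ℕ) : Ex := read (add (add (const 2) (var 0)) (var v))

def inTrace (j v : ℕ) : Ex :=
  read (add (add (add (add (const 2) (var 0)) (var 0)) (mul j 0)) (var v))

def isPaired (v : ℕ) : Ex :=
  .and (lt (var 5) (var 0)) (.and (neg (eq (var v) (var 5)))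
    (sum 30 1 (all 31 0 (.iff (inTrace 30 31) (.or (eq (var 31) (var 5)) (eq (var 31) (var v)))))))

def inBase (v : ℕ) : Ex :=
  .or (.and (eq (var 9) (const 1)) (isSep v))
    (.or (.and (eq (var 9) (const 2)) (.and (isSep v) (.and (neg (isFreeSep v)) (neg (isPaired v)))))
      (.or (.and (eq (var 9) (const 3)) (.and (isSep v) (neg (isPaired v))))
        (.or (.and (eq (var 9) (const 4)) (inTrace 8 v))
          (.and (eq (var 9) (const 5)) (.and (isSep v) (neg (inTrace 8 v)))))))

def typeEx (v : ℕ) : Ex :=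
  cond (eq (var v) (var 5)) (const 0) (cond (eq (var v) (var 6)) (const 1)
    (cond (neg (.iff (inBase v) (eq (var v) (var 7)))) (const 3)
      (cond (isSep v) (const 2) (const 4))))

def widthEx (v : ℕ) : Ex :=
  cond (lt (typeEx v) (const 2)) (const 0) (cond (lt (typeEx v) (const 4)) (const 1) (const 2))

def startEx (v : ℕ) : Ex := add (const 2) (sum 21 v (widthEx 21))

def lowerEx : Ex := cond (lt (typeEx 20) (const 2)) (const 1) (startEx 20)

def upperEx : Ex := cond (eq (typeEx 20) (const 3)) (const 1) (const 0)

def upperEx' : Ex := cond (lt (typeEx 20) (const 4)) upperEx (startEx 20)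

def lowerEx' : Ex := cond (lt (typeEx 20) (const 4)) lowerEx (add (startEx 20) (const 1))

def nodeEx : Ex := cond (eq (typeEx 20) (const 0)) (const 0) lowerEx'

def codeStmt : Stmt :=
  .seq (.emit (startEx 0)) (.seq (.emit (add (const 1) (sum 20 0 (const 2))))
    (.seq (.emit (const 0)) (.seq (.emit (const 1))
      (.seq (.loop 20 0 (.seq (.emit upperEx) (.seq (.emit lowerEx)
          (.seq (.emit upperEx') (.emit lowerEx')))))
        (.loop 20 0 (.emit nodeEx))))))

/-- Center, distinguished child and exceptional vertex run over all vertex numbers and one more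
value that means no vertex; then come a trace and one of the six modes. -/
def params : List (ℕ × ℕ) := [(5, 2), (6, 2), (7, 2), (8, 3), (9, 4)]

def body : Stmt := .seq (.emit (sums params (const 1))) (.loops params codeStmt)

/-- Only as many traces are used as there can be if they matter. -/
def vars : List Ex := [read (const 0),
  -- Truncated subtraction computes the minimum of the number of traces and `k * k + 4`.
  sub (read (const 1)) (sub (read (const 1)) (add (mul 0 0) (const 4))),
  add (var 0) (const 1), add (var 1) (const 1), const 6]

variable {inp : List ℕ} {σ : ℕ → ℕ}

open Classical in
theorem Ex.eval_cond {c a b : Ex} :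
    (cond c a b).eval inp σ = if c.Holds inp σ then a.eval inp σ else b.eval inp σ := by
  simp only [Ex.eval, Ex.Holds]
  congr

theorem holds_isSep {v : ℕ} : (isSep v).Holds inp σ ↔ IsSep inp (σ v) := Iff.rfl

theorem holds_isFreeSep {v : ℕ} : (isFreeSep v).Holds inp σ ↔ IsFreeSep inp σ (σ v) := Iff.rfl

theorem holds_inTrace {j v : ℕ} : (inTrace j v).Holds inp σ ↔ InTrace inp σ (σ j) (σ v) := by
  rw [inTrace, holds_read]
  simp only [eval_add, eval_const, eval_var, eval_mul (show (0 : ℕ) ≠ 50 by omega), InTrace]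

theorem holds_isPaired {v : ℕ} (hv : v < 30) : (isPaired v).Holds inp σ ↔ IsPaired inp σ (σ v) := by
  simp only [isPaired, holds_and, holds_lt, holds_neg, holds_eq, holds_sum, holds_all, holds_iff,
    holds_or, holds_inTrace, eval_var, IsPaired, InTrace]
  have h30 : v ≠ 30 := by omega
  have h31 : v ≠ 31 := by omega
  simp [h30, h31]

theorem holds_inBase {v : ℕ} (hv : v < 30) : (inBase v).Holds inp σ ↔ InBase inp σ (σ v) := by
  simp only [inBase, holds_and, holds_neg, holds_eq, holds_or, holds_inTrace, holds_isPaired hv,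
    holds_isSep, holds_isFreeSep, eval_var, eval_const, InBase]

theorem eval_typeEx {v : ℕ} (hv : v < 30) : (typeEx v).eval inp σ = type inp σ (σ v) := by
  classical
  simp only [typeEx, Ex.eval_cond, holds_eq, holds_neg, holds_iff, holds_inBase hv, holds_isSep,
    eval_var, eval_const, type]

theorem eval_widthEx {v : ℕ} (hv : v < 30) :
    (widthEx v).eval inp σ = TreeCode.width (type inp σ (σ v)) := by
  classical
  simp only [widthEx, Ex.eval_cond, holds_lt, eval_typeEx hv, eval_const, TreeCode.width]
  split_ifs <;> omega

theorem eval_startEx (v : ℕ) :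
    (startEx v).eval inp σ = TreeCode.start (type inp σ) (σ v) := by
  rw [startEx, eval_add, eval_const, Ex.eval, TreeCode.start]
  congr 1
  refine Finset.sum_congr rfl fun q _ => ?_
  rw [eval_widthEx (by omega), type_update (by omega), Function.update_self]

theorem eval_lowerEx : lowerEx.eval inp σ = TreeCode.lower (type inp σ) (σ 20) := by
  classical
  rw [lowerEx, Ex.eval_cond, holds_lt, eval_typeEx (by omega), eval_startEx, TreeCode.lower]
  by_cases h : type inp σ (σ 20) ≤ 1
  · rw [if_pos (by rw [eval_const]; omega), if_pos h, eval_const]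
  · rw [if_neg (by rw [eval_const]; omega), if_neg h]

theorem eval_upperEx : upperEx.eval inp σ = TreeCode.upper (type inp σ) (σ 20) := by
  classical
  rw [upperEx, Ex.eval_cond, holds_eq, eval_typeEx (by omega), TreeCode.upper]
  by_cases h : type inp σ (σ 20) = 3
  · rw [if_pos (by simpa using h), if_pos h, eval_const]
  · rw [if_neg (by simpa using h), if_neg h, eval_const]

theorem eval_upperEx' : upperEx'.eval inp σ = TreeCode.upper' (type inp σ) (σ 20) := by
  classical
  rw [upperEx', Ex.eval_cond, holds_lt, eval_typeEx (by omega), eval_startEx, eval_upperEx,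
    TreeCode.upper']
  by_cases h : type inp σ (σ 20) ≤ 3
  · rw [if_pos (by rw [eval_const]; omega), if_pos h]
  · rw [if_neg (by rw [eval_const]; omega), if_neg h]

theorem eval_lowerEx' : lowerEx'.eval inp σ = TreeCode.lower' (type inp σ) (σ 20) := by
  classical
  rw [lowerEx', Ex.eval_cond, holds_lt, eval_typeEx (by omega), eval_add, eval_startEx, eval_lowerEx,
    TreeCode.lower']
  by_cases h : type inp σ (σ 20) ≤ 3
  · rw [if_pos (by rw [eval_const]; omega), if_pos h]
  · rw [if_neg (by rw [eval_const]; omega), if_neg h, eval_const]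

theorem eval_nodeEx : nodeEx.eval inp σ = TreeCode.nodeOf (type inp σ) (σ 20) := by
  classical
  rw [nodeEx, Ex.eval_cond, holds_eq, eval_typeEx (by omega), eval_lowerEx', TreeCode.nodeOf]
  by_cases h : type inp σ (σ 20) = 0
  · rw [if_pos (by simpa using h), if_pos h, eval_const]
  · rw [if_neg (by simpa using h), if_neg h]

theorem out_codeStmt :
    codeStmt.out inp σ = (TreeCode.ofTypes (σ 0) (type inp σ)).encode := by
  rw [TreeCode.encode_ofTypes]
  simp only [codeStmt, Stmt.out, eval_startEx, eval_upperEx, eval_lowerEx, eval_upperEx',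
    eval_lowerEx', eval_nodeEx, Ex.eval, Function.update_self,
    type_update (show 10 ≤ 20 by omega), List.cons_append, List.nil_append]

/-- The trees for a clique of size `k`. -/
noncomputable def family (inp : List ℕ) (σ : ℕ → ℕ) (k : ℕ) : List (TreeCode k) :=
  (envs params σ).map fun σ' => TreeCode.ofTypes k (type inp σ')

theorem out_body : body.out inp σ = TreeCode.encodeFamily (family inp σ (σ 0)) := by
  rw [body, Stmt.out, Stmt.out, eval_sums_const, Stmt.out_loops, TreeCode.encodeFamily, family,
    List.length_map, List.flatMap_map, List.singleton_append]
  congr 1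
  refine List.flatMap_congr fun σ' hσ' => ?_
  rw [out_codeStmt, eq_of_mem_envs hσ' (by decide)]

/-- The values of the variables at the start of the loops. -/
def init (k t : ℕ) : ℕ → ℕ :=
  Function.update (Function.update (Function.update (Function.update (Function.update (fun _ => 0)
    0 k) 1 t) 2 (k + 1)) 3 (t + 1)) 4 6

def prog : Prog := setVars vars 0 (body.comp 0)

/-- All stored variables are at most `k * k + 10`; in particular the number of traces in the input
does not enter, since it is cut off before any loop. -/
noncomputable def cost : Polynomial ℕ :=
  (setVarsCost vars + body.cost).comp (Polynomial.X * Polynomial.X + 10)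

theorem outputsWithin_prog (inp : List ℕ) :
    OutputsWithin prog inp (TreeCode.encodeFamily (family inp
      (init (inp.getD 0 0) (min (inp.getD 1 0) (inp.getD 0 0 * inp.getD 0 0 + 4))) (inp.getD 0 0)))
      (cost.eval (inp.getD 0 0)) := by
  set k := inp.getD 0 0 with hk
  set t := inp.getD 1 0 with ht
  have e0 : (read (const 0)).eval inp (fun _ => 0) = k := rfl
  have e1 : (sub (read (const 1)) (sub (read (const 1)) (add (mul 0 0) (const 4)))).eval inp
      (Function.update (fun _ => 0) 0 k) = min t (k * k + 4) := by
    simp only [eval_sub, eval_add, eval_mul (show (0 : ℕ) ≠ 50 by omega), eval_const, eval_read,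
      Function.update_self, ← ht]
    omega
  have hv : valsAfter inp vars 0 (fun _ => 0) = init k (min t (k * k + 4)) := by
    simp only [vars, valsAfter, e0, zero_add, e1, init]
    simp
  have h := outputsWithin_setVars inp (k * k + 10) body vars (by
    have hkk : k ≤ k * k := Nat.le_mul_self k
    simp only [vars, ValsBounded, e0, zero_add, e1]
    simp
    omega)
  rw [hv, out_body, show init k (min t (k * k + 4)) 0 = k by simp [init]] at h
  rw [cost, Polynomial.eval_comp]
  simpa [prog] using h

end RAM.Leaf

/-! ### Reading the local clique data -/

namespace RootedCliqueTree

variable {n : ℕ} {G : SimpleGraph (Fin n)} (C : RootedCliqueTree G) (i : Fin C.size)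

open Classical in
/-- The vertex with number `p` of the clique `i`. -/
noncomputable def vert [Nonempty (Fin n)] (p : ℕ) : Fin n :=
  if h : p < (C.clique i).card then (C.clique i).orderEmbOfFin rfl ⟨p, h⟩ else Classical.arbitrary _

variable {C i}

theorem length_row (A : Finset (Fin n)) : (C.row i A).length = (C.clique i).card := by
  simp [row]

theorem mem_traces (A : Finset (Fin n)) :
    A ∈ C.traces i ↔ ∃ K', IsMaxClique G K' ∧ K' ≠ (C.clique i : Set (Fin n)) ∧
      (C.clique i : Set (Fin n)) ∩ K' = A := by
  rw [C.exists_isMaxClique_iff fun K' => K' ≠ (C.clique i : Set (Fin n)) ∧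
      (C.clique i : Set (Fin n)) ∩ K' = A]
  simp only [traces, List.mem_dedup, List.mem_map, List.mem_filter, List.mem_finRange, true_and,
    decide_eq_true_eq, ← Finset.coe_inter, Finset.coe_inj, Ne, C.clique_injective.eq_iff]

/-- Up to four exceptional sets, `S`, `Y`, `Z` and the empty set, every trace has one or two
elements and is the image of a pair of vertices of the clique. -/
theorem length_traces_le {Y Z : Set (Fin n)}
    (h : ∀ K', IsMaxClique G K' → K' ≠ (C.clique i : Set (Fin n)) →
      (C.clique i : Set (Fin n)) ∩ K' = C.sep i ∨ (C.clique i : Set (Fin n)) ∩ K' = Y ∨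
        (C.clique i : Set (Fin n)) ∩ K' = Z ∨ ((C.clique i : Set (Fin n)) ∩ K').ncard ≤ 2) :
    (C.traces i).length ≤ (C.clique i).card * (C.clique i).card + 4 := by
  classical
  have hnd : (C.traces i).Nodup := List.nodup_dedup _
  rw [← List.toFinset_card_of_nodup hnd]
  have hsub : (C.traces i).toFinset ⊆ {C.sep i, Y.toFinset, Z.toFinset, ∅} ∪
      (C.clique i ×ˢ C.clique i).image fun x => {x.1, x.2} := by
    intro A hA
    obtain ⟨K', hK', hne, e⟩ := (mem_traces A).1 (List.mem_toFinset.1 hA)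
    have hAK : A ⊆ C.clique i := by
      rw [← Finset.coe_subset, ← e]
      exact Set.inter_subset_left
    simp only [Finset.mem_union, Finset.mem_insert, Finset.mem_singleton, Finset.mem_image,
      Finset.mem_product, Prod.exists]
    have h' := h K' hK' hne
    rw [e, Set.ncard_coe_finset] at h'
    rcases h' with h' | h' | h' | h'
    · exact Or.inl (Or.inl (Finset.coe_inj.1 h'))
    · exact Or.inl (Or.inr (Or.inl (by rw [← Finset.coe_inj, h', Set.coe_toFinset])))
    · exact Or.inl (Or.inr (Or.inr (Or.inl (by rw [← Finset.coe_inj, h', Set.coe_toFinset]))))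
    · have h3 : A.card = 0 ∨ A.card = 1 ∨ A.card = 2 := by omega
      rcases h3 with h3 | h3 | h3
      · exact Or.inl (Or.inr (Or.inr (Or.inr (Finset.card_eq_zero.1 h3))))
      · obtain ⟨x, rfl⟩ := Finset.card_eq_one.1 h3
        have hx := hAK (Finset.mem_singleton_self x)
        exact Or.inr ⟨x, x, ⟨hx, hx⟩, by simp⟩
      · obtain ⟨x, y, -, rfl⟩ := Finset.card_eq_two.1 h3
        exact Or.inr ⟨x, y, ⟨hAK (by simp), hAK (by simp)⟩, rfl⟩
  refine (Finset.card_le_card hsub).trans ((Finset.card_union_le _ _).trans ?_)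
  have h1 := Finset.card_le_four (a := C.sep i) (b := Y.toFinset) (c := Z.toFinset) (d := ∅)
  have h2 := Finset.card_image_le (s := C.clique i ×ˢ C.clique i)
    (f := fun x => ({x.1, x.2} : Finset (Fin n)))
  rw [Finset.card_product] at h2
  omega

section Vert

variable [Nonempty (Fin n)] {p q : ℕ}

theorem vert_of_lt (hp : p < (C.clique i).card) :
    C.vert i p = (C.clique i).orderEmbOfFin rfl ⟨p, hp⟩ := dif_pos hp

theorem mem_clique_iff (u : Fin n) :
    u ∈ C.clique i ↔ ∃ p < (C.clique i).card, C.vert i p = u := by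
  constructor
  · intro hu
    have h := Finset.range_orderEmbOfFin (C.clique i) rfl
    obtain ⟨p, hp⟩ := h.symm.subset (Finset.mem_coe.2 hu)
    exact ⟨p, p.2, by rw [vert_of_lt p.2]; exact hp⟩
  · rintro ⟨p, hp, rfl⟩
    rw [vert_of_lt hp]
    exact Finset.orderEmbOfFin_mem _ _ _

theorem vert_mem (hp : p < (C.clique i).card) : C.vert i p ∈ C.clique i :=
  (mem_clique_iff _).2 ⟨p, hp, rfl⟩

theorem vert_injective (hp : p < (C.clique i).card) (hq : q < (C.clique i).card)
    (h : C.vert i p = C.vert i q) : p = q := by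
  rw [vert_of_lt hp, vert_of_lt hq] at h
  exact congrArg Fin.val (((C.clique i).orderEmbOfFin rfl).injective h)

theorem real_vert (D : TreeCode (C.clique i).card) (hp : p < (C.clique i).card)
    (h : C.vert i p ∈ C.clique i) : D.real ⟨C.vert i p, h⟩ = D.label ⟨p, hp⟩ := by
  rw [TreeCode.real]
  congr 1
  rw [OrderIso.symm_apply_eq]
  apply Subtype.ext
  rw [Finset.coe_orderIsoOfFin_apply]
  exact vert_of_lt hp

theorem row_ne_zero (A : Finset (Fin n)) (hp : p < (C.clique i).card) :
    (C.row i A).getD p 0 ≠ 0 ↔ C.vert i p ∈ A := by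
  rw [row, List.getD_eq_getElem _ _ (by simpa using hp), List.getElem_ofFn, vert_of_lt hp]
  simp

end Vert

end RootedCliqueTree

/-! ### Correctness of the algorithm for a leaf -/

namespace RAM.Leaf

open RootedCliqueTree

variable {n : ℕ} {G : SimpleGraph (Fin n)} {C : RootedCliqueTree G} {i : Fin C.size}
  [Nonempty (Fin n)] {σ : ℕ → ℕ} {p : ℕ}

theorem isSep_localData (hp : p < (C.clique i).card) :
    IsSep (C.localData i) p ↔ C.vert i p ∈ C.sep i := by
  rw [IsSep, localData, List.append_assoc, List.append_assoc,
    List.getD_append_right _ _ _ _ (by simp), show 2 + p -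
      [(C.clique i).card, (C.traces i).length].length = p by simp,
    List.getD_append _ _ _ _ (by rwa [length_row]), row_ne_zero _ hp]

theorem isFreeSep_localData (h0 : σ 0 = (C.clique i).card) (hp : p < (C.clique i).card) :
    IsFreeSep (C.localData i) σ p ↔ C.vert i p ∈ C.freeSep i := by
  rw [IsFreeSep, localData, List.append_assoc,
    List.getD_append_right _ _ _ _ (by simp [length_row, h0]; omega), h0,
    show 2 + (C.clique i).card + p -
      ([(C.clique i).card, (C.traces i).length] ++ C.row i (C.sep i)).length = p by
        simp [length_row]; omega,
    List.getD_append _ _ _ _ (by rwa [length_row]), row_ne_zero _ hp]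

theorem inTrace_localData (h0 : σ 0 = (C.clique i).card) (hp : p < (C.clique i).card) {j : ℕ}
    (hj : j < (C.traces i).length) :
    InTrace (C.localData i) σ j p ↔ C.vert i p ∈ (C.traces i)[j] := by
  rw [InTrace, localData, List.getD_append_right _ _ _ _ (by simp [length_row, h0]; omega), h0,
    show 2 + (C.clique i).card + (C.clique i).card + j * (C.clique i).card + p -
      ([(C.clique i).card, (C.traces i).length] ++ C.row i (C.sep i) ++
        C.row i (C.freeSep i)).length = j * (C.clique i).card + p by
        simp [length_row]; omega,
    List.getD_flatMap_uniform _ _ _ _ (fun A _ => length_row A) j p hj hp, row_ne_zero _ hp]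

theorem exists_trace_iff (h0 : σ 0 = (C.clique i).card) {B : Set (Fin n)}
    (hB : B ⊆ C.clique i) :
    (∃ K', IsMaxClique G K' ∧ K' ≠ (C.clique i : Set (Fin n)) ∧
      (C.clique i : Set (Fin n)) ∩ K' = B) ↔
    ∃ j < (C.traces i).length, ∀ q < (C.clique i).card,
      InTrace (C.localData i) σ j q ↔ C.vert i q ∈ B := by
  classical
  have h := mem_traces (C := C) (i := i) B.toFinset
  rw [Set.coe_toFinset] at h
  rw [← h, List.mem_iff_getElem]
  refine exists_congr fun j => ⟨?_, ?_⟩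
  · rintro ⟨hj, e⟩
    refine ⟨hj, fun q hq => ?_⟩
    rw [inTrace_localData h0 hq hj, e, Set.mem_toFinset]
  · rintro ⟨hj, hall⟩
    refine ⟨hj, ?_⟩
    ext u
    rw [Set.mem_toFinset]
    have hsub : (C.traces i)[j] ⊆ C.clique i := by
      obtain ⟨K', -, -, e⟩ := (mem_traces _).1 (List.getElem_mem hj)
      rw [← Finset.coe_subset, ← e]
      exact Set.inter_subset_left
    have key : ∀ u ∈ C.clique i, (u ∈ (C.traces i)[j] ↔ u ∈ B) := by
      intro u hu
      obtain ⟨q, hq, rfl⟩ := (mem_clique_iff u).1 hu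
      rw [← hall q hq, inTrace_localData h0 hq hj]
    exact ⟨fun hu => (key u (hsub hu)).1 hu, fun hu => (key u (hB hu)).2 hu⟩

/-- A property of at most one vertex is given by its number, with `k` for no vertex. -/
theorem exists_number {k : ℕ} (P : ℕ → Prop) (hP : ∀ p < k, ∀ q < k, P p → P q → p = q) :
    ∃ a, a < k + 1 ∧ ∀ p < k, p = a ↔ P p := by
  by_cases h : ∃ a < k, P a
  · obtain ⟨a, ha, hPa⟩ := h
    refine ⟨a, by omega, fun p hp => ⟨?_, fun h => hP p hp a ha h hPa⟩⟩
    rintro rfl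
    exact hPa
  · refine ⟨k, by omega, fun p hp => ⟨fun e => by omega, fun hPp => absurd ⟨p, hp, hPp⟩ h⟩⟩

variable {W : Type*} {ρ : Fin n → W} {c : W}

theorem isPaired_iff (h0 : σ 0 = (C.clique i).card) (h1 : σ 1 = (C.traces i).length)
    (h5 : ∀ p < (C.clique i).card, p = σ 5 ↔ ρ (C.vert i p) = c) (hp : p < (C.clique i).card) :
    IsPaired (C.localData i) σ p ↔
      IsPairTrace G ρ (C.clique i : Set (Fin n)) c (C.vert i p) := by
  rw [IsPaired, h0, h1]
  constructor
  · rintro ⟨ha, hpa, j, hj, hall⟩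
    refine ⟨C.vert i (σ 5), (h5 _ ha).1 rfl, fun e => hpa (vert_injective hp ha e), ?_⟩
    refine (exists_trace_iff h0 ?_).2 ⟨j, hj, fun q hq => ?_⟩
    · rintro _ (rfl | rfl)
      exacts [vert_mem ha, vert_mem hp]
    · rw [hall q hq]
      refine or_congr ⟨?_, fun e => vert_injective hq ha e⟩ ⟨?_, fun e => vert_injective hq hp e⟩
      · rintro rfl
        rfl
      · rintro rfl
        rfl
  · rintro ⟨a, hac, hne, K', hK', hKne, e⟩
    have haK : a ∈ C.clique i := (e.symm.subset (Set.mem_insert _ _)).1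
    obtain ⟨q, hq, rfl⟩ := (mem_clique_iff a).1 haK
    obtain rfl : q = σ 5 := (h5 q hq).2 hac
    refine ⟨hq, fun e => hne (by rw [e]), ?_⟩
    obtain ⟨j, hj, hall⟩ := (exists_trace_iff (σ := σ) h0 (B := {C.vert i (σ 5), C.vert i p}) (by
      rintro _ (rfl | rfl)
      exacts [vert_mem hq, vert_mem hp])).1 ⟨K', hK', hKne, e⟩
    refine ⟨j, hj, fun r hr => (hall r hr).trans ?_⟩
    refine or_congr ⟨fun e => vert_injective hr hq e, ?_⟩ ⟨fun e => vert_injective hr hp e, ?_⟩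
    · rintro rfl
      rfl
    · rintro rfl
      rfl

/-- Pairs with the center are consulted only from mode `2` on, and a chosen trace only from mode `4`
on; the hypotheses on traces are restricted accordingly, because in the lower modes the list may
have been cut off. -/
theorem inBase_iff {X : Set (Fin n)} (h0 : σ 0 = (C.clique i).card)
    (h1 : 2 ≤ σ 9 → σ 1 = (C.traces i).length)
    (h5 : ∀ p < (C.clique i).card, p = σ 5 ↔ ρ (C.vert i p) = c)
    (h8 : 4 ≤ σ 9 → ∀ p < (C.clique i).card,
      InTrace (C.localData i) σ (σ 8) p ↔ C.vert i p ∈ X) (h9 : σ 9 < 6)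
    (hp : p < (C.clique i).card) :
    InBase (C.localData i) σ p ↔ C.vert i p ∈ baseSet (C.sep i : Set (Fin n))
      {v | IsFree G (C.sep i : Set (Fin n)) v}
      {v | IsPairTrace G ρ (C.clique i : Set (Fin n)) c v} X (σ 9) := by
  have hpair : 2 ≤ σ 9 → (IsPaired (C.localData i) σ p ↔
      IsPairTrace G ρ (C.clique i : Set (Fin n)) c (C.vert i p)) :=
    fun h => isPaired_iff h0 (h1 h) h5 hp
  have hcases : σ 9 = 0 ∨ σ 9 = 1 ∨ σ 9 = 2 ∨ σ 9 = 3 ∨ σ 9 = 4 ∨ σ 9 = 5 := by omega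
  rw [InBase, isSep_localData hp, isFreeSep_localData h0 hp, mem_freeSep]
  rcases hcases with h | h | h | h | h | h <;> rw [h] at hpair h8 ⊢
  · simp [baseSet]
  · simp [baseSet]
  · rw [hpair le_rfl]
    simp only [baseSet, Set.mem_ofPred_eq, Finset.mem_coe]
    simp
    tauto
  · rw [hpair (by omega)]
    simp [baseSet]
  · rw [h8 le_rfl p hp]
    simp [baseSet]
  · rw [h8 (by omega) p hp]
    simp [baseSet]

/-- The structural description of the spanned tree singles out one assignment of the loop
parameters, and the types computed from it are those of the tree. -/
theorem exists_steinerEquivalent (hi : C.IsLeaf i) {W : Type*} [Finite W] {T : SimpleGraph W}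
    {ρ : Fin n → W} (hT : IsWellStructured G T ρ) :
    ∃ D ∈ family (C.localData i) (init (C.clique i).card (min (C.traces i).length
        ((C.clique i).card * (C.clique i).card + 4))) (C.clique i).card,
      SteinerEquivalent (spanTree T (ρ '' (C.clique i : Set (Fin n)))) (fun v w => ρ v = (w : W))
        D.graph (fun v w => ∃ h : v ∈ C.clique i, D.real ⟨v, h⟩ = w) := by
  have hL := hi.isLeafClique
  have hroot := hT.root
  obtain ⟨c, hc⟩ := hL.exists_isLeafCenter hT
  obtain ⟨b, hb, m, X, e, hm, hm2, hm4, hlow⟩ := exists_baseSet hL hT hc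
  set k := (C.clique i).card with hk
  set t := min (C.traces i).length (k * k + 4) with ht
  have hinj : ∀ w, ∀ p < k, ∀ q < k, ρ (C.vert i p) = w → ρ (C.vert i q) = w → p = q :=
    fun w p hp q hq h h' => vert_injective hp hq (hroot.injective (h.trans h'.symm))
  obtain ⟨a, hak, ha⟩ := exists_number (k := k) (fun p => ρ (C.vert i p) = c) (hinj c)
  obtain ⟨b', hbk, hb'⟩ := exists_number (k := k) (fun p => ρ (C.vert i p) = b) (hinj b)
  obtain ⟨e', hek, he⟩ := exists_number (k := k) (fun p => e = some (C.vert i p))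
    fun p hp q hq h h' => vert_injective hp hq (Option.some.inj (h.symm.trans h'))
  -- If the mode uses traces, their number is within the cut-off, so none has been dropped.
  have htm : 2 ≤ m → t = (C.traces i).length := by
    intro h
    obtain ⟨Y, Z, hYZ⟩ := hm2 h
    exact min_eq_left (length_traces_le hYZ)
  -- The trace number is found before the final assignment is defined, so the claim is made for
  -- every assignment with the right value of variable `0`, the only one that the position in the
  -- word depends on.
  have hj : ∃ j, j < t + 1 ∧ ∀ σ : ℕ → ℕ, σ 0 = k → 4 ≤ m → ∀ p < k,
      InTrace (C.localData i) σ j p ↔ C.vert i p ∈ X := by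
    by_cases h : 4 ≤ m
    · obtain ⟨K', hK', hne, rfl⟩ := hm4 h
      obtain ⟨j, hj, hall⟩ := (exists_trace_iff (σ := fun _ => k) rfl
        Set.inter_subset_left).1 ⟨K', hK', hne, rfl⟩
      refine ⟨j, by rw [htm (by omega)]; omega, fun σ h0 _ p hp => ?_⟩
      rw [← hall p hp, InTrace, InTrace, h0]
    · exact ⟨0, by omega, fun _ _ h' => absurd h' h⟩
  obtain ⟨j, hjt, hj⟩ := hj
  set σ : ℕ → ℕ := Function.update (Function.update (Function.update (Function.update
    (Function.update (init k t) 5 a) 6 b') 7 e') 8 j) 9 m with hσ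
  have hmem : σ ∈ envs params (init k t) := by
    refine mem_envs_cons (v := a) (by simpa [init] using hak) ?_
    refine mem_envs_cons (v := b') (by simpa [init] using hbk) ?_
    refine mem_envs_cons (v := e') (by simpa [init] using hek) ?_
    refine mem_envs_cons (v := j) (by simpa [init] using hjt) ?_
    refine mem_envs_cons (v := m) (by simpa [init] using hm) ?_
    exact List.mem_singleton.2 rfl
  have s0 : σ 0 = k := by simp [hσ, init]
  have s1 : σ 1 = t := by simp [hσ, init]
  have s5 : σ 5 = a := by simp [hσ]
  have s6 : σ 6 = b' := by simp [hσ]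
  have s7 : σ 7 = e' := by simp [hσ]
  have s8 : σ 8 = j := by simp [hσ]
  have s9 : σ 9 = m := by simp [hσ]
  have hbase : ∀ p < k, InBase (C.localData i) σ p ↔ C.vert i p ∈ baseSet
      (C.sep i : Set (Fin n)) {v | IsFree G (C.sep i : Set (Fin n)) v}
      {v | IsPairTrace G ρ (C.clique i : Set (Fin n)) c v} X m := by
    intro p hp
    rw [← s9]
    exact inBase_iff s0 (by rw [s9, s1]; exact htm) (by rw [s5]; exact ha)
      (by rw [s8, s9]; exact hj σ s0) (by rw [s9]; exact hm) hp
  refine ⟨_, List.mem_map.2 ⟨σ, hmem, rfl⟩, ?_⟩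
  obtain ⟨φ, hφ⟩ := hb.exists_iso hc hroot k (C.vert i)
    (fun u => by rw [Finset.mem_coe]; exact mem_clique_iff u)
    (fun p hp q hq h => vert_injective hp hq h) (type (C.localData i) σ) (by
      intro p hp
      by_cases h1 : p = a
      · exact Or.inl ⟨(ha p hp).1 h1, by rw [type, if_pos (by rw [s5, h1])]⟩
      have h1' : ρ (C.vert i p) ≠ c := fun h => h1 ((ha p hp).2 h)
      by_cases h2 : p = b'
      · exact Or.inr (Or.inl ⟨(hb' p hp).1 h2, by
          rw [type, if_neg (by rwa [s5]), if_pos (by rw [s6, h2])]⟩)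
      have h2' : ρ (C.vert i p) ≠ b := fun h => h2 ((hb' p hp).2 h)
      have hiff := hlow (C.vert i p) (vert_mem hp) h1' h2'
      rw [← hbase p hp, ← he p hp, ← s7] at hiff
      rw [type, if_neg (by rwa [s5]), if_neg (by rwa [s6])]
      by_cases h3 : C.vert i p ∈ lowerSet T ρ c b
      · exact Or.inr (Or.inr (Or.inl ⟨h3, if_pos (hiff.1 h3)⟩))
      · rw [if_neg fun h => h3 (hiff.2 h)]
        by_cases h4 : C.vert i p ∈ C.sep i
        · exact Or.inr (Or.inr (Or.inr (Or.inl ⟨h1', h2', h3, h4,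
            if_pos ((isSep_localData hp).2 h4)⟩)))
        · exact Or.inr (Or.inr (Or.inr (Or.inr ⟨h1', h2', h3, h4,
            if_neg fun h => h4 ((isSep_localData hp).1 h)⟩))))
  have hsub : ρ '' (C.clique i : Set (Fin n)) ⊆ spanNodes T (ρ '' (C.clique i : Set (Fin n))) :=
    SimpleGraph.IsTree.subset_spanNodes T _
  refine ⟨φ, fun v w => ⟨fun hvw => ?_, ?_⟩⟩
  -- The span lies in the ball of radius two around `c`, so its real nodes are vertices of the
  -- clique and no foreign vertex has to be represented.
  · have hv : v ∈ C.clique i := by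
      rw [← Finset.mem_coe, hc.mem_iff, hvw]
      have hne : (ρ '' (C.clique i : Set (Fin n))).Nonempty := hL.isMax.nonempty.image ρ
      obtain ⟨_, ⟨u, hu, rfl⟩, hw⟩ :=
        (hroot.isTree.spanNodes_eq hne hc.mem_span).subset w.2
      have := (hc.mem_iff u).1 hu
      omega
    refine ⟨hv, ?_⟩
    obtain ⟨p, hp, rfl⟩ := (mem_clique_iff v).1 hv
    rw [real_vert _ hp, ← hφ ⟨p, hp⟩ (hsub ⟨_, hv, rfl⟩)]
    exact congrArg φ (Subtype.ext hvw)
  · rintro ⟨hv, h⟩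
    obtain ⟨p, hp, rfl⟩ := (mem_clique_iff v).1 hv
    rw [real_vert _ hp, ← hφ ⟨p, hp⟩ (hsub ⟨_, hv, rfl⟩)] at h
    exact congrArg Subtype.val (φ.injective h)

end RAM.Leaf

/-! ### Preprocessing and the family of trees for a leaf -/

theorem theorem6p3 :
    ∃ (pre alg : RAM.Prog) (p q : Polynomial ℕ),
      ∀ (n : ℕ) (G : SimpleGraph (Fin n)), G.Connected →
      ∀ (C : RootedCliqueTree G) (i : Fin C.size), C.IsLeaf i →
        RAM.OutputsWithin pre (C.input i) (C.localData i) (p.eval (C.input i).length) ∧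
        ∃ F : List (TreeCode (C.clique i).card),
          RAM.OutputsWithin alg (C.localData i) (TreeCode.encodeFamily F)
            (q.eval (C.clique i).card) ∧
          (∀ D ∈ F, IsSteinerRoot 4 (G.induce {v | v ∈ C.clique i}) D.graph D.real) ∧
          ∀ (W : Type) [Finite W] (T : SimpleGraph W) (ρ : Fin n → W),
            IsWellStructured G T ρ →
            ∃ D ∈ F, SteinerEquivalent
              (spanTree T (ρ '' (C.clique i : Set (Fin n)))) (fun v w => ρ v = (w : W))
              D.graph (fun v w => ∃ h : v ∈ C.clique i, D.real ⟨v, h⟩ = w) := by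
  refine ⟨RAM.Pre.prog, RAM.Leaf.prog, RAM.setVarsCost RAM.Pre.vars + RAM.Pre.body.cost,
    RAM.Leaf.cost, fun n G hG C i hi => ⟨RAM.Pre.outputsWithin_prog hi, _,
      RAM.Leaf.outputsWithin_prog (C.localData i), ?_, ?_⟩⟩
  · intro D hD
    obtain ⟨σ, -, rfl⟩ := List.mem_map.1 hD
    exact TreeCode.isSteinerRoot_ofTypes (C.isMaxClique i).1 (RAM.Leaf.typesValid _ _ _)
  · intro W _ T ρ hT
    have := hG.nonempty
    exact RAM.Leaf.exists_steinerEquivalent hi hT
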